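/- Let $\mathbb T=\mathbb R/2\pi\mathbb Z$ and let $v_n$ ($n\in\mathbb Z$) denote the Fourier coefficients of $v\in L^2(\mathbb T)$. Put $\phi(\bar n)=n_1^4-n_2^4+n_3^4-n^4$, $$\Gamma(n)=\{(n_1,n_2,n_3)\in\mathbb Z^3:\ n=n_1-n_2+n_3,\ n_1,n_3\neq n\},\qquad \Gamma_N(n)=\Gamma(n)\cap\{|n_1|,|n_2|,|n_3|\le N\}.$$ Consider, for $v:\mathbb R\to L^2(\mathbb T)$, the renormalized interaction-picture equation of the cubic fourth order NLS $$\partial_t v_n=-i\sum_{\Gamma(n)}e^{-i\phi(\bar n)t}v_{n_1}\overline{v_{n_2}}v_{n_3}+i|v_n|^2v_n,\qquad n\in\mathbb Z, \tag{1}$$ and, for $N\in\mathbb N$, its frequency truncation $$\partial_t v_n=\mathbf 1_{|n|\le N}\Big\{-i\sum_{\Gamma_N(n)}e^{-i\phi(\bar n)t}v_{n_1}\overline{v_{n_2}}v_{n_3}+i|v_n|^2v_n\Big\},\qquad n\in\mathbb Z. \tag{2}$$ A solution of (1) is a $v\in C(\mathbb R;L^2(\mathbb T))$ with $e^{-it\partial_x^4}v(t)\in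 L^4_{\mathrm{loc}}(\mathbb R;L^4(\mathbb T))$ which satisfies (1) integrated in time from $0$ to $t$, for every $t$ and $n$, the sum over $\Gamma(n)$ being understood as the limit as $K\to\infty$ of the time integrals of the sums over $\Gamma_K(n)$. A solution of (2) is a $v\in C(\mathbb R;L^2(\mathbb T))$ satisfying (2) for all $t$ and $n$. For every $u_0\in L^2(\mathbb T)$, each of (1) and (2) has exactly one solution with $v(0)=u_0$; let $\Psi(t)u_0$ and $\Psi_N(t)u_0$ denote their values at time $t$. Let $B_r$ be the ball of radius $r$ centred at $0$ in $L^2(\mathbb T)$. **Proposition.** Let $R>0$ and let $A\subset B_R$ be compact in $L^2(\mathbb T)$. Fix $t\in\mathbb R$. Then for every $\varepsilon>0$ there is $N_0\in\mathbb N$ such that $$\Psi(t)(A)\subset\Psi_N(t)(A+B_\varepsilon)\qquad\text{for all }N\ge N_0.$$ -/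

import Mathlib

open scoped Pointwise Topology ComplexConjugate

noncomputable section

namespace FourthOrderNLS

open MeasureTheory Filter

instance factTwoPiPos : Fact (0 < 2 * Real.pi) := ⟨Real.two_pi_pos⟩

/-- The torus `𝕋 = ℝ / 2πℤ`. -/
abbrev Torus : Type := AddCircle (2 * Real.pi)

/-- The complex Hilbert space `L²(𝕋)`. The measure is `dx / 2π`, so that the Fourier coefficients
`v_n = (1 / 2π) ∫ v(x) e^{-inx} dx` satisfy `‖v‖² = ∑ |v_n|²`. -/
abbrev L2 : Type := Lp ℂ 2 (AddCircle.haarAddCircle (T := 2 * Real.pi))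

/-- The phase `φ(n₁, n₂, n₃, n) = n₁⁴ - n₂⁴ + n₃⁴ - n⁴`. -/
def phase (n₁ n₂ n₃ n : ℤ) : ℤ := n₁ ^ 4 - n₂ ^ 4 + n₃ ^ 4 - n ^ 4

/-- The frequencies `n` with `|n| ≤ N`. -/
def freqs (N : ℕ) : Finset ℤ := Finset.Icc (-(N : ℤ)) N

/-- The truncated plane `Γ_N(n)` of all triples `(n₁, n₂, n₃)` with `n = n₁ - n₂ + n₃`,
`n₁ ≠ n`, `n₃ ≠ n` and `|n₁|, |n₂|, |n₃| ≤ N`. The full plane `Γ(n)` is the increasing union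
of these finite sets. -/
def planeTrunc (N : ℕ) (n : ℤ) : Finset (ℤ × ℤ × ℤ) :=
  (freqs N ×ˢ freqs N ×ˢ freqs N).filter
    fun p => n = p.1 - p.2.1 + p.2.2 ∧ p.1 ≠ n ∧ p.2.2 ≠ n

/-- The expression
`-i ∑_{Γ_N(n)} e^{-i φ t} v_{n₁} conj(v_{n₂}) v_{n₃} + i |v_n|² v_n`. -/
def nonlinearity (N : ℕ) (t : ℝ) (v : L2) (n : ℤ) : ℂ :=
  -Complex.I * (∑ p ∈ planeTrunc N n,
      Complex.exp (-Complex.I * (phase p.1 p.2.1 p.2.2 n : ℂ) * (t : ℂ)) *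
        (fourierCoeff v p.1 * conj (fourierCoeff v p.2.1) * fourierCoeff v p.2.2)) +
    Complex.I * ((‖fourierCoeff v n‖ ^ 2 : ℝ) : ℂ) * fourierCoeff v n

/-- `v` is a (global) solution in `C(ℝ; L²(𝕋))` of the frequency-truncated equation
`∂ₜ v_n = 1_{|n| ≤ N} { -i ∑_{Γ_N(n)} e^{-i φ t} v_{n₁} conj(v_{n₂}) v_{n₃} + i |v_n|² v_n }`,
`n ∈ ℤ`. -/
structure IsTruncatedSolution (N : ℕ) (v : ℝ → L2) : Prop where
  continuous : Continuous v
  equation : ∀ (n : ℤ) (t : ℝ), HasDerivAt (fun s => fourierCoeff (v s) n)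
    (if n ∈ freqs N then nonlinearity N t (v t) n else 0) t

/-- The Fourier partial sum `P_{≤K} u(t, x)` of `u(t) = S(t) v(t)`, `S(t) = e^{-i t ∂ₓ⁴}`, i.e.
`∑_{|n| ≤ K} e^{-i t n⁴} v_n(t) e^{inx}`. -/
def partialSum (v : ℝ → L2) (K : ℕ) (t : ℝ) (x : Torus) : ℂ :=
  ∑ n ∈ freqs K,
    Complex.exp (-Complex.I * (t : ℂ) * (n : ℂ) ^ 4) * fourierCoeff (v t) n * fourier n x

/-- `v` is a (global) solution of the renormalized equation in the interaction picture
`∂ₜ v_n = -i ∑_{Γ(n)} e^{-i φ t} v_{n₁} conj(v_{n₂}) v_{n₃} + i |v_n|² v_n`, `n ∈ ℤ`.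

* `v ∈ C(ℝ; L²(𝕋))`, and `u(t) = S(t) v(t)` is in `L⁴([-T, T] × 𝕋)` for every `T`. The latter is
  written as boundedness in `L⁴([-T, T] × 𝕋)` of the Fourier partial sums of `u` (the same thing,
  as the Dirichlet projections are uniformly bounded on `L⁴(𝕋)`).
* For `L²` data the sum over `Γ(n)` need not converge absolutely at a fixed time; the equation is
  understood in integrated (Duhamel) form, the sum over `Γ(n)` being the limit of the sums over
  `Γ_K(n)` as `K → ∞`. -/
structure IsSolution (v : ℝ → L2) : Prop where
  continuous : Continuous v
  memL4 : ∀ T : ℝ, 0 < T → ∃ C : ℝ, ∀ K : ℕ,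
    ∫ t in (-T)..T, ∫ x, ‖partialSum v K t x‖ ^ 4 ∂AddCircle.haarAddCircle ≤ C
  equation : ∀ (n : ℤ) (t : ℝ),
    Tendsto (fun K : ℕ => ∫ s in (0 : ℝ)..t, nonlinearity K s (v s) n) atTop
      (𝓝 (fourierCoeff (v t) n - fourierCoeff (v 0) n))

open Classical in
/-- The solution map of an evolution equation whose solutions are described by `Sol`: it sends
`u₀` to the value at time `t` of the solution that equals `u₀` at time `0` (and to `0` if there
is no such solution). -/
def solutionMap (Sol : (ℝ → L2) → Prop) (t : ℝ) (u₀ : L2) : L2 :=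
  if h : ∃ v, Sol v ∧ v 0 = u₀ then h.choose t else 0

/-- The flow `Ψ(t)` of the renormalized equation in the interaction picture. -/
def Psi (t : ℝ) : L2 → L2 := solutionMap IsSolution t

/-- The flow `Ψ_N(t)` of the frequency-truncated equation. -/
def PsiTrunc (N : ℕ) (t : ℝ) : L2 → L2 := solutionMap (IsTruncatedSolution N) t

end FourthOrderNLS

end

noncomputable section

namespace FourthOrderNLS

open MeasureTheory Filter

/-! Given `u₀ ∈ A` with solution `v` of (1), solve the truncated equation from time `t` with value
`v t`, obtaining `a`. Then `Ψ(t) u₀ = Ψ_N(t) (a 0)`, and it remains to bound `‖a 0 - v 0‖` uniformly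
over `A`. `IsFlow.exists_normSq_sub_le` bounds its square by a constant times the mass of `v t`
above frequency `N` plus `1/N`; by `IsFlow.exists_tail_le` that mass is at most the one of `u₀` plus
`O(1/N)`; and the tails of a compact set are uniformly small (`exists_forall_tail_lt`, Dini).

The estimates rest on integration by parts in time, without Bourgain spaces. On `n = n₁ - n₂ + n₃`
the phase factors, and `|φ| ≥ |n - n₁| |n - n₃| (n² + n₁² + n₂² + n₃²)`. The quadrilinear form with
weight `1 / (|n - n₁| |n - n₃|)` is bounded on `ℓ²` (`sum_quads_div_gap_le`). The remaining factor
gives both a gain `1/L`, when some frequency is at least of size `L`, and a weight `1 / max(1, |k|)`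
at any chosen frequency `k`. That weight is in `ℓ²`, so the factor that is differentiated need only
be controlled in `ℓ^∞`: it suffices that the coefficients have bounded variation in `ℓ^∞`.

This variation is at most the time integral of the `ℓ^∞` norm of the nonlinearity, hence is
controlled by the mass and the space-time `L⁴` norm. Conversely the `L⁴` norm is a resonant part,
controlled by the mass, plus the oscillating form, which is bounded through the variation. A small
parameter in Young's inequality closes this loop (`exists_apriori`).

For two solutions, write `b = a + w + h` with `w` the low-frequency difference and `h` the part of
`b` above `N`. In the energy identity for `w`, the terms with a second `w` are quadratic in the
difference and small on short intervals, and the terms with `h` gain `1/N`. Iterating over short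
intervals gives `exists_comparison`. The same comparison shows that truncated solutions form a
Cauchy sequence and converge to any solution with the same data, which yields existence, uniqueness
and mass conservation for (1). -/

/-! ### Non-resonant quadruples and the phase -/

/-- All `(n, n₁, n₂, n₃)` with `|n| ≤ K` and `(n₁, n₂, n₃) ∈ Γ_K(n)`. -/
def quads (K : ℕ) : Finset (Σ _ : ℤ, ℤ × ℤ × ℤ) :=
  (freqs K).sigma (planeTrunc K)

theorem mem_quads {K : ℕ} {q : Σ _ : ℤ, ℤ × ℤ × ℤ} :
    q ∈ quads K ↔ q.1 ∈ freqs K ∧ q.2.1 ∈ freqs K ∧ q.2.2.1 ∈ freqs K ∧ q.2.2.2 ∈ freqs K ∧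
      q.1 = q.2.1 - q.2.2.1 + q.2.2.2 ∧ q.2.1 ≠ q.1 ∧ q.2.2.2 ≠ q.1 := by
  simp only [quads, planeTrunc, Finset.mem_sigma, Finset.mem_filter, Finset.mem_product]
  tauto

/-- The phase of a quadruple. -/
def quadPhase (q : Σ _ : ℤ, ℤ × ℤ × ℤ) : ℤ := phase q.2.1 q.2.2.1 q.2.2.2 q.1

/-- The sum of the squares of the four frequencies. -/
def quadSize (q : Σ _ : ℤ, ℤ × ℤ × ℤ) : ℝ :=
  (q.1 : ℝ) ^ 2 + (q.2.1 : ℝ) ^ 2 + (q.2.2.1 : ℝ) ^ 2 + (q.2.2.2 : ℝ) ^ 2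

/-- The product `|n - n₁| |n - n₃|`. -/
def quadGap (q : Σ _ : ℤ, ℤ × ℤ × ℤ) : ℝ :=
  |(q.1 : ℝ) - q.2.1| * |(q.1 : ℝ) - q.2.2.2|

theorem quadGap_pos {K : ℕ} {q : Σ _ : ℤ, ℤ × ℤ × ℤ} (hq : q ∈ quads K) : 0 < quadGap q := by
  obtain ⟨-, -, -, -, -, h1, h3⟩ := mem_quads.1 hq
  have h1' : (q.1 : ℝ) - q.2.1 ≠ 0 := sub_ne_zero.2 (by exact_mod_cast h1.symm)
  have h3' : (q.1 : ℝ) - q.2.2.2 ≠ 0 := sub_ne_zero.2 (by exact_mod_cast h3.symm)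
  exact mul_pos (abs_pos.2 h1') (abs_pos.2 h3')

/-- Eliminating `n₂`, the phase equals `-(n - n₁)(n - n₃)` times the sum of the four squares plus
`2(n₁ + n₃)²`. -/
theorem quadGap_mul_quadSize_le {K : ℕ} {q : Σ _ : ℤ, ℤ × ℤ × ℤ} (hq : q ∈ quads K) :
    quadGap q * quadSize q ≤ |(quadPhase q : ℝ)| := by
  obtain ⟨-, -, -, -, h, -, -⟩ := mem_quads.1 hq
  obtain ⟨n, n₁, n₂, n₃⟩ := q
  simp only at h
  have h2 : n₂ = n₁ + n₃ - n := by omega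
  subst h2
  have hfac : (quadPhase ⟨n, n₁, n₁ + n₃ - n, n₃⟩ : ℝ) =
      -(((n : ℝ) - n₃) * ((n : ℝ) - n₁) * (quadSize ⟨n, n₁, n₁ + n₃ - n, n₃⟩
        + 2 * ((n₁ : ℝ) + n₃) ^ 2)) := by
    simp only [quadPhase, phase, quadSize]; push_cast; ring
  have hs : 0 ≤ quadSize ⟨n, n₁, n₁ + n₃ - n, n₃⟩ := by simp only [quadSize]; positivity
  rw [hfac, abs_neg, abs_mul, abs_mul, abs_of_nonneg (a := quadSize _ + _) (by positivity)]
  simp only [quadGap]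
  have : 0 ≤ |(n : ℝ) - n₃| * |(n : ℝ) - n₁| * (2 * ((n₁ : ℝ) + n₃) ^ 2) := by positivity
  nlinarith

/-- For quadruples of size below `L²` this gives `1 ≤ 2 L² / quadGap`, so low frequencies can be fed
into the same weighted sum as high ones. -/
theorem quadGap_le_quadSize {q : Σ _ : ℤ, ℤ × ℤ × ℤ} : quadGap q ≤ 2 * quadSize q := by
  simp only [quadGap, quadSize]
  have h1 := sq_abs ((q.1 : ℝ) - q.2.1)
  have h3 := sq_abs ((q.1 : ℝ) - q.2.2.2)
  nlinarith [sq_nonneg (|(q.1 : ℝ) - q.2.1| - |(q.1 : ℝ) - q.2.2.2|),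
    sq_nonneg ((q.1 : ℝ) + q.2.1), sq_nonneg ((q.1 : ℝ) + q.2.2.2), sq_nonneg (q.2.2.1 : ℝ)]

theorem one_le_quadSize {K : ℕ} {q : Σ _ : ℤ, ℤ × ℤ × ℤ} (hq : q ∈ quads K) :
    1 ≤ quadSize q := by
  obtain ⟨-, -, -, -, -, h1, -⟩ := mem_quads.1 hq
  have h : 1 ≤ q.1 ^ 2 + q.2.1 ^ 2 := by
    by_contra! h
    have e1 : q.1 = 0 := by nlinarith [sq_nonneg q.1, sq_nonneg q.2.1]
    have e2 : q.2.1 = 0 := by nlinarith [sq_nonneg q.1, sq_nonneg q.2.1]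
    exact h1 (by rw [e1, e2])
  have h' : (1 : ℝ) ≤ (q.1 : ℝ) ^ 2 + (q.2.1 : ℝ) ^ 2 := by exact_mod_cast h
  simp only [quadSize]; nlinarith [sq_nonneg (q.2.2.1 : ℝ), sq_nonneg (q.2.2.2 : ℝ)]

theorem quadPhase_ne_zero {K : ℕ} {q : Σ _ : ℤ, ℤ × ℤ × ℤ} (hq : q ∈ quads K) :
    (quadPhase q : ℝ) ≠ 0 := by
  rw [← abs_pos]
  have := quadGap_mul_quadSize_le hq
  have := mul_pos (quadGap_pos hq) (lt_of_lt_of_le one_pos (one_le_quadSize hq))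
  linarith

/-! ### The multilinear sum bound -/

/-- The sum of the inverse squares of the non-zero integers. -/
def invSqSum : ℝ := ∑' k : ℤ, ((k : ℝ) ^ 2)⁻¹

theorem summable_invSq : Summable fun k : ℤ => ((k : ℝ) ^ 2)⁻¹ := by
  simpa using Real.summable_one_div_int_pow.2 (one_lt_two)

theorem invSqSum_nonneg : 0 ≤ invSqSum := tsum_nonneg fun k => by positivity

theorem sum_invSq_le (s : Finset ℤ) : ∑ k ∈ s, ((k : ℝ) ^ 2)⁻¹ ≤ invSqSum :=
  summable_invSq.sum_le_tsum s fun k _ => by positivity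

/-- The term `k = m` contributes `0`, because `0⁻¹ = 0`. -/
theorem sum_invSq_sub_le (s : Finset ℤ) (m : ℤ) :
    ∑ k ∈ s, (((k : ℝ) - m) ^ 2)⁻¹ ≤ invSqSum := by
  have : ∑ k ∈ s, (((k : ℝ) - m) ^ 2)⁻¹ =
      ∑ k ∈ s.map (Equiv.subRight m).toEmbedding, ((k : ℝ) ^ 2)⁻¹ := by
    simp [Finset.sum_map]
  rw [this]; exact sum_invSq_le _

/-- A sum over a set of quadruples parametrized injectively by three integers, with the third
one summed against an inverse square. -/
theorem sum_sq_mul_sq_div_le {K : ℕ} (α β : ℤ → ℝ) {A B : ℝ}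
    (hα : ∑ n ∈ freqs K, α n ^ 2 ≤ A ^ 2) (hβ : ∑ n ∈ freqs K, β n ^ 2 ≤ B ^ 2)
    (x y z : (Σ _ : ℤ, ℤ × ℤ × ℤ) → ℤ)
    (hx : ∀ q ∈ quads K, x q ∈ freqs K) (hy : ∀ q ∈ quads K, y q ∈ freqs K)
    (hz : ∀ q ∈ quads K, z q ∈ freqs K)
    (hinj : Set.InjOn (fun q => (x q, y q, z q)) (quads K : Set (Σ _ : ℤ, ℤ × ℤ × ℤ))) :
    ∑ q ∈ quads K, (α (x q) * β (y q)) ^ 2 * (((z q : ℝ) - x q) ^ 2)⁻¹ ≤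
      invSqSum * (A * B) ^ 2 := by
  calc ∑ q ∈ quads K, (α (x q) * β (y q)) ^ 2 * (((z q : ℝ) - x q) ^ 2)⁻¹
      = ∑ p ∈ (quads K).image (fun q => (x q, y q, z q)),
          (α p.1 * β p.2.1) ^ 2 * (((p.2.2 : ℝ) - p.1) ^ 2)⁻¹ := by
        rw [Finset.sum_image hinj]
    _ ≤ ∑ p ∈ freqs K ×ˢ freqs K ×ˢ freqs K,
          (α p.1 * β p.2.1) ^ 2 * (((p.2.2 : ℝ) - p.1) ^ 2)⁻¹ := by
        refine Finset.sum_le_sum_of_subset_of_nonneg ?_ fun p _ _ => by positivity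
        intro p hp
        obtain ⟨q, hq, rfl⟩ := Finset.mem_image.1 hp
        simp only [Finset.mem_product]
        exact ⟨hx q hq, hy q hq, hz q hq⟩
    _ = ∑ i ∈ freqs K, ∑ j ∈ freqs K, (α i * β j) ^ 2 *
          ∑ k ∈ freqs K, (((k : ℝ) - i) ^ 2)⁻¹ := by
        simp only [Finset.sum_product, Finset.mul_sum]
    _ ≤ ∑ i ∈ freqs K, ∑ j ∈ freqs K, (α i * β j) ^ 2 * invSqSum := by
        gcongr with i _ j _
        exact sum_invSq_sub_le _ _
    _ = invSqSum * ((∑ i ∈ freqs K, α i ^ 2) * ∑ j ∈ freqs K, β j ^ 2) := by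
        rw [Finset.sum_mul_sum, Finset.mul_sum]
        refine Finset.sum_congr rfl fun i _ => ?_
        rw [Finset.mul_sum]
        exact Finset.sum_congr rfl fun j _ => by ring
    _ ≤ invSqSum * (A ^ 2 * B ^ 2) := by
        have := invSqSum_nonneg
        have : 0 ≤ ∑ j ∈ freqs K, β j ^ 2 := Finset.sum_nonneg fun _ _ => by positivity
        gcongr
    _ = invSqSum * (A * B) ^ 2 := by ring

/-- Cauchy–Schwarz between `a_{n₁} c_{n₃} / |n - n₁|` and `d_n b_{n₂} / |n - n₃|`. Three frequencies
determine the fourth, so each factor is a sum over three free integers: two carry `ℓ²` coefficients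
and the third (`n` in the first factor, `n₃` in the second) is summed against an inverse square. -/
theorem sum_quads_div_gap_le {K : ℕ} {a b c d : ℤ → ℝ} {A B C D : ℝ}
    (hA : 0 ≤ A) (hB : 0 ≤ B) (hC : 0 ≤ C) (hD : 0 ≤ D)
    (ha : ∑ n ∈ freqs K, a n ^ 2 ≤ A ^ 2) (hb : ∑ n ∈ freqs K, b n ^ 2 ≤ B ^ 2)
    (hc : ∑ n ∈ freqs K, c n ^ 2 ≤ C ^ 2) (hd : ∑ n ∈ freqs K, d n ^ 2 ≤ D ^ 2) :
    ∑ q ∈ quads K, a q.2.1 * b q.2.2.1 * c q.2.2.2 * d q.1 / quadGap q ≤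
      invSqSum * (A * B * C * D) := by
  have hinj1 : Set.InjOn (fun q : Σ _ : ℤ, ℤ × ℤ × ℤ => (q.2.1, q.2.2.2, q.1))
      (quads K : Set (Σ _ : ℤ, ℤ × ℤ × ℤ)) := by
    rintro ⟨n, n₁, n₂, n₃⟩ hq ⟨m, m₁, m₂, m₃⟩ hq' h
    obtain ⟨-, -, -, -, e, -, -⟩ := mem_quads.1 (Finset.mem_coe.1 hq)
    obtain ⟨-, -, -, -, e', -, -⟩ := mem_quads.1 (Finset.mem_coe.1 hq')
    simp only [Prod.mk.injEq] at h e e'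
    obtain ⟨rfl, rfl, rfl⟩ := h
    have : n₂ = m₂ := by omega
    rw [this]
  have hinj2 : Set.InjOn (fun q : Σ _ : ℤ, ℤ × ℤ × ℤ => (q.1, q.2.2.1, q.2.2.2))
      (quads K : Set (Σ _ : ℤ, ℤ × ℤ × ℤ)) := by
    rintro ⟨n, n₁, n₂, n₃⟩ hq ⟨m, m₁, m₂, m₃⟩ hq' h
    obtain ⟨-, -, -, -, e, -, -⟩ := mem_quads.1 (Finset.mem_coe.1 hq)
    obtain ⟨-, -, -, -, e', -, -⟩ := mem_quads.1 (Finset.mem_coe.1 hq')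
    simp only [Prod.mk.injEq] at h e e'
    obtain ⟨rfl, rfl, rfl⟩ := h
    have : n₁ = m₁ := by omega
    rw [this]
  have h1 := sum_sq_mul_sq_div_le a c ha hc (fun q => q.2.1) (fun q => q.2.2.2) (fun q => q.1)
    (fun q hq => (mem_quads.1 hq).2.1) (fun q hq => (mem_quads.1 hq).2.2.2.1)
    (fun q hq => (mem_quads.1 hq).1) hinj1
  have h2 := sum_sq_mul_sq_div_le d b hd hb (fun q => q.1) (fun q => q.2.2.1)
    (fun q => q.2.2.2) (fun q hq => (mem_quads.1 hq).1) (fun q hq => (mem_quads.1 hq).2.2.1)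
    (fun q hq => (mem_quads.1 hq).2.2.2.1) hinj2
  have hcs := Finset.sum_mul_sq_le_sq_mul_sq (quads K)
    (fun q => a q.2.1 * c q.2.2.2 * |(q.1 : ℝ) - q.2.1|⁻¹)
    (fun q => d q.1 * b q.2.2.1 * |(q.1 : ℝ) - q.2.2.2|⁻¹)
  have e : ∑ q ∈ quads K, a q.2.1 * b q.2.2.1 * c q.2.2.2 * d q.1 / quadGap q =
      ∑ q ∈ quads K, (a q.2.1 * c q.2.2.2 * |(q.1 : ℝ) - q.2.1|⁻¹) *
        (d q.1 * b q.2.2.1 * |(q.1 : ℝ) - q.2.2.2|⁻¹) := by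
    refine Finset.sum_congr rfl fun q _ => ?_
    rw [quadGap, div_eq_mul_inv, mul_inv]; ring
  rw [e]
  refine abs_le_of_sq_le_sq' ?_ (by have := invSqSum_nonneg; positivity) |>.2
  refine hcs.trans ?_
  have e1 : ∑ q ∈ quads K, (a q.2.1 * c q.2.2.2 * |(q.1 : ℝ) - q.2.1|⁻¹) ^ 2 =
      ∑ q ∈ quads K, (a q.2.1 * c q.2.2.2) ^ 2 * (((q.1 : ℝ) - q.2.1) ^ 2)⁻¹ := by
    refine Finset.sum_congr rfl fun q _ => ?_
    rw [mul_pow, inv_pow, sq_abs]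
  have e2 : ∑ q ∈ quads K, (d q.1 * b q.2.2.1 * |(q.1 : ℝ) - q.2.2.2|⁻¹) ^ 2 =
      ∑ q ∈ quads K, (d q.1 * b q.2.2.1) ^ 2 * (((q.2.2.2 : ℝ) - q.1) ^ 2)⁻¹ := by
    refine Finset.sum_congr rfl fun q _ => ?_
    rw [mul_pow, inv_pow, sq_abs, ← neg_sub, neg_sq]
  rw [e1, e2]
  calc _ ≤ (invSqSum * (A * C) ^ 2) * (invSqSum * (D * B) ^ 2) := by
        refine mul_le_mul h1 h2 (Finset.sum_nonneg fun _ _ => by positivity) ?_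
        have := invSqSum_nonneg; positivity
    _ = _ := by ring

/-! ### Uniform partitions of an interval -/

/-- The `j`-th point of the uniform partition of `[s, t]` into `m` pieces. -/
def part (s t : ℝ) (m j : ℕ) : ℝ := s + (t - s) * (((min j m : ℕ) : ℝ) / m)

theorem part_zero (s t : ℝ) (m : ℕ) : part s t m 0 = s := by simp [part]

theorem part_self (s t : ℝ) {m : ℕ} (hm : m ≠ 0) : part s t m m = t := by
  have : (m : ℝ) ≠ 0 := by exact_mod_cast hm
  simp [part, this]

/-- The `min j m` freezes the points after `j = m`, so that monotonicity and membership in `[s, t]`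
hold for all indices, as `HasVar` requires. -/
theorem part_mono {s t : ℝ} (hst : s ≤ t) (m : ℕ) : Monotone (part s t m) := by
  intro i j hij
  have : 0 ≤ t - s := sub_nonneg.2 hst
  have h : ((min i m : ℕ) : ℝ) ≤ (min j m : ℕ) := by exact_mod_cast min_le_min_right m hij
  unfold part; gcongr

theorem part_mem {s t : ℝ} (hst : s ≤ t) (m j : ℕ) : part s t m j ∈ Set.Icc s t := by
  have h0 : 0 ≤ t - s := sub_nonneg.2 hst
  have h1 : ((min j m : ℕ) : ℝ) / m ≤ 1 :=
    div_le_one_of_le₀ (by exact_mod_cast min_le_right j m) (by positivity)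
  have h2 : 0 ≤ ((min j m : ℕ) : ℝ) / m := by positivity
  constructor <;> unfold part <;> nlinarith

theorem part_succ_sub_le {s t : ℝ} (hst : s ≤ t) (m j : ℕ) :
    part s t m (j + 1) - part s t m j ≤ (t - s) / m := by
  have h0 : 0 ≤ t - s := sub_nonneg.2 hst
  have h : ((min (j + 1) m : ℕ) : ℝ) ≤ (min j m : ℕ) + 1 := by
    exact_mod_cast (by omega : min (j + 1) m ≤ min j m + 1)
  have : part s t m (j + 1) - part s t m j =
      (t - s) * ((((min (j + 1) m : ℕ) : ℝ) - (min j m : ℕ)) / m) := by unfold part; ring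
  rw [this, ← mul_div_assoc]
  gcongr
  nlinarith

/-- A continuous function oscillates little on the pieces of fine uniform partitions. -/
theorem eventually_part_oscillation {f : ℝ → ℂ} (hf : Continuous f) {s t : ℝ} (hst : s ≤ t)
    {ε : ℝ} (hε : 0 < ε) :
    ∀ᶠ m : ℕ in atTop, ∀ j, ∀ r ∈ Set.Icc (part s t m j) (part s t m (j + 1)),
      ‖f r - f (part s t m j)‖ ≤ ε ∧ ‖f r - f (part s t m (j + 1))‖ ≤ ε := by
  have huc := (isCompact_Icc (a := s) (b := t)).uniformContinuousOn_of_continuous hf.continuousOn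
  obtain ⟨δ, hδ, h⟩ := Metric.uniformContinuousOn_iff.1 huc ε hε
  have h2 : ∀ᶠ m : ℕ in atTop, (t - s) / (m : ℝ) < δ :=
    (tendsto_const_div_atTop_nhds_zero_nat (t - s)).eventually_lt_const hδ
  filter_upwards [h2] with m hm j r hr
  have h3 := part_succ_sub_le hst m j
  have hj := part_mem hst m j
  have hj' := part_mem hst m (j + 1)
  have hr' : r ∈ Set.Icc s t := ⟨hj.1.trans hr.1, hr.2.trans hj'.2⟩
  constructor
  · rw [← dist_eq_norm]
    refine (h r hr' _ hj ?_).le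
    rw [Real.dist_eq, abs_lt]; constructor <;> linarith [hr.1, hr.2]
  · rw [← dist_eq_norm]
    refine (h r hr' _ hj' ?_).le
    rw [Real.dist_eq, abs_lt]; constructor <;> linarith [hr.1, hr.2]

/-- Discrete integration by parts. It moves the difference onto `f` without differentiating it; in
the application `f` is a product of coefficients known only to be continuous and of bounded
variation. -/
theorem abel_sum (E f : ℕ → ℂ) (m : ℕ) :
    ∑ j ∈ Finset.range m, (E (j + 1) - E j) * f j =
      E m * f m - E 0 * f 0 - ∑ j ∈ Finset.range m, E (j + 1) * (f (j + 1) - f j) := by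
  induction m with
  | zero => simp
  | succ m ih => rw [Finset.sum_range_succ, Finset.sum_range_succ, ih]; ring

/-- Sums of increments of a primitive of `e` weighted by the values of `f` converge to the
integral of `e f`. -/
theorem tendsto_sum_increments {e E f : ℝ → ℂ} (he : Continuous e) (he1 : ∀ r, ‖e r‖ ≤ 1)
    (hE : ∀ r, HasDerivAt E (e r) r) (hf : Continuous f) {s t : ℝ} (hst : s ≤ t) :
    Tendsto (fun m : ℕ => ∑ j ∈ Finset.range m,
      (E (part s t m (j + 1)) - E (part s t m j)) * f (part s t m j)) atTop
      (𝓝 (∫ r in s..t, e r * f r)) := by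
  have hef : Continuous fun r => e r * f r := he.mul hf
  have hec : ∀ c : ℂ, Continuous fun r => e r * c := fun c => he.mul continuous_const
  rw [Metric.tendsto_nhds]
  intro ε hε
  have hε' : 0 < ε / (t - s + 1) := div_pos hε (by linarith)
  filter_upwards [eventually_part_oscillation hf hst hε', eventually_ne_atTop 0] with m hm hm0
  have hsum : ∫ r in s..t, e r * f r =
      ∑ j ∈ Finset.range m, ∫ r in part s t m j..part s t m (j + 1), e r * f r := by
    rw [intervalIntegral.sum_integral_adjacent_intervals
      fun k _ => hef.intervalIntegrable _ _, part_zero, part_self s t hm0]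
  have hlen : ∑ j ∈ Finset.range m, (part s t m (j + 1) - part s t m j) = t - s := by
    rw [Finset.sum_range_sub, part_zero, part_self s t hm0]
  rw [hsum, dist_eq_norm, ← Finset.sum_sub_distrib]
  calc _ ≤ ∑ j ∈ Finset.range m,
        ε / (t - s + 1) * (part s t m (j + 1) - part s t m j) := by
        refine norm_sum_le_of_le _ fun j _ => ?_
        have hle := part_mono hst m (Nat.le_succ j)
        have h1 : E (part s t m (j + 1)) - E (part s t m j) =
            ∫ r in part s t m j..part s t m (j + 1), e r :=
          (intervalIntegral.integral_eq_sub_of_hasDerivAt (fun r _ => hE r)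
            (he.intervalIntegrable _ _)).symm
        rw [h1, ← intervalIntegral.integral_mul_const, ← intervalIntegral.integral_sub
          ((hec _).intervalIntegrable _ _) (hef.intervalIntegrable _ _)]
        refine (intervalIntegral.norm_integral_le_of_norm_le_const fun r hr => ?_).trans_eq
          (by rw [abs_of_nonneg (sub_nonneg.2 hle)])
        rw [Set.uIoc_of_le hle] at hr
        rw [← mul_sub, norm_mul, norm_sub_rev]
        calc _ ≤ 1 * (ε / (t - s + 1)) := by
              gcongr
              · exact he1 r
              · exact (hm j r ⟨hr.1.le, hr.2⟩).1
          _ = _ := one_mul _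
    _ = ε / (t - s + 1) * (t - s) := by rw [← Finset.mul_sum, hlen]
    _ < ε := by
        rw [div_mul_eq_mul_div, div_lt_iff₀ (by linarith)]
        nlinarith

/-! ### Variation of a family of coefficients -/

/-- The variation of `a` on `[s, t]`, as a curve in `ℓ^∞`, is at most `Y`: at each step of a
partition the increment of an arbitrary coefficient may be taken. -/
def HasVar (a : ℝ → ℤ → ℂ) (s t Y : ℝ) : Prop :=
  ∀ (m : ℕ) (u : ℕ → ℝ), Monotone u → (∀ j, u j ∈ Set.Icc s t) → ∀ ν : ℕ → ℤ,
    ∑ j ∈ Finset.range m, ‖a (u (j + 1)) (ν j) - a (u j) (ν j)‖ ≤ Y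

theorem HasVar.mono {a : ℝ → ℤ → ℂ} {s t s' t' Y Y' : ℝ} (h : HasVar a s t Y)
    (hs : s ≤ s') (ht : t' ≤ t) (hY : Y ≤ Y') : HasVar a s' t' Y' :=
  fun m u hu hmem ν =>
    (h m u hu (fun j => ⟨hs.trans (hmem j).1, (hmem j).2.trans ht⟩) ν).trans hY

/-- At each step the selector `ν` picks the frequency `|n| ≤ K` with the largest increment; the
resulting sup bounds are still summable to `Y`. -/
theorem HasVar.exists_bound {a : ℝ → ℤ → ℂ} {s t Y : ℝ} (h : HasVar a s t Y) (K m : ℕ)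
    {u : ℕ → ℝ} (hu : Monotone u) (hmem : ∀ j, u j ∈ Set.Icc s t) :
    ∃ β : ℕ → ℝ, (∀ j, 0 ≤ β j) ∧ (∀ j, ∀ n ∈ freqs K, ‖a (u (j + 1)) n - a (u j) n‖ ≤ β j) ∧
      ∑ j ∈ Finset.range m, β j ≤ Y := by
  have hne : (freqs K).Nonempty := ⟨0, by simp [freqs]⟩
  choose ν hν using fun j : ℕ =>
    Finset.exists_max_image (freqs K) (fun n => ‖a (u (j + 1)) n - a (u j) n‖) hne
  exact ⟨fun j => ‖a (u (j + 1)) (ν j) - a (u j) (ν j)‖, fun j => norm_nonneg _,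
    fun j n hn => (hν j).2 n hn, h m u hu hmem ν⟩

/-! ### The non-resonant quadrilinear form -/

/-- The mass of the frequencies `|n| ≤ K`. -/
def mass (K : ℕ) (x : ℤ → ℂ) : ℝ := ∑ n ∈ freqs K, ‖x n‖ ^ 2

theorem mass_nonneg (K : ℕ) (x : ℤ → ℂ) : 0 ≤ mass K x :=
  Finset.sum_nonneg fun _ _ => by positivity

/-- The product `a_{n₁} conj(b_{n₂}) c_{n₃} conj(d_n)`. -/
def quadProd (a b c d : ℤ → ℂ) (q : Σ _ : ℤ, ℤ × ℤ × ℤ) : ℂ :=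
  a q.2.1 * conj (b q.2.2.1) * c q.2.2.2 * conj (d q.1)

/-- The oscillating factor `e^{-iφt}` of a quadruple. -/
def quadExp (t : ℝ) (q : Σ _ : ℤ, ℤ × ℤ × ℤ) : ℂ :=
  Complex.exp (-Complex.I * (quadPhase q : ℂ) * (t : ℂ))

/-- The sum of `e^{-iφt} a_{n₁} conj(b_{n₂}) c_{n₃} conj(d_n)` over the quadruples with
frequencies at most `K`. -/
def quartSum (K : ℕ) (t : ℝ) (a b c d : ℤ → ℂ) : ℂ :=
  ∑ q ∈ quads K, quadExp t q * quadProd a b c d q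

theorem norm_quadProd (a b c d : ℤ → ℂ) (q : Σ _ : ℤ, ℤ × ℤ × ℤ) :
    ‖quadProd a b c d q‖ = ‖a q.2.1‖ * ‖b q.2.2.1‖ * ‖c q.2.2.2‖ * ‖d q.1‖ := by
  simp [quadProd]

theorem norm_quadExp (t : ℝ) (q : Σ _ : ℤ, ℤ × ℤ × ℤ) : ‖quadExp t q‖ = 1 := by
  have : -Complex.I * (quadPhase q : ℂ) * (t : ℂ) =
      ((-(quadPhase q * t) : ℝ) : ℂ) * Complex.I := by push_cast; ring
  rw [quadExp, this, Complex.norm_exp_ofReal_mul_I]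

theorem continuous_quadExp (q : Σ _ : ℤ, ℤ × ℤ × ℤ) : Continuous fun t => quadExp t q := by
  unfold quadExp; fun_prop

theorem continuous_quadProd {a b c d : ℝ → ℤ → ℂ} (ha : ∀ n, Continuous fun r => a r n)
    (hb : ∀ n, Continuous fun r => b r n) (hc : ∀ n, Continuous fun r => c r n)
    (hd : ∀ n, Continuous fun r => d r n) (q : Σ _ : ℤ, ℤ × ℤ × ℤ) :
    Continuous fun r => quadProd (a r) (b r) (c r) (d r) q := by
  unfold quadProd
  exact (((ha _).mul (Complex.continuous_conj.comp (hb _))).mul (hc _)).mul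
    (Complex.continuous_conj.comp (hd _))

theorem continuous_quartSum {a b c d : ℝ → ℤ → ℂ} (ha : ∀ n, Continuous fun r => a r n)
    (hb : ∀ n, Continuous fun r => b r n) (hc : ∀ n, Continuous fun r => c r n)
    (hd : ∀ n, Continuous fun r => d r n) (K : ℕ) :
    Continuous fun r => quartSum K r (a r) (b r) (c r) (d r) := by
  unfold quartSum
  exact continuous_finsetSum _ fun q _ =>
    (continuous_quadExp q).mul (continuous_quadProd ha hb hc hd q)

theorem norm_quadProd_sub_le (a b c d a' b' c' d' : ℤ → ℂ) (q : Σ _ : ℤ, ℤ × ℤ × ℤ) :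
    ‖quadProd a' b' c' d' q - quadProd a b c d q‖ ≤
      ‖a' q.2.1 - a q.2.1‖ * ‖b q.2.2.1‖ * ‖c q.2.2.2‖ * ‖d q.1‖ +
      ‖a' q.2.1‖ * ‖b' q.2.2.1 - b q.2.2.1‖ * ‖c q.2.2.2‖ * ‖d q.1‖ +
      ‖a' q.2.1‖ * ‖b' q.2.2.1‖ * ‖c' q.2.2.2 - c q.2.2.2‖ * ‖d q.1‖ +
      ‖a' q.2.1‖ * ‖b' q.2.2.1‖ * ‖c' q.2.2.2‖ * ‖d' q.1 - d q.1‖ := by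
  have e : quadProd a' b' c' d' q - quadProd a b c d q =
      quadProd (a' - a) b c d q + quadProd a' (b' - b) c d q + quadProd a' b' (c' - c) d q +
        quadProd a' b' c' (d' - d) q := by
    simp only [quadProd, Pi.sub_apply, map_sub]; ring
  rw [e]
  refine (norm_add_le _ _).trans (add_le_add ((norm_add_le _ _).trans
    (add_le_add ((norm_add_le _ _).trans (add_le_add ?_ ?_)) ?_)) ?_)
  all_goals rw [norm_quadProd]; rfl

/-! ### Sums against the inverse phase -/

/-- The constant of the oscillatory estimates. -/
def oscConst : ℝ := invSqSum * (1 + invSqSum)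

theorem oscConst_nonneg : 0 ≤ oscConst := by
  have := invSqSum_nonneg; unfold oscConst; positivity

theorem invSqSum_le_oscConst : invSqSum ≤ oscConst := by
  have := invSqSum_nonneg; unfold oscConst; nlinarith

/-- The weight `1 / max(1, |n|)`. -/
def freqWeight (n : ℤ) : ℝ := (max 1 |(n : ℝ)|)⁻¹

theorem freqWeight_pos (n : ℤ) : 0 < freqWeight n := by unfold freqWeight; positivity

/-- Square summability of the weight is what converts an `ℓ^∞` bound on an increment into the `ℓ²`
bound needed in `sum_quads_div_gap_le`. -/
theorem sum_freqWeight_sq_le (K : ℕ) :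
    ∑ n ∈ freqs K, freqWeight n ^ 2 ≤ (1 + invSqSum) ^ 2 := by
  have h0 := invSqSum_nonneg
  calc ∑ n ∈ freqs K, freqWeight n ^ 2
      ≤ ∑ n ∈ freqs K, ((if n = 0 then 1 else 0) + ((n : ℝ) ^ 2)⁻¹) := by
        refine Finset.sum_le_sum fun n _ => ?_
        by_cases hn : n = 0
        · subst hn; simp [freqWeight]
        · have : 0 < |(n : ℝ)| := by simpa using hn
          rw [if_neg hn, zero_add, freqWeight, inv_pow, ← sq_abs (n : ℝ)]
          gcongr
          exact le_max_right _ _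
    _ ≤ 1 + invSqSum := by
        rw [Finset.sum_add_distrib]
        refine add_le_add ?_ (sum_invSq_le _)
        rw [Finset.sum_ite_eq' ]
        split_ifs <;> norm_num
    _ ≤ _ := by nlinarith

theorem sq_out_le_quadSize (q : Σ _ : ℤ, ℤ × ℤ × ℤ) : (q.1 : ℝ) ^ 2 ≤ quadSize q := by
  simp only [quadSize]
  nlinarith [sq_nonneg (q.1 : ℝ), sq_nonneg (q.2.1 : ℝ), sq_nonneg (q.2.2.1 : ℝ),
    sq_nonneg (q.2.2.2 : ℝ)]

theorem sq_fst_le_quadSize (q : Σ _ : ℤ, ℤ × ℤ × ℤ) : (q.2.1 : ℝ) ^ 2 ≤ quadSize q := by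
  simp only [quadSize]
  nlinarith [sq_nonneg (q.1 : ℝ), sq_nonneg (q.2.1 : ℝ), sq_nonneg (q.2.2.1 : ℝ),
    sq_nonneg (q.2.2.2 : ℝ)]

theorem sq_snd_le_quadSize (q : Σ _ : ℤ, ℤ × ℤ × ℤ) : (q.2.2.1 : ℝ) ^ 2 ≤ quadSize q := by
  simp only [quadSize]
  nlinarith [sq_nonneg (q.1 : ℝ), sq_nonneg (q.2.1 : ℝ), sq_nonneg (q.2.2.1 : ℝ),
    sq_nonneg (q.2.2.2 : ℝ)]

theorem sq_trd_le_quadSize (q : Σ _ : ℤ, ℤ × ℤ × ℤ) : (q.2.2.2 : ℝ) ^ 2 ≤ quadSize q := by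
  simp only [quadSize]
  nlinarith [sq_nonneg (q.1 : ℝ), sq_nonneg (q.2.1 : ℝ), sq_nonneg (q.2.2.1 : ℝ),
    sq_nonneg (q.2.2.2 : ℝ)]

/-- `quadSize` dominates both `L²` and `max(1, |k|)²`, hence their geometric mean `L · max(1, |k|)`:
half of the decay becomes the gain `L⁻¹`, the other half the weight at `k`. -/
theorem inv_phase_le {K : ℕ} {q : Σ _ : ℤ, ℤ × ℤ × ℤ} (hq : q ∈ quads K) {L : ℝ} (hL : 1 ≤ L)
    (hLq : L ^ 2 ≤ quadSize q) (k : ℤ) (hk : (k : ℝ) ^ 2 ≤ quadSize q) :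
    |(quadPhase q : ℝ)|⁻¹ ≤ L⁻¹ * (freqWeight k / quadGap q) := by
  have hg := quadGap_pos hq
  have h1 := quadGap_mul_quadSize_le hq
  have hm : L * max 1 |(k : ℝ)| ≤ quadSize q := by
    have : (max 1 |(k : ℝ)|) ^ 2 ≤ quadSize q := by
      rcases max_cases 1 |(k : ℝ)| with ⟨e, -⟩ | ⟨e, -⟩ <;> rw [e]
      · simpa using one_le_quadSize hq
      · rwa [sq_abs]
    nlinarith [sq_nonneg (L - max 1 |(k : ℝ)|)]
  rw [freqWeight, div_eq_mul_inv, ← mul_inv, ← mul_inv]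
  have : 0 < max 1 |(k : ℝ)| := by positivity
  gcongr
  nlinarith

/-- The selector `i` says which of the four frequencies receives the weight. -/
theorem sum_high_div_phase_le {K : ℕ} {L : ℝ} (hL : 1 ≤ L) {a b c d : ℤ → ℝ}
    (i : (Σ _ : ℤ, ℤ × ℤ × ℤ) → ℤ) (hi : ∀ q, (i q : ℝ) ^ 2 ≤ quadSize q)
    (ha0 : ∀ n, 0 ≤ a n) (hb0 : ∀ n, 0 ≤ b n) (hc0 : ∀ n, 0 ≤ c n) (hd0 : ∀ n, 0 ≤ d n)
    {S : ℝ} (h : ∑ q ∈ quads K, a q.2.1 * b q.2.2.1 * c q.2.2.2 * d q.1 *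
      freqWeight (i q) / quadGap q ≤ S) :
    ∑ q ∈ quads K with L ^ 2 ≤ quadSize q,
      a q.2.1 * b q.2.2.1 * c q.2.2.2 * d q.1 * |(quadPhase q : ℝ)|⁻¹ ≤ L⁻¹ * S := by
  have hL0 : 0 < L := by linarith
  calc _ ≤ ∑ q ∈ quads K with L ^ 2 ≤ quadSize q,
        L⁻¹ * (a q.2.1 * b q.2.2.1 * c q.2.2.2 * d q.1 * freqWeight (i q) / quadGap q) := by
        refine Finset.sum_le_sum fun q hq => ?_
        obtain ⟨hq, hs⟩ := Finset.mem_filter.1 hq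
        have h1 := inv_phase_le hq hL hs (i q) (hi q)
        have h2 : 0 ≤ a q.2.1 * b q.2.2.1 * c q.2.2.2 * d q.1 :=
          mul_nonneg (mul_nonneg (mul_nonneg (ha0 _) (hb0 _)) (hc0 _)) (hd0 _)
        calc _ ≤ a q.2.1 * b q.2.2.1 * c q.2.2.2 * d q.1 *
              (L⁻¹ * (freqWeight (i q) / quadGap q)) := mul_le_mul_of_nonneg_left h1 h2
          _ = _ := by ring
    _ ≤ ∑ q ∈ quads K,
        L⁻¹ * (a q.2.1 * b q.2.2.1 * c q.2.2.2 * d q.1 * freqWeight (i q) / quadGap q) := by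
        refine Finset.sum_le_sum_of_subset_of_nonneg (Finset.filter_subset _ _) fun q hq _ => ?_
        have h2 : 0 ≤ a q.2.1 * b q.2.2.1 * c q.2.2.2 * d q.1 :=
          mul_nonneg (mul_nonneg (mul_nonneg (ha0 _) (hb0 _)) (hc0 _)) (hd0 _)
        have := quadGap_pos hq
        have := freqWeight_pos (i q)
        positivity
    _ ≤ _ := by rw [← Finset.mul_sum]; gcongr

theorem sum_sq_mul_freqWeight_le {K : ℕ} {x : ℤ → ℝ} {β : ℝ} (hx0 : ∀ n, 0 ≤ x n)
    (hx : ∀ n ∈ freqs K, x n ≤ β) :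
    ∑ n ∈ freqs K, (x n * freqWeight n) ^ 2 ≤ (β * (1 + invSqSum)) ^ 2 := by
  calc _ ≤ ∑ n ∈ freqs K, β ^ 2 * freqWeight n ^ 2 := by
        refine Finset.sum_le_sum fun n hn => ?_
        rw [mul_pow]
        have := hx0 n
        have := hx n hn
        gcongr
    _ ≤ β ^ 2 * (1 + invSqSum) ^ 2 := by
        rw [← Finset.mul_sum]; gcongr; exact sum_freqWeight_sq_le K
    _ = _ := by ring

/-- The difference of products telescopes into four terms, each with one increment known only in
`ℓ^∞`. The weight is placed at the frequency of that increment; the other three factors are bounded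
in `ℓ²`. -/
theorem sum_high_increment_le {K : ℕ} {L : ℝ} (hL : 1 ≤ L) {a b c d a' b' c' d' : ℤ → ℂ}
    {A B C D α β γ δ : ℝ} (hA : 0 ≤ A) (hB : 0 ≤ B) (hC : 0 ≤ C) (hD : 0 ≤ D)
    (hα : 0 ≤ α) (hβ : 0 ≤ β) (hγ : 0 ≤ γ) (hδ : 0 ≤ δ)
    (hb : mass K b ≤ B ^ 2) (hc : mass K c ≤ C ^ 2) (hd : mass K d ≤ D ^ 2)
    (ha' : mass K a' ≤ A ^ 2) (hb' : mass K b' ≤ B ^ 2) (hc' : mass K c' ≤ C ^ 2)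
    (hda : ∀ n ∈ freqs K, ‖a' n - a n‖ ≤ α) (hdb : ∀ n ∈ freqs K, ‖b' n - b n‖ ≤ β)
    (hdc : ∀ n ∈ freqs K, ‖c' n - c n‖ ≤ γ) (hdd : ∀ n ∈ freqs K, ‖d' n - d n‖ ≤ δ) :
    ∑ q ∈ quads K with L ^ 2 ≤ quadSize q,
      ‖quadProd a' b' c' d' q - quadProd a b c d q‖ * |(quadPhase q : ℝ)|⁻¹ ≤
    L⁻¹ * (oscConst * (α * (B * C * D) + A * (β * (C * D)) + A * B * (γ * D) +
      A * B * C * δ)) := by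
  have hz := invSqSum_nonneg
  have hsplit : ∀ q ∈ (quads K).filter (fun q => L ^ 2 ≤ quadSize q),
      ‖quadProd a' b' c' d' q - quadProd a b c d q‖ * |(quadPhase q : ℝ)|⁻¹ ≤
      ‖a' q.2.1 - a q.2.1‖ * ‖b q.2.2.1‖ * ‖c q.2.2.2‖ * ‖d q.1‖ * |(quadPhase q : ℝ)|⁻¹ +
      ‖a' q.2.1‖ * ‖b' q.2.2.1 - b q.2.2.1‖ * ‖c q.2.2.2‖ * ‖d q.1‖ * |(quadPhase q : ℝ)|⁻¹ +
      ‖a' q.2.1‖ * ‖b' q.2.2.1‖ * ‖c' q.2.2.2 - c q.2.2.2‖ * ‖d q.1‖ * |(quadPhase q : ℝ)|⁻¹ +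
      ‖a' q.2.1‖ * ‖b' q.2.2.1‖ * ‖c' q.2.2.2‖ * ‖d' q.1 - d q.1‖ * |(quadPhase q : ℝ)|⁻¹ := by
    intro q _
    rw [← add_mul, ← add_mul, ← add_mul]
    gcongr
    exact norm_quadProd_sub_le a b c d a' b' c' d' q
  refine (Finset.sum_le_sum hsplit).trans ?_
  rw [Finset.sum_add_distrib, Finset.sum_add_distrib, Finset.sum_add_distrib]
  have h1 := sum_high_div_phase_le (K := K) hL (a := fun n => ‖a' n - a n‖) (b := fun n => ‖b n‖)
    (c := fun n => ‖c n‖) (d := fun n => ‖d n‖) (fun q => q.2.1) sq_fst_le_quadSize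
    (fun n => norm_nonneg _) (fun n => norm_nonneg _) (fun n => norm_nonneg _)
    (fun n => norm_nonneg _)
    (S := invSqSum * ((α * (1 + invSqSum)) * B * C * D)) (by
      refine le_trans (le_of_eq (Finset.sum_congr rfl fun q _ => ?_)) (sum_quads_div_gap_le
        (a := fun n => ‖a' n - a n‖ * freqWeight n) (b := fun n => ‖b n‖)
        (c := fun n => ‖c n‖) (d := fun n => ‖d n‖) (by positivity) hB hC hD
        (sum_sq_mul_freqWeight_le (fun n => norm_nonneg _) hda) hb hc hd)
      ring)
  have h2 := sum_high_div_phase_le (K := K) hL (a := fun n => ‖a' n‖)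
    (b := fun n => ‖b' n - b n‖)
    (c := fun n => ‖c n‖) (d := fun n => ‖d n‖) (fun q => q.2.2.1) sq_snd_le_quadSize
    (fun n => norm_nonneg _) (fun n => norm_nonneg _) (fun n => norm_nonneg _)
    (fun n => norm_nonneg _)
    (S := invSqSum * (A * (β * (1 + invSqSum)) * C * D)) (by
      refine le_trans (le_of_eq (Finset.sum_congr rfl fun q _ => ?_)) (sum_quads_div_gap_le
        (a := fun n => ‖a' n‖) (b := fun n => ‖b' n - b n‖ * freqWeight n)
        (c := fun n => ‖c n‖) (d := fun n => ‖d n‖) hA (by positivity) hC hD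
        ha' (sum_sq_mul_freqWeight_le (fun n => norm_nonneg _) hdb) hc hd)
      ring)
  have h3 := sum_high_div_phase_le (K := K) hL (a := fun n => ‖a' n‖) (b := fun n => ‖b' n‖)
    (c := fun n => ‖c' n - c n‖) (d := fun n => ‖d n‖) (fun q => q.2.2.2) sq_trd_le_quadSize
    (fun n => norm_nonneg _) (fun n => norm_nonneg _) (fun n => norm_nonneg _)
    (fun n => norm_nonneg _)
    (S := invSqSum * (A * B * (γ * (1 + invSqSum)) * D)) (by
      refine le_trans (le_of_eq (Finset.sum_congr rfl fun q _ => ?_)) (sum_quads_div_gap_le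
        (a := fun n => ‖a' n‖) (b := fun n => ‖b' n‖)
        (c := fun n => ‖c' n - c n‖ * freqWeight n) (d := fun n => ‖d n‖) hA hB (by positivity) hD
        ha' hb' (sum_sq_mul_freqWeight_le (fun n => norm_nonneg _) hdc) hd)
      ring)
  have h4 := sum_high_div_phase_le (K := K) hL (a := fun n => ‖a' n‖) (b := fun n => ‖b' n‖)
    (c := fun n => ‖c' n‖) (d := fun n => ‖d' n - d n‖) (fun q => q.1) sq_out_le_quadSize
    (fun n => norm_nonneg _) (fun n => norm_nonneg _) (fun n => norm_nonneg _)
    (fun n => norm_nonneg _)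
    (S := invSqSum * (A * B * C * (δ * (1 + invSqSum)))) (by
      refine le_trans (le_of_eq (Finset.sum_congr rfl fun q _ => ?_)) (sum_quads_div_gap_le
        (a := fun n => ‖a' n‖) (b := fun n => ‖b' n‖)
        (c := fun n => ‖c' n‖) (d := fun n => ‖d' n - d n‖ * freqWeight n) hA hB hC (by positivity)
        ha' hb' hc' (sum_sq_mul_freqWeight_le (fun n => norm_nonneg _) hdd))
      ring)
  refine (add_le_add (add_le_add (add_le_add h1 h2) h3) h4).trans_eq ?_
  unfold oscConst; ring

theorem sum_high_boundary_le {K : ℕ} {L : ℝ} (hL : 1 ≤ L) {a b c d : ℤ → ℂ} {A B C D : ℝ}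
    (hA : 0 ≤ A) (hB : 0 ≤ B) (hC : 0 ≤ C) (hD : 0 ≤ D)
    (ha : mass K a ≤ A ^ 2) (hb : mass K b ≤ B ^ 2) (hc : mass K c ≤ C ^ 2)
    (hd : mass K d ≤ D ^ 2) :
    ∑ q ∈ quads K with L ^ 2 ≤ quadSize q, ‖quadProd a b c d q‖ * |(quadPhase q : ℝ)|⁻¹ ≤
      L⁻¹ * (oscConst * (A * B * C * D)) := by
  simp only [norm_quadProd]
  refine sum_high_div_phase_le (a := fun n => ‖a n‖) (b := fun n => ‖b n‖)
    (c := fun n => ‖c n‖) (d := fun n => ‖d n‖) hL (fun q => q.1) sq_out_le_quadSize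
    (fun n => norm_nonneg _) (fun n => norm_nonneg _) (fun n => norm_nonneg _)
    (fun n => norm_nonneg _) ?_
  calc _ ≤ ∑ q ∈ quads K, ‖a q.2.1‖ * ‖b q.2.2.1‖ * ‖c q.2.2.2‖ * ‖d q.1‖ / quadGap q := by
        refine Finset.sum_le_sum fun q hq => ?_
        have := quadGap_pos hq
        have h1 : freqWeight q.1 ≤ 1 := inv_le_one_of_one_le₀ (le_max_left _ _)
        exact div_le_div_of_nonneg_right (mul_le_of_le_one_right (by positivity) h1) this.le
    _ ≤ invSqSum * (A * B * C * D) :=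
        sum_quads_div_gap_le (a := fun n => ‖a n‖) (b := fun n => ‖b n‖)
          (c := fun n => ‖c n‖) (d := fun n => ‖d n‖) hA hB hC hD ha hb hc hd
    _ ≤ _ := by gcongr; exact invSqSum_le_oscConst

/-! ### Integration by parts in time -/

/-- A family of continuous coefficients with bounds for its `ℓ²` norm and its variation. -/
structure Controlled (a : ℝ → ℤ → ℂ) (s t A Y : ℝ) : Prop where
  cont : ∀ n, Continuous fun r => a r n
  nonneg : 0 ≤ A
  mass_le : ∀ K, ∀ r ∈ Set.Icc s t, mass K (a r) ≤ A ^ 2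
  var : HasVar a s t Y

theorem Controlled.mono {a : ℝ → ℤ → ℂ} {s t s' t' A A' Y Y' : ℝ} (h : Controlled a s t A Y)
    (hs : s ≤ s') (ht : t' ≤ t) (hA : A ≤ A') (hY : Y ≤ Y') : Controlled a s' t' A' Y' where
  cont := h.cont
  nonneg := h.nonneg.trans hA
  mass_le K r hr := (h.mass_le K r ⟨hs.trans hr.1, hr.2.trans ht⟩).trans
    (by have := h.nonneg; gcongr)
  var := h.var.mono hs ht hY

theorem quadExp_hasDerivAt {q : Σ _ : ℤ, ℤ × ℤ × ℤ} (hq : (quadPhase q : ℝ) ≠ 0) (r : ℝ) :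
    HasDerivAt (fun r => quadExp r q / (-Complex.I * (quadPhase q : ℂ))) (quadExp r q) r := by
  have hne : -Complex.I * (quadPhase q : ℂ) ≠ 0 :=
    mul_ne_zero (neg_ne_zero.2 Complex.I_ne_zero) (by exact_mod_cast hq)
  have h1 : HasDerivAt (fun r : ℝ => -Complex.I * (quadPhase q : ℂ) * (r : ℂ))
      (-Complex.I * (quadPhase q : ℂ)) r := by
    simpa using (Complex.ofRealCLM.hasDerivAt (x := r)).const_mul (-Complex.I * (quadPhase q : ℂ))
  have h2 := (h1.cexp).div_const (-Complex.I * (quadPhase q : ℂ))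
  rwa [mul_div_assoc, div_self hne, mul_one] at h2

/-- Each integral is the limit of sums of increments of `e^{-iφr} / (-iφ)` against values of the
product. Abel summation leaves two boundary terms, whence `2ABCD`, and the increments of the
product; these are bounded on every partition by the four variations, uniformly in the mesh. -/
theorem norm_sum_high_integral_le {K : ℕ} {L : ℝ} (hL : 1 ≤ L) {a b c d : ℝ → ℤ → ℂ}
    {s t : ℝ} (hst : s ≤ t) {A B C D Ya Yb Yc Yd : ℝ} (ha : Controlled a s t A Ya)
    (hb : Controlled b s t B Yb) (hc : Controlled c s t C Yc) (hd : Controlled d s t D Yd) :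
    ‖∑ q ∈ quads K with L ^ 2 ≤ quadSize q,
      ∫ r in s..t, quadExp r q * quadProd (a r) (b r) (c r) (d r) q‖ ≤
    L⁻¹ * (oscConst * (2 * (A * B * C * D) + Ya * (B * C * D) + A * (Yb * (C * D)) +
      A * B * (Yc * D) + A * B * C * Yd)) := by
  have hosc := oscConst_nonneg
  have hL0 : 0 < L := by linarith
  have hA := ha.nonneg
  have hB := hb.nonneg
  have hC := hc.nonneg
  have hD := hd.nonneg
  have hlim : Tendsto (fun m : ℕ => ∑ q ∈ quads K with L ^ 2 ≤ quadSize q,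
      ∑ j ∈ Finset.range m,
        (quadExp (part s t m (j + 1)) q / (-Complex.I * (quadPhase q : ℂ)) -
          quadExp (part s t m j) q / (-Complex.I * (quadPhase q : ℂ))) *
        quadProd (a (part s t m j)) (b (part s t m j)) (c (part s t m j)) (d (part s t m j)) q)
      atTop (𝓝 (∑ q ∈ quads K with L ^ 2 ≤ quadSize q,
        ∫ r in s..t, quadExp r q * quadProd (a r) (b r) (c r) (d r) q)) := by
    refine tendsto_finsetSum _ fun q hq => ?_
    have hq' := quadPhase_ne_zero (Finset.mem_filter.1 hq).1
    exact tendsto_sum_increments (continuous_quadExp q) (fun r => (norm_quadExp r q).le)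
      (quadExp_hasDerivAt hq') (continuous_quadProd ha.cont hb.cont hc.cont hd.cont q) hst
  refine le_of_tendsto hlim.norm ?_
  filter_upwards [eventually_ne_atTop 0] with m hm
  have hu := part_mono hst m
  have hmem := part_mem hst m
  obtain ⟨α, hα0, hα, hαY⟩ := ha.var.exists_bound K m hu hmem
  obtain ⟨β, hβ0, hβ, hβY⟩ := hb.var.exists_bound K m hu hmem
  obtain ⟨γ, hγ0, hγ, hγY⟩ := hc.var.exists_bound K m hu hmem
  obtain ⟨δ, hδ0, hδ, hδY⟩ := hd.var.exists_bound K m hu hmem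
  have hbound : ∀ j, ∑ q ∈ quads K with L ^ 2 ≤ quadSize q,
      ‖quadProd (a (part s t m j)) (b (part s t m j)) (c (part s t m j))
        (d (part s t m j)) q‖ * |(quadPhase q : ℝ)|⁻¹ ≤ L⁻¹ * (oscConst * (A * B * C * D)) :=
    fun j => sum_high_boundary_le hL hA hB hC hD (ha.mass_le K _ (hmem j))
      (hb.mass_le K _ (hmem j)) (hc.mass_le K _ (hmem j)) (hd.mass_le K _ (hmem j))
  have hstep : ∀ j, ∑ q ∈ quads K with L ^ 2 ≤ quadSize q,
      ‖quadProd (a (part s t m (j + 1))) (b (part s t m (j + 1))) (c (part s t m (j + 1)))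
          (d (part s t m (j + 1))) q -
        quadProd (a (part s t m j)) (b (part s t m j)) (c (part s t m j)) (d (part s t m j)) q‖
        * |(quadPhase q : ℝ)|⁻¹ ≤
      L⁻¹ * (oscConst * (α j * (B * C * D) + A * (β j * (C * D)) + A * B * (γ j * D) +
        A * B * C * δ j)) :=
    fun j => sum_high_increment_le hL hA hB hC hD (hα0 j) (hβ0 j) (hγ0 j) (hδ0 j)
      (hb.mass_le K _ (hmem j)) (hc.mass_le K _ (hmem j)) (hd.mass_le K _ (hmem j))
      (ha.mass_le K _ (hmem (j + 1))) (hb.mass_le K _ (hmem (j + 1)))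
      (hc.mass_le K _ (hmem (j + 1))) (hα j) (hβ j) (hγ j) (hδ j)
  have hnorm : ∀ (r : ℝ) (q : Σ _ : ℤ, ℤ × ℤ × ℤ) (z : ℂ),
      ‖quadExp r q / (-Complex.I * (quadPhase q : ℂ)) * z‖ = ‖z‖ * |(quadPhase q : ℝ)|⁻¹ := by
    intro r q z
    rw [norm_mul, norm_div, norm_quadExp, norm_mul, norm_neg, Complex.norm_I, one_mul,
      Complex.norm_intCast, one_div, mul_comm]
  calc _ ≤ ∑ q ∈ quads K with L ^ 2 ≤ quadSize q,
        (‖quadProd (a (part s t m m)) (b (part s t m m)) (c (part s t m m))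
            (d (part s t m m)) q‖ * |(quadPhase q : ℝ)|⁻¹ +
          ‖quadProd (a (part s t m 0)) (b (part s t m 0)) (c (part s t m 0))
            (d (part s t m 0)) q‖ * |(quadPhase q : ℝ)|⁻¹ +
          ∑ j ∈ Finset.range m,
            ‖quadProd (a (part s t m (j + 1))) (b (part s t m (j + 1))) (c (part s t m (j + 1)))
              (d (part s t m (j + 1))) q - quadProd (a (part s t m j)) (b (part s t m j))
              (c (part s t m j)) (d (part s t m j)) q‖ * |(quadPhase q : ℝ)|⁻¹) := by
        refine norm_sum_le_of_le _ fun q _ => ?_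
        rw [abel_sum (fun j => quadExp (part s t m j) q / (-Complex.I * (quadPhase q : ℂ)))
          (fun j => quadProd (a (part s t m j)) (b (part s t m j)) (c (part s t m j))
            (d (part s t m j)) q)]
        refine (norm_sub_le _ _).trans (add_le_add ((norm_sub_le _ _).trans (add_le_add ?_ ?_)) ?_)
        · rw [hnorm]
        · rw [hnorm]
        · exact norm_sum_le_of_le _ fun j _ => (hnorm _ _ _).le
    _ ≤ L⁻¹ * (oscConst * (A * B * C * D)) + L⁻¹ * (oscConst * (A * B * C * D)) +
        ∑ j ∈ Finset.range m, L⁻¹ * (oscConst * (α j * (B * C * D) + A * (β j * (C * D)) +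
          A * B * (γ j * D) + A * B * C * δ j)) := by
        rw [Finset.sum_add_distrib, Finset.sum_add_distrib, Finset.sum_comm]
        exact add_le_add (add_le_add (hbound m) (hbound 0)) (Finset.sum_le_sum fun j _ => hstep j)
    _ = L⁻¹ * (oscConst * (2 * (A * B * C * D) + (∑ j ∈ Finset.range m, α j) * (B * C * D) +
          A * ((∑ j ∈ Finset.range m, β j) * (C * D)) +
          A * B * ((∑ j ∈ Finset.range m, γ j) * D) +
          A * B * C * (∑ j ∈ Finset.range m, δ j))) := by
        simp only [← Finset.mul_sum, Finset.sum_add_distrib, ← Finset.sum_mul]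
        ring
    _ ≤ _ := by gcongr

/-- Oscillation is not used here: the weight `1 / quadGap` is inserted at the cost of `2 L²`, and
smallness comes from the length `t - s`. -/
theorem norm_sum_low_integral_le {K : ℕ} {L : ℝ} {a b c d : ℝ → ℤ → ℂ}
    {s t : ℝ} (hst : s ≤ t) {A B C D Ya Yb Yc Yd : ℝ} (ha : Controlled a s t A Ya)
    (hb : Controlled b s t B Yb) (hc : Controlled c s t C Yc) (hd : Controlled d s t D Yd) :
    ‖∑ q ∈ quads K with ¬ L ^ 2 ≤ quadSize q,
      ∫ r in s..t, quadExp r q * quadProd (a r) (b r) (c r) (d r) q‖ ≤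
    2 * L ^ 2 * (t - s) * (oscConst * (A * B * C * D)) := by
  have hcont := continuous_quadProd ha.cont hb.cont hc.cont hd.cont
  have hosc := oscConst_nonneg
  have hA := ha.nonneg
  have hB := hb.nonneg
  have hC := hc.nonneg
  have hD := hd.nonneg
  have hcont' : ∀ q, Continuous fun r => quadExp r q * quadProd (a r) (b r) (c r) (d r) q :=
    fun q => (continuous_quadExp q).mul (hcont q)
  rw [← intervalIntegral.integral_finsetSum fun q _ => (hcont' q).intervalIntegrable _ _]
  refine (intervalIntegral.norm_integral_le_of_norm_le_const
    (C := 2 * L ^ 2 * (oscConst * (A * B * C * D))) fun r hr => ?_).trans_eq ?_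
  · rw [Set.uIoc_of_le hst] at hr
    have hr' : r ∈ Set.Icc s t := ⟨hr.1.le, hr.2⟩
    calc _ ≤ ∑ q ∈ quads K with ¬ L ^ 2 ≤ quadSize q, 2 * L ^ 2 *
          (‖a r q.2.1‖ * ‖b r q.2.2.1‖ * ‖c r q.2.2.2‖ * ‖d r q.1‖ / quadGap q) := by
          refine norm_sum_le_of_le _ fun q hq => ?_
          obtain ⟨hq, hs⟩ := Finset.mem_filter.1 hq
          rw [norm_mul, norm_quadExp, one_mul, norm_quadProd, mul_div_assoc',
            le_div_iff₀ (quadGap_pos hq), mul_comm]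
          gcongr
          linarith [quadGap_le_quadSize (q := q)]
      _ ≤ ∑ q ∈ quads K, 2 * L ^ 2 *
          (‖a r q.2.1‖ * ‖b r q.2.2.1‖ * ‖c r q.2.2.2‖ * ‖d r q.1‖ / quadGap q) := by
          refine Finset.sum_le_sum_of_subset_of_nonneg (Finset.filter_subset _ _)
            fun q hq _ => ?_
          have := quadGap_pos hq
          positivity
      _ ≤ 2 * L ^ 2 * (invSqSum * (A * B * C * D)) := by
          rw [← Finset.mul_sum]
          gcongr
          exact sum_quads_div_gap_le (a := fun n => ‖a r n‖) (b := fun n => ‖b r n‖)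
            (c := fun n => ‖c r n‖) (d := fun n => ‖d r n‖) hA hB hC hD (ha.mass_le K r hr')
            (hb.mass_le K r hr') (hc.mass_le K r hr') (hd.mass_le K r hr')
      _ ≤ _ := by gcongr; exact invSqSum_le_oscConst
  · rw [abs_of_nonneg (sub_nonneg.2 hst)]; ring

theorem integral_quartSum_eq {K : ℕ} (L : ℝ) {a b c d : ℝ → ℤ → ℂ}
    (s t : ℝ) (ha : ∀ n, Continuous fun r => a r n)
    (hb : ∀ n, Continuous fun r => b r n) (hc : ∀ n, Continuous fun r => c r n)
    (hd : ∀ n, Continuous fun r => d r n) :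
    ∫ r in s..t, quartSum K r (a r) (b r) (c r) (d r) =
      (∑ q ∈ quads K with L ^ 2 ≤ quadSize q,
        ∫ r in s..t, quadExp r q * quadProd (a r) (b r) (c r) (d r) q) +
      ∑ q ∈ quads K with ¬ L ^ 2 ≤ quadSize q,
        ∫ r in s..t, quadExp r q * quadProd (a r) (b r) (c r) (d r) q := by
  rw [Finset.sum_filter_add_sum_filter_not]
  unfold quartSum
  exact intervalIntegral.integral_finsetSum fun q _ =>
    ((continuous_quadExp q).mul (continuous_quadProd ha hb hc hd q)).intervalIntegrable _ _

/-- The oscillatory estimate: integration by parts in time for the frequencies larger than `L`. -/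
theorem norm_integral_quartSum_le (K : ℕ) {L : ℝ} (hL : 1 ≤ L) {a b c d : ℝ → ℤ → ℂ}
    {s t : ℝ} (hst : s ≤ t) {A B C D Ya Yb Yc Yd : ℝ} (ha : Controlled a s t A Ya)
    (hb : Controlled b s t B Yb) (hc : Controlled c s t C Yc) (hd : Controlled d s t D Yd) :
    ‖∫ r in s..t, quartSum K r (a r) (b r) (c r) (d r)‖ ≤
    L⁻¹ * (oscConst * (2 * (A * B * C * D) + Ya * (B * C * D) + A * (Yb * (C * D)) +
      A * B * (Yc * D) + A * B * C * Yd)) +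
    2 * L ^ 2 * (t - s) * (oscConst * (A * B * C * D)) := by
  rw [integral_quartSum_eq L s t ha.cont hb.cont hc.cont hd.cont]
  exact (norm_add_le _ _).trans (add_le_add (norm_sum_high_integral_le hL hst ha hb hc hd)
    (norm_sum_low_integral_le hst ha hb hc hd))

/-- The oscillatory estimate when only frequencies larger than `L` interact. -/
theorem norm_integral_quartSum_le_of_high (K : ℕ) {L : ℝ} (hL : 1 ≤ L) {a b c d : ℝ → ℤ → ℂ}
    {s t : ℝ} (hst : s ≤ t) {A B C D Ya Yb Yc Yd : ℝ} (ha : Controlled a s t A Ya)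
    (hb : Controlled b s t B Yb) (hc : Controlled c s t C Yc) (hd : Controlled d s t D Yd)
    (hhigh : ∀ r q, quadSize q < L ^ 2 → quadProd (a r) (b r) (c r) (d r) q = 0) :
    ‖∫ r in s..t, quartSum K r (a r) (b r) (c r) (d r)‖ ≤
    L⁻¹ * (oscConst * (2 * (A * B * C * D) + Ya * (B * C * D) + A * (Yb * (C * D)) +
      A * B * (Yc * D) + A * B * C * Yd)) := by
  rw [integral_quartSum_eq L s t ha.cont hb.cont hc.cont hd.cont]
  have : ∑ q ∈ quads K with ¬ L ^ 2 ≤ quadSize q,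
      ∫ r in s..t, quadExp r q * quadProd (a r) (b r) (c r) (d r) q = 0 := by
    refine Finset.sum_eq_zero fun q hq => ?_
    have hq' := (Finset.mem_filter.1 hq).2
    simp [hhigh _ q (not_le.1 hq')]
  rw [this, add_zero]
  exact norm_sum_high_integral_le hL hst ha hb hc hd

/-! ### Trigonometric polynomials -/

/-- The trigonometric polynomial with coefficients `u n`, `|n| ≤ K`. -/
def trigPoly (K : ℕ) (u : ℤ → ℂ) (y : Torus) : ℂ := ∑ n ∈ freqs K, u n * fourier n y

/-- The factor `e^{-itn⁴}` of the linear propagator. -/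
def linExp (t : ℝ) (n : ℤ) : ℂ := Complex.exp (-Complex.I * (t : ℂ) * (n : ℂ) ^ 4)

/-- The coefficients of the linear evolution. -/
def rot (t : ℝ) (x : ℤ → ℂ) (n : ℤ) : ℂ := linExp t n * x n

theorem norm_linExp (t : ℝ) (n : ℤ) : ‖linExp t n‖ = 1 := by
  have : -Complex.I * (t : ℂ) * (n : ℂ) ^ 4 = ((-(t * n ^ 4) : ℝ) : ℂ) * Complex.I := by
    push_cast; ring
  rw [linExp, this, Complex.norm_exp_ofReal_mul_I]

theorem norm_rot (t : ℝ) (x : ℤ → ℂ) (n : ℤ) : ‖rot t x n‖ = ‖x n‖ := by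
  rw [rot, norm_mul, norm_linExp, one_mul]

theorem mass_rot (K : ℕ) (t : ℝ) (x : ℤ → ℂ) : mass K (rot t x) = mass K x := by
  simp only [mass, norm_rot]

theorem rot_sub (t : ℝ) (x y : ℤ → ℂ) : rot t (x - y) = rot t x - rot t y := by
  ext n; simp [rot, mul_sub]

theorem continuous_trigPoly (K : ℕ) (u : ℤ → ℂ) : Continuous (trigPoly K u) := by
  unfold trigPoly; fun_prop

theorem trigPoly_sub (K : ℕ) (u w : ℤ → ℂ) (y : Torus) :
    trigPoly K (u - w) y = trigPoly K u y - trigPoly K w y := by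
  simp [trigPoly, sub_mul]

theorem integrable_torus {E : Type*} [NormedAddCommGroup E] {f : Torus → E}
    (hf : Continuous f) : Integrable f AddCircle.haarAddCircle :=
  hf.integrable_of_hasCompactSupport (HasCompactSupport.of_compactSpace f)

theorem integral_fourier (k : ℤ) :
    ∫ y : Torus, (fourier k y : ℂ) ∂AddCircle.haarAddCircle = if k = 0 then 1 else 0 := by
  have h := congrFun (fourierCoeff_fourier (T := 2 * Real.pi) k) 0
  simp only [fourierCoeff, neg_zero, fourier_zero, one_smul] at h
  rw [h, Pi.single_apply]
  simp [eq_comm]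

/-- The `n`-th coefficient of `|U|² U` where `U` is the trigonometric polynomial with
coefficients `u`. -/
def fullSum (K : ℕ) (u : ℤ → ℂ) (n : ℤ) : ℂ :=
  ∑ p ∈ freqs K ×ˢ freqs K ×ˢ freqs K,
    if n = p.1 - p.2.1 + p.2.2 then u p.1 * conj (u p.2.1) * u p.2.2 else 0

theorem integral_cubic (K : ℕ) (u : ℤ → ℂ) (n : ℤ) :
    ∫ y, trigPoly K u y * conj (trigPoly K u y) * trigPoly K u y * conj (fourier n y : ℂ)
      ∂AddCircle.haarAddCircle = fullSum K u n := by
  have h : ∀ y, trigPoly K u y * conj (trigPoly K u y) * trigPoly K u y *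
      conj (fourier n y : ℂ) = ∑ p ∈ freqs K ×ˢ freqs K ×ˢ freqs K,
        u p.1 * conj (u p.2.1) * u p.2.2 * (fourier (p.1 - p.2.1 + p.2.2 - n) y : ℂ) := by
    intro y
    simp only [trigPoly, map_sum, Finset.sum_product]
    rw [Finset.sum_mul_sum, Finset.sum_mul, Finset.sum_mul]
    refine Finset.sum_congr rfl fun i _ => ?_
    rw [Finset.sum_mul_sum, Finset.sum_mul]
    refine Finset.sum_congr rfl fun j _ => ?_
    rw [Finset.sum_mul]
    refine Finset.sum_congr rfl fun k _ => ?_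
    rw [sub_eq_add_neg _ n, fourier_add, fourier_add, sub_eq_add_neg, fourier_add, fourier_neg,
      fourier_neg, map_mul]
    ring
  simp only [h]
  rw [integral_finsetSum _ fun p _ => integrable_torus (by fun_prop), fullSum]
  refine Finset.sum_congr rfl fun p _ => ?_
  rw [integral_const_mul, integral_fourier]
  have : (p.1 - p.2.1 + p.2.2 - n = 0) ↔ n = p.1 - p.2.1 + p.2.2 := by
    constructor <;> intro h <;> linarith
  simp only [this]
  split_ifs <;> simp

theorem integral_normSq_trigPoly (K : ℕ) (u : ℤ → ℂ) :
    ∫ y, ‖trigPoly K u y‖ ^ 2 ∂AddCircle.haarAddCircle = mass K u := by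
  have h : ∀ y, ((‖trigPoly K u y‖ ^ 2 : ℝ) : ℂ) = ∑ i ∈ freqs K, ∑ j ∈ freqs K,
      u i * conj (u j) * (fourier (i - j) y : ℂ) := by
    intro y
    push_cast
    rw [← Complex.mul_conj', trigPoly, map_sum, Finset.sum_mul_sum]
    refine Finset.sum_congr rfl fun i _ => Finset.sum_congr rfl fun j _ => ?_
    rw [sub_eq_add_neg, fourier_add, fourier_neg, map_mul]; ring
  have h2 : ((∫ y, ‖trigPoly K u y‖ ^ 2 ∂AddCircle.haarAddCircle : ℝ) : ℂ) = mass K u := by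
    rw [← integral_complex_ofReal]
    simp only [h]
    rw [integral_finsetSum _ fun i _ => integrable_torus (by fun_prop), mass]
    push_cast
    refine Finset.sum_congr rfl fun i hi => ?_
    rw [integral_finsetSum _ fun j _ => integrable_torus (by fun_prop)]
    simp only [integral_const_mul, integral_fourier, sub_eq_zero, mul_ite, mul_one, mul_zero]
    rw [Finset.sum_ite_eq, if_pos hi, Complex.mul_conj']
  exact_mod_cast h2

/-- The contribution of the resonances `n₁ = n` or `n₃ = n`. -/
theorem fullSum_eq {K : ℕ} (u : ℤ → ℂ) {n : ℤ} (hn : n ∈ freqs K) :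
    fullSum K u n = (∑ p ∈ planeTrunc K n, u p.1 * conj (u p.2.1) * u p.2.2) +
      2 * mass K u * u n - (‖u n‖ ^ 2 : ℝ) * u n := by
  -- Inclusion–exclusion: on the plane `n₁ = n` means `n₃ = n₂`, and `n₃ = n` means `n₂ = n₁`; the
  -- overlap `n₁ = n₂ = n₃ = n` is counted twice and subtracted once.
  have hsplit : ∀ p : ℤ × ℤ × ℤ,
      (if n = p.1 - p.2.1 + p.2.2 then u p.1 * conj (u p.2.1) * u p.2.2 else 0) =
      (if n = p.1 - p.2.1 + p.2.2 ∧ p.1 ≠ n ∧ p.2.2 ≠ n then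
        u p.1 * conj (u p.2.1) * u p.2.2 else 0) +
      (if p.1 = n then if p.2.2 = p.2.1 then u p.1 * conj (u p.2.1) * u p.2.2 else 0 else 0) +
      (if p.2.2 = n then if p.2.1 = p.1 then u p.1 * conj (u p.2.1) * u p.2.2 else 0 else 0) -
      (if p.1 = n then if p.2.1 = n then if p.2.2 = n then
        u p.1 * conj (u p.2.1) * u p.2.2 else 0 else 0 else 0) := by
    rintro ⟨i, j, k⟩
    simp only
    by_cases hi : i = n
    · subst hi
      by_cases hk : k = i
      · subst hk
        by_cases hj : j = k
        · subst hj; simp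
        · have h1 : ¬ k = k - j + k := by omega
          have h2 : ¬ k = j := fun h => hj h.symm
          simp [hj, h1, h2]
      · have : (i = i - j + k) ↔ k = j := by omega
        simp [hk, this]
    · by_cases hk : k = n
      · subst hk
        have : (k = i - j + k) ↔ j = i := by omega
        simp [hi, this]
      · simp [hi, hk]
  unfold fullSum
  simp only [hsplit, Finset.sum_sub_distrib, Finset.sum_add_distrib]
  have e1 : ∑ p ∈ freqs K ×ˢ freqs K ×ˢ freqs K, (if n = p.1 - p.2.1 + p.2.2 ∧ p.1 ≠ n ∧
      p.2.2 ≠ n then u p.1 * conj (u p.2.1) * u p.2.2 else 0) =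
      ∑ p ∈ planeTrunc K n, u p.1 * conj (u p.2.1) * u p.2.2 := by
    rw [planeTrunc, Finset.sum_filter]
  have hm : (mass K u : ℂ) = ∑ j ∈ freqs K, u j * conj (u j) := by
    simp only [mass, Complex.mul_conj']; push_cast; rfl
  have e2 : ∑ p ∈ freqs K ×ˢ freqs K ×ˢ freqs K, (if p.1 = n then if p.2.2 = p.2.1 then
      u p.1 * conj (u p.2.1) * u p.2.2 else 0 else 0) = mass K u * u n := by
    simp only [Finset.sum_product]
    rw [Finset.sum_eq_single_of_mem n hn (fun i _ hi => by simp [hi]), hm, Finset.sum_mul]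
    refine Finset.sum_congr rfl fun j hj => ?_
    simp only [if_true, Finset.sum_ite_eq', hj]
    ring
  have e3 : ∑ p ∈ freqs K ×ˢ freqs K ×ˢ freqs K, (if p.2.2 = n then if p.2.1 = p.1 then
      u p.1 * conj (u p.2.1) * u p.2.2 else 0 else 0) = mass K u * u n := by
    simp only [Finset.sum_product]
    rw [hm, Finset.sum_mul]
    refine Finset.sum_congr rfl fun i hi => ?_
    rw [Finset.sum_eq_single_of_mem i hi (fun j _ hj => by simp [hj])]
    simp [hn]
  have e4 : ∑ p ∈ freqs K ×ˢ freqs K ×ˢ freqs K, (if p.1 = n then if p.2.1 = n then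
      if p.2.2 = n then u p.1 * conj (u p.2.1) * u p.2.2 else 0 else 0 else 0) =
      (‖u n‖ ^ 2 : ℝ) * u n := by
    simp only [Finset.sum_product]
    rw [Finset.sum_eq_single_of_mem n hn (fun i _ hi => by simp [hi]),
      Finset.sum_eq_single_of_mem n hn (fun i _ hi => by simp [hi]),
      Finset.sum_eq_single_of_mem n hn (fun i _ hi => by simp [hi])]
    simp [Complex.mul_conj']
  rw [e1, e2, e3, e4]; ring

/-! ### The nonlinearity -/

/-- The trilinear form of the non-resonant interactions. -/
def triSum (K : ℕ) (t : ℝ) (a b c : ℤ → ℂ) (n : ℤ) : ℂ :=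
  ∑ p ∈ planeTrunc K n, Complex.exp (-Complex.I * (phase p.1 p.2.1 p.2.2 n : ℂ) * (t : ℂ)) *
    (a p.1 * conj (b p.2.1) * c p.2.2)

/-- The right-hand side of the equation in terms of the coefficients. -/
def seqNonlin (K : ℕ) (t : ℝ) (x : ℤ → ℂ) (n : ℤ) : ℂ :=
  -Complex.I * triSum K t x x x n + Complex.I * ((‖x n‖ ^ 2 : ℝ) : ℂ) * x n

theorem nonlinearity_eq (K : ℕ) (t : ℝ) (v : L2) (n : ℤ) :
    nonlinearity K t v n = seqNonlin K t (fourierCoeff v) n := rfl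

theorem sum_triSum_mul_conj (K : ℕ) (t : ℝ) (a b c d : ℤ → ℂ) :
    ∑ n ∈ freqs K, triSum K t a b c n * conj (d n) = quartSum K t a b c d := by
  unfold quartSum quads triSum
  rw [Finset.sum_sigma]
  refine Finset.sum_congr rfl fun n _ => ?_
  rw [Finset.sum_mul]
  refine Finset.sum_congr rfl fun p _ => ?_
  simp only [quadExp, quadProd, quadPhase]; ring

theorem rot_mul_rot (t : ℝ) (x : ℤ → ℂ) {n : ℤ} {p : ℤ × ℤ × ℤ} :
    rot t x p.1 * conj (rot t x p.2.1) * rot t x p.2.2 =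
      linExp t n * (Complex.exp (-Complex.I * (phase p.1 p.2.1 p.2.2 n : ℂ) * (t : ℂ)) *
        (x p.1 * conj (x p.2.1) * x p.2.2)) := by
  have : linExp t p.1 * conj (linExp t p.2.1) * linExp t p.2.2 =
      linExp t n * Complex.exp (-Complex.I * (phase p.1 p.2.1 p.2.2 n : ℂ) * (t : ℂ)) := by
    simp only [linExp, ← Complex.exp_conj, ← Complex.exp_add]
    congr 1
    simp [phase]
    ring
  simp only [rot, map_mul]
  linear_combination (x p.1 * conj (x p.2.1) * x p.2.2) * this

theorem fullSum_rot {K : ℕ} (t : ℝ) (x : ℤ → ℂ) {n : ℤ} (hn : n ∈ freqs K) :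
    fullSum K (rot t x) n = linExp t n * (triSum K t x x x n + 2 * mass K x * x n -
      (‖x n‖ ^ 2 : ℝ) * x n) := by
  rw [fullSum_eq _ hn, mass_rot, norm_rot, triSum]
  simp only [rot_mul_rot t x (n := n), ← Finset.mul_sum]
  rw [rot]; ring

/-- The term `i|v_n|²v_n` of the equation exactly cancels the diagonal correction in `fullSum_rot`.
What remains is a Fourier coefficient of `|U|²U`, accessible through `L⁴`, and a phase rotation by
the mass. -/
theorem linExp_mul_seqNonlin {K : ℕ} (t : ℝ) (x : ℤ → ℂ) {n : ℤ} (hn : n ∈ freqs K) :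
    linExp t n * seqNonlin K t x n =
      -Complex.I * fullSum K (rot t x) n + 2 * Complex.I * linExp t n * (mass K x * x n) := by
  rw [fullSum_rot t x hn, seqNonlin]; ring

/-- The fourth power of the `L⁴(𝕋)` norm of the linear evolution of the frequencies at most
`K`. -/
def quartNorm (K : ℕ) (t : ℝ) (x : ℤ → ℂ) : ℝ :=
  ∫ y, ‖trigPoly K (rot t x) y‖ ^ 4 ∂AddCircle.haarAddCircle

theorem quartNorm_nonneg (K : ℕ) (t : ℝ) (x : ℤ → ℂ) : 0 ≤ quartNorm K t x :=
  integral_nonneg fun y => by positivity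

/-- Parseval for `∫|U|⁴`, with the resonances separated. It makes the `L⁴` norm accessible to the
oscillatory estimate, and shows that the non-resonant form on the diagonal is real, which is the
source of mass conservation. -/
theorem ofReal_quartNorm_eq (K : ℕ) (t : ℝ) (x : ℤ → ℂ) :
    ((quartNorm K t x : ℝ) : ℂ) = quartSum K t x x x x + ((2 * mass K x ^ 2 -
      ∑ n ∈ freqs K, ‖x n‖ ^ 4 : ℝ) : ℂ) := by
  have h : ((quartNorm K t x : ℝ) : ℂ) = ∑ n ∈ freqs K,
      fullSum K (rot t x) n * conj (rot t x n) := by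
    rw [quartNorm, ← integral_complex_ofReal]
    have : ∀ y, ((‖trigPoly K (rot t x) y‖ ^ 4 : ℝ) : ℂ) = ∑ n ∈ freqs K,
        trigPoly K (rot t x) y * conj (trigPoly K (rot t x) y) * trigPoly K (rot t x) y *
          conj (fourier n y : ℂ) * conj (rot t x n) := by
      intro y
      have e : ∑ n ∈ freqs K, conj (rot t x n) * conj (fourier n y : ℂ) =
          conj (trigPoly K (rot t x) y) := by simp [trigPoly]
      simp only [mul_assoc, ← Finset.mul_sum]
      simp only [mul_comm (conj (fourier _ y : ℂ)), e]
      have := Complex.mul_conj' (trigPoly K (rot t x) y)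
      push_cast
      linear_combination (-(trigPoly K (rot t x) y * conj (trigPoly K (rot t x) y)) -
        (‖trigPoly K (rot t x) y‖ : ℂ) ^ 2) * this
    simp only [this]
    have hc := continuous_trigPoly K (rot t x)
    rw [integral_finsetSum _ fun n _ => integrable_torus (by fun_prop)]
    refine Finset.sum_congr rfl fun n _ => ?_
    rw [integral_mul_const, integral_cubic]
  rw [h, ← sum_triSum_mul_conj]
  push_cast
  have hm : 2 * (mass K x : ℂ) ^ 2 = ∑ n ∈ freqs K, 2 * mass K x * (x n * conj (x n)) := by
    rw [← Finset.mul_sum]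
    simp only [Complex.mul_conj']
    rw [mass]; push_cast; ring
  rw [hm, ← Finset.sum_sub_distrib, ← Finset.sum_add_distrib]
  refine Finset.sum_congr rfl fun n hn => ?_
  rw [fullSum_rot t x hn, rot, map_mul]
  have e1 : linExp t n * conj (linExp t n) = 1 := by
    rw [Complex.mul_conj', norm_linExp]; simp
  have e2 := Complex.mul_conj' (x n)
  push_cast
  linear_combination ((triSum K t x x x n + 2 * mass K x * x n - (‖x n‖ : ℂ) ^ 2 * x n) *
    conj (x n)) * e1 - (‖x n‖ : ℂ) ^ 2 * e2

theorem quartNorm_eq (K : ℕ) (t : ℝ) (x : ℤ → ℂ) :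
    quartNorm K t x = (quartSum K t x x x x).re + (2 * mass K x ^ 2 -
      ∑ n ∈ freqs K, ‖x n‖ ^ 4) := by
  have h := congrArg Complex.re (ofReal_quartNorm_eq K t x)
  rw [Complex.add_re, Complex.ofReal_re, Complex.ofReal_re] at h
  exact h

theorem quartSum_self_im (K : ℕ) (t : ℝ) (x : ℤ → ℂ) : (quartSum K t x x x x).im = 0 := by
  have h := congrArg Complex.im (ofReal_quartNorm_eq K t x)
  rw [Complex.add_im, Complex.ofReal_im, Complex.ofReal_im, add_zero] at h
  exact h.symm

theorem norm_cubic_sub_le (A B : ℂ) :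
    ‖B * conj B * B - A * conj A * A‖ ≤ 3 / 2 * (‖B - A‖ * (‖A‖ ^ 2 + ‖B‖ ^ 2)) := by
  have e : B * conj B * B - A * conj A * A =
      B * conj B * (B - A) + (B - A) * conj B * A + A * conj (B - A) * A := by
    rw [map_sub]; ring
  rw [e]
  refine (norm_add₃_le).trans ?_
  simp only [norm_mul, RCLike.norm_conj]
  nlinarith [mul_nonneg (norm_nonneg (B - A)) (sq_nonneg (‖A‖ - ‖B‖))]

/-- A Fourier coefficient is at most the `L¹` norm of the cubic difference, and Young's inequality
gives `δ(α² + β²) ≤ δ²/μ + (μ/2)(α⁴ + β⁴)`. The parameter `μ` is small in the a priori bound and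
equal to the size of the difference in the comparison. -/
theorem norm_fullSum_sub_le (K : ℕ) (u w : ℤ → ℂ) (n : ℤ) {μ : ℝ} (hμ : 0 < μ) :
    ‖fullSum K w n - fullSum K u n‖ ≤ 3 / 2 * (mass K (w - u) / μ +
      μ / 2 * ((∫ y, ‖trigPoly K u y‖ ^ 4 ∂AddCircle.haarAddCircle) +
        ∫ y, ‖trigPoly K w y‖ ^ 4 ∂AddCircle.haarAddCircle)) := by
  have hu := continuous_trigPoly K u
  have hw := continuous_trigPoly K w
  rw [← integral_cubic, ← integral_cubic, ← integral_sub (integrable_torus (by fun_prop))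
    (integrable_torus (by fun_prop)), ← integral_normSq_trigPoly]
  have hd := continuous_trigPoly K (w - u)
  rw [← integral_add (integrable_torus (by fun_prop)) (integrable_torus (by fun_prop)),
    ← integral_const_mul, ← integral_div, ← integral_add (integrable_torus (by fun_prop))
    (integrable_torus (by fun_prop)), ← integral_const_mul]
  refine norm_integral_le_of_norm_le (integrable_torus (by fun_prop)) (Eventually.of_forall ?_)
  intro y
  have hf : ‖(fourier n y : ℂ)‖ = 1 := by
    rw [fourier_apply]; exact Circle.norm_coe _
  rw [← sub_mul, norm_mul, RCLike.norm_conj, hf, mul_one, trigPoly_sub]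
  refine (norm_cubic_sub_le _ _).trans ?_
  set δ := ‖trigPoly K w y - trigPoly K u y‖
  set α := ‖trigPoly K u y‖
  set β := ‖trigPoly K w y‖
  gcongr
  rw [div_add' _ _ _ hμ.ne', le_div_iff₀ hμ]
  nlinarith [sq_nonneg (δ - μ * (α ^ 2 + β ^ 2) / 2), sq_nonneg (μ * (α ^ 2 - β ^ 2))]

theorem abs_mass_sub_le {K : ℕ} {a b : ℤ → ℂ} {R D : ℝ} (hR : 0 ≤ R) (hD : 0 ≤ D)
    (ha : mass K a ≤ R ^ 2) (hb : mass K b ≤ R ^ 2) (hd : mass K (b - a) ≤ D ^ 2) :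
    |mass K b - mass K a| ≤ 2 * R * D := by
  have h1 : |mass K b - mass K a| ≤ ∑ n ∈ freqs K, ‖(b - a) n‖ * (‖a n‖ + ‖b n‖) := by
    rw [mass, mass, ← Finset.sum_sub_distrib]
    refine Finset.abs_sum_le_sum_abs _ _ |>.trans (Finset.sum_le_sum fun n _ => ?_)
    rw [sq_sub_sq, abs_mul, mul_comm, abs_of_nonneg (a := ‖b n‖ + ‖a n‖) (by positivity),
      add_comm]
    gcongr
    exact abs_norm_sub_norm_le _ _
  refine h1.trans ?_
  have key : ∀ x : ℤ → ℂ, mass K x ≤ R ^ 2 →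
      ∑ n ∈ freqs K, ‖(b - a) n‖ * ‖x n‖ ≤ D * R := by
    intro x hx
    refine abs_le_of_sq_le_sq' ((Finset.sum_mul_sq_le_sq_mul_sq _ _ _).trans ?_)
      (by positivity) |>.2
    rw [mul_pow]
    exact mul_le_mul hd hx (mass_nonneg K x) (by positivity)
  simp only [mul_add, Finset.sum_add_distrib]
  linarith [key a ha, key b hb]

theorem norm_apply_le_of_mass_le {K : ℕ} {x : ℤ → ℂ} {R : ℝ} (hR : 0 ≤ R)
    (hx : mass K x ≤ R ^ 2) {n : ℤ} (hn : n ∈ freqs K) : ‖x n‖ ≤ R := by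
  refine abs_le_of_sq_le_sq' (le_trans ?_ hx) hR |>.2
  exact Finset.single_le_sum (f := fun n => ‖x n‖ ^ 2) (fun _ _ => by positivity) hn

theorem norm_seqNonlin_sub_le {K : ℕ} (t : ℝ) {a b : ℤ → ℂ} {R D μ : ℝ} (hR : 0 ≤ R)
    (hD : 0 ≤ D) (hμ : 0 < μ) (ha : mass K a ≤ R ^ 2) (hb : mass K b ≤ R ^ 2)
    (hd : mass K (b - a) ≤ D ^ 2) {n : ℤ} (hn : n ∈ freqs K) :
    ‖seqNonlin K t b n - seqNonlin K t a n‖ ≤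
      3 / 2 * (D ^ 2 / μ + μ / 2 * (quartNorm K t a + quartNorm K t b)) + 6 * R ^ 2 * D := by
  have e : linExp t n * (seqNonlin K t b n - seqNonlin K t a n) =
      -Complex.I * (fullSum K (rot t b) n - fullSum K (rot t a) n) +
      2 * Complex.I * linExp t n * (mass K b * (b - a) n + ((mass K b : ℂ) - mass K a) * a n) := by
    rw [mul_sub, linExp_mul_seqNonlin t b hn, linExp_mul_seqNonlin t a hn, Pi.sub_apply]; ring
  have e' := congrArg norm e
  rw [norm_mul, norm_linExp, one_mul] at e'
  rw [e']
  refine (norm_add_le _ _).trans (add_le_add ?_ ?_)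
  · rw [norm_mul, norm_neg, Complex.norm_I, one_mul]
    refine (norm_fullSum_sub_le K _ _ n hμ).trans ?_
    rw [← rot_sub, mass_rot]
    simp only [quartNorm]
    gcongr
  · have h1 : ‖(mass K b : ℂ) * (b - a) n + ((mass K b : ℂ) - mass K a) * a n‖ ≤
        R ^ 2 * D + 2 * R * D * R := by
      refine (norm_add_le _ _).trans (add_le_add ?_ ?_)
      · rw [norm_mul, Complex.norm_real, Real.norm_of_nonneg (mass_nonneg K b)]
        gcongr
        exact norm_apply_le_of_mass_le hD hd hn
      · rw [norm_mul, ← Complex.ofReal_sub, Complex.norm_real]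
        gcongr
        · exact abs_mass_sub_le hR hD ha hb hd
        · exact norm_apply_le_of_mass_le hR ha hn
    rw [norm_mul, norm_mul, norm_mul, norm_linExp, Complex.norm_I]
    rw [show ‖(2 : ℂ)‖ = 2 by simp]
    linarith

/-! ### Continuity in time -/

theorem continuous_mass {x : ℝ → ℤ → ℂ} (hx : ∀ n, Continuous fun r => x r n) (K : ℕ) :
    Continuous fun r => mass K (x r) := by
  unfold mass
  exact continuous_finsetSum _ fun n _ => (hx n).norm.pow 2

theorem continuous_triSum {a b c : ℝ → ℤ → ℂ} (ha : ∀ n, Continuous fun r => a r n)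
    (hb : ∀ n, Continuous fun r => b r n) (hc : ∀ n, Continuous fun r => c r n)
    (K : ℕ) (n : ℤ) : Continuous fun r => triSum K r (a r) (b r) (c r) n := by
  unfold triSum
  refine continuous_finsetSum _ fun p _ => Continuous.mul (by fun_prop) ?_
  exact ((ha _).mul (Complex.continuous_conj.comp (hb _))).mul (hc _)

theorem continuous_seqNonlin {x : ℝ → ℤ → ℂ} (hx : ∀ n, Continuous fun r => x r n)
    (K : ℕ) (n : ℤ) : Continuous fun r => seqNonlin K r (x r) n := by
  unfold seqNonlin
  have h1 := continuous_triSum hx hx hx K n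
  have h2 := hx n
  fun_prop

theorem continuous_quartNorm {x : ℝ → ℤ → ℂ} (hx : ∀ n, Continuous fun r => x r n) (K : ℕ) :
    Continuous fun r => quartNorm K r (x r) := by
  simp only [quartNorm_eq]
  have h1 := continuous_quartSum hx hx hx hx K
  have h2 := continuous_mass hx K
  have h3 : Continuous fun r => ∑ n ∈ freqs K, ‖x r n‖ ^ 4 :=
    continuous_finsetSum _ fun n _ => (hx n).norm.pow 4
  exact (Complex.continuous_re.comp h1).add ((continuous_const.mul (h2.pow 2)).sub h3)

theorem integral_const_add_const_mul {g : ℝ → ℝ} (hg : Continuous g) (c d s t : ℝ) :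
    ∫ r in s..t, (c + d * g r) = (t - s) * c + d * ∫ r in s..t, g r := by
  have h : Continuous fun r => d * g r := continuous_const.mul hg
  rw [intervalIntegral.integral_add (continuous_const.intervalIntegrable _ _)
    (h.intervalIntegrable _ _), intervalIntegral.integral_const,
    intervalIntegral.integral_const_mul, smul_eq_mul]

/-! ### Solutions in terms of their coefficients -/

/-- `x` solves the integrated equation for the frequencies in `S`, and the other coefficients
vanish. -/
structure IsSol (S : Set ℤ) (x : ℝ → ℤ → ℂ) : Prop where
  cont : ∀ n, Continuous fun r => x r n
  supp : ∀ r, ∀ n ∉ S, x r n = 0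
  memL4 : ∀ T : ℝ, 0 < T → ∃ C : ℝ, ∀ K : ℕ, ∫ r in (-T)..T, quartNorm K r (x r) ≤ C
  equation : ∀ n ∈ S, ∀ s t : ℝ, Tendsto (fun K : ℕ => ∫ r in s..t, seqNonlin K r (x r) n) atTop
    (𝓝 (x t n - x s n))

/-! ### Variation and space-time `L⁴` bounds -/

theorem eventually_mem_freqs (n : ℤ) : ∀ᶠ K : ℕ in atTop, n ∈ freqs K := by
  filter_upwards [eventually_ge_atTop n.natAbs] with K hK
  simp only [freqs, Finset.mem_Icc]
  omega

/-- Each increment of `z` is a limit of integrals of `h K` over one step. A partition has finitely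
many steps, so the limit may be taken after summation; the majorant `y K` does not depend on the
frequency, which is why the selector `ν` is harmless. -/
theorem hasVar_of_tendsto {z : ℝ → ℤ → ℂ} {h : ℕ → ℝ → ℤ → ℂ} {y : ℕ → ℝ → ℝ} {s t Y : ℝ}
    (hy : ∀ K, Continuous (y K)) (hy0 : ∀ K r, 0 ≤ y K r)
    (hz : ∀ n s' t', Tendsto (fun K => ∫ r in s'..t', h K r n) atTop (𝓝 (z t' n - z s' n)))
    (hb : ∀ n, ∀ᶠ K in atTop, ∀ r ∈ Set.Icc s t, ‖h K r n‖ ≤ y K r)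
    (hY : ∀ᶠ K in atTop, ∫ r in s..t, y K r ≤ Y) : HasVar z s t Y := by
  intro m u hu hmem ν
  have hlim : Tendsto (fun K => ∑ j ∈ Finset.range m, ‖∫ r in u j..u (j + 1), h K r (ν j)‖) atTop
      (𝓝 (∑ j ∈ Finset.range m, ‖z (u (j + 1)) (ν j) - z (u j) (ν j)‖)) :=
    tendsto_finsetSum _ fun j _ => (hz _ _ _).norm
  refine le_of_tendsto hlim ?_
  have hall : ∀ᶠ K in atTop, ∀ j ∈ Finset.range m, ∀ r ∈ Set.Icc s t, ‖h K r (ν j)‖ ≤ y K r :=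
    (Finset.eventually_all _).2 fun j _ => hb _
  filter_upwards [hall, hY] with K hK hYK
  calc _ ≤ ∑ j ∈ Finset.range m, ∫ r in u j..u (j + 1), y K r := by
        refine Finset.sum_le_sum fun j hj => ?_
        refine intervalIntegral.norm_integral_le_of_norm_le (hu (Nat.le_succ j))
          (Eventually.of_forall fun r hr => hK j hj r ?_) ((hy K).intervalIntegrable _ _)
        exact ⟨(hmem j).1.trans hr.1.le, hr.2.trans (hmem (j + 1)).2⟩
    _ = ∫ r in u 0..u m, y K r :=
        intervalIntegral.sum_integral_adjacent_intervals
          fun k _ => (hy K).intervalIntegrable _ _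
    _ ≤ ∫ r in s..t, y K r :=
        intervalIntegral.integral_mono_interval (hmem 0).1 (hu (Nat.zero_le m)) (hmem m).2
          (Eventually.of_forall fun r => hy0 K r) ((hy K).intervalIntegrable _ _)
    _ ≤ Y := hYK

theorem seqNonlin_zero (K : ℕ) (t : ℝ) (n : ℤ) : seqNonlin K t 0 n = 0 := by
  simp [seqNonlin, triSum]

theorem quartNorm_zero (K : ℕ) (t : ℝ) : quartNorm K t 0 = 0 := by
  have : rot t 0 = 0 := by ext n; simp [rot]
  simp [quartNorm, this, trigPoly]

theorem norm_seqNonlin_le {K : ℕ} (t : ℝ) {x : ℤ → ℂ} {R μ : ℝ} (hR : 0 ≤ R)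
    (hμ : 0 < μ) (hx : mass K x ≤ R ^ 2) {n : ℤ} (hn : n ∈ freqs K) :
    ‖seqNonlin K t x n‖ ≤ 3 / 2 * (R ^ 2 / μ + μ / 2 * quartNorm K t x) + 6 * R ^ 3 := by
  have h0 : mass K (0 : ℤ → ℂ) ≤ R ^ 2 := by simp only [mass]; simp; positivity
  have := norm_seqNonlin_sub_le t hR hR hμ h0 hx (by simpa using hx) hn
  rw [seqNonlin_zero, sub_zero, quartNorm_zero, zero_add] at this
  linarith

theorem IsSol.tendsto_indicator {S : Set ℤ} {x : ℝ → ℤ → ℂ} (hx : IsSol S x) (n : ℤ) (s t : ℝ) :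
    Tendsto (fun K => ∫ r in s..t, S.indicator (seqNonlin K r (x r)) n) atTop
      (𝓝 (x t n - x s n)) := by
  by_cases hn : n ∈ S
  · simpa [hn] using hx.equation n hn s t
  · simp [hn, hx.supp]

/-- The `L⁴` bound `C` enters with the factor `μ`, which is free to be small. -/
theorem IsSol.hasVar {S : Set ℤ} {x : ℝ → ℤ → ℂ} (hx : IsSol S x) {s t R C μ : ℝ}
    (hR : 0 ≤ R) (hμ : 0 < μ) (hmass : ∀ K, ∀ r ∈ Set.Icc s t, mass K (x r) ≤ R ^ 2)
    (hC : ∀ K, ∫ r in s..t, quartNorm K r (x r) ≤ C) :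
    HasVar x s t ((t - s) * (3 / 2 * (R ^ 2 / μ) + 6 * R ^ 3) + 3 / 4 * μ * C) := by
  have hq := continuous_quartNorm hx.cont
  refine hasVar_of_tendsto
    (y := fun K r => 3 / 2 * (R ^ 2 / μ + μ / 2 * quartNorm K r (x r)) + 6 * R ^ 3)
    (fun K => by have := hq K; fun_prop)
    (fun K r => by have := quartNorm_nonneg K r (x r); positivity) hx.tendsto_indicator ?_ ?_
  · intro n
    filter_upwards [eventually_mem_freqs n] with K hK r hr
    have h1 := norm_seqNonlin_le r hR hμ (hmass K r hr) hK
    exact (norm_indicator_le_norm_self _ _).trans h1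
  · refine Eventually.of_forall fun K => ?_
    have e : ∀ r, 3 / 2 * (R ^ 2 / μ + μ / 2 * quartNorm K r (x r)) + 6 * R ^ 3 =
      (3 / 2 * (R ^ 2 / μ) + 6 * R ^ 3) + 3 / 4 * μ * quartNorm K r (x r) := fun r => by ring
    simp only [e]
    rw [integral_const_add_const_mul (hq K)]
    gcongr
    exact hC K

/-- The oscillatory estimate with threshold `L = 1`, after the resonant part is bounded by the mass
and the negative sum of fourth powers is dropped. The result is affine in the variation `Y`. -/
theorem integral_quartNorm_le {x : ℝ → ℤ → ℂ} {s t R Y : ℝ} (hst : s ≤ t)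
    (hx : Controlled x s t R Y) (K : ℕ) :
    ∫ r in s..t, quartNorm K r (x r) ≤ 2 * R ^ 4 * (t - s) +
      oscConst * (2 * R ^ 4 + 4 * Y * R ^ 3) + 2 * (t - s) * oscConst * R ^ 4 := by
  have hq := continuous_quartNorm hx.cont K
  have hs := continuous_quartSum hx.cont hx.cont hx.cont hx.cont K
  have h1 := norm_integral_quartSum_le K le_rfl hst hx hx hx hx
  have h2 : ∫ r in s..t, quartNorm K r (x r) ≤
      ∫ r in s..t, ((quartSum K r (x r) (x r) (x r) (x r)).re + 2 * R ^ 4) := by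
    refine intervalIntegral.integral_mono_on hst (hq.intervalIntegrable _ _)
      (Continuous.intervalIntegrable (by fun_prop) _ _) fun r hr => ?_
    rw [quartNorm_eq]
    have h3 : mass K (x r) ^ 2 ≤ (R ^ 2) ^ 2 :=
      pow_le_pow_left₀ (mass_nonneg K _) (hx.mass_le K r hr) 2
    have h4 : 0 ≤ ∑ n ∈ freqs K, ‖x r n‖ ^ 4 := Finset.sum_nonneg fun _ _ => by positivity
    nlinarith
  have h3 : ∫ r in s..t, (quartSum K r (x r) (x r) (x r) (x r)).re =
      (∫ r in s..t, quartSum K r (x r) (x r) (x r) (x r)).re :=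
    Complex.reCLM.intervalIntegral_comp_comm (hs.intervalIntegrable _ _)
  have hre : Continuous fun r => (quartSum K r (x r) (x r) (x r) (x r)).re :=
    Complex.continuous_re.comp hs
  rw [intervalIntegral.integral_add (hre.intervalIntegrable _ _) (by simp), h3,
    intervalIntegral.integral_const, smul_eq_mul] at h2
  have h4 := (Complex.re_le_norm (∫ r in s..t, quartSum K r (x r) (x r) (x r) (x r))).trans h1
  rw [inv_one] at h4
  nlinarith

/-- A priori bounds for the space-time `L⁴` norm and for the variation of the coefficients, in
terms of the mass. -/
theorem exists_apriori {R T : ℝ} (hR : 0 ≤ R) (hT : 0 < T) :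
    ∃ B, 0 ≤ B ∧ ∀ (S : Set ℤ) (x : ℝ → ℤ → ℂ), IsSol S x →
      (∀ K, ∀ r ∈ Set.Icc (-T) T, mass K (x r) ≤ R ^ 2) →
      (∀ K, ∫ r in (-T)..T, quartNorm K r (x r) ≤ B) ∧ Controlled x (-T) T R B := by
  have hosc := oscConst_nonneg
  -- Inserting `Y = Y₀ + (3/4) μ M` into `4 oscConst Y R³` produces `3 oscConst R³ μ M`; this `μ`
  -- makes it at most `M / 2`.
  obtain ⟨μ, hμ, hμ2⟩ : ∃ μ : ℝ, 0 < μ ∧ 3 * oscConst * R ^ 3 * μ ≤ 1 / 2 := by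
    refine ⟨(6 * oscConst * R ^ 3 + 1)⁻¹, by positivity, ?_⟩
    rw [← div_eq_mul_inv, div_le_iff₀ (by positivity)]
    have : 0 ≤ oscConst * R ^ 3 := by positivity
    nlinarith
  set Y₀ := 2 * T * (3 / 2 * (R ^ 2 / μ) + 6 * R ^ 3) with hY₀
  set C₁ := 2 * R ^ 4 * (2 * T) + oscConst * (2 * R ^ 4 + 4 * Y₀ * R ^ 3) +
    2 * (2 * T) * oscConst * R ^ 4 with hC₁
  have hY0 : 0 ≤ Y₀ := by positivity
  have hC1 : 0 ≤ C₁ := by positivity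
  refine ⟨2 * C₁ + (Y₀ + 3 / 4 * μ * (2 * C₁)), by positivity, fun S x hx hmass => ?_⟩
  have hTT : -T ≤ T := by linarith
  have hvar : ∀ C, (∀ K, ∫ r in (-T)..T, quartNorm K r (x r) ≤ C) →
      HasVar x (-T) T (Y₀ + 3 / 4 * μ * C) := by
    intro C hC
    refine (hx.hasVar hR hμ hmass hC).mono le_rfl le_rfl (le_of_eq ?_)
    rw [hY₀]; ring
  -- The qualitative `L⁴` hypothesis is used only to make the supremum `M` finite, so that `M ≤ C₁ +
  -- M / 2` can be absorbed; the final bound does not depend on `C`.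
  obtain ⟨C, hC⟩ := hx.memL4 T hT
  have hbdd : BddAbove (Set.range fun K => ∫ r in (-T)..T, quartNorm K r (x r)) :=
    ⟨C, by rintro _ ⟨K, rfl⟩; exact hC K⟩
  set M := ⨆ K, ∫ r in (-T)..T, quartNorm K r (x r)
  have hM : ∀ K, ∫ r in (-T)..T, quartNorm K r (x r) ≤ M := le_ciSup hbdd
  have hM2 : M ≤ C₁ + M / 2 := by
    have h0 : 0 ≤ M := le_trans (intervalIntegral.integral_nonneg hTT
      fun r _ => quartNorm_nonneg 0 r (x r)) (hM 0)
    refine ciSup_le fun K => ?_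
    refine (integral_quartNorm_le hTT ⟨hx.cont, hR, hmass, hvar M hM⟩ K).trans ?_
    rw [hC₁]
    nlinarith [mul_le_mul_of_nonneg_right hμ2 h0]
  have hM3 : M ≤ 2 * C₁ := by linarith
  refine ⟨fun K => (hM K).trans (hM3.trans (by nlinarith)), hx.cont, hR, hmass,
    (hvar _ fun K => (hM K).trans hM3).mono le_rfl le_rfl (by linarith)⟩

/-! ### The energy identity -/

theorem normSq_sub_normSq (z w : ℂ) :
    ‖z‖ ^ 2 - ‖w‖ ^ 2 = ((z - w) * conj (w + z)).re := by
  rw [← Complex.normSq_eq_norm_sq, ← Complex.normSq_eq_norm_sq, Complex.normSq_apply,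
    Complex.normSq_apply]
  simp
  ring

/-- A chain rule for `‖f‖²` when `f` is only a limit of integrals. On a fixed fine partition the
increments of `‖f‖²` are `Re (f(u') - f(u)) conj(f(u) + f(u'))`, where the limit in `K` may be
taken; replacing `f(u) + f(u')` by `2f(r)` costs at most `2ηY`, uniformly in large `K`. -/
theorem tendsto_energy {f : ℝ → ℂ} {h : ℕ → ℝ → ℂ} {s t Y : ℝ} (hst : s ≤ t)
    (hf : Continuous f) (hh : ∀ K, Continuous (h K))
    (hlim : ∀ s' t', Tendsto (fun K => ∫ r in s'..t', h K r) atTop (𝓝 (f t' - f s')))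
    (hY : ∀ᶠ K in atTop, ∫ r in s..t, ‖h K r‖ ≤ Y) :
    Tendsto (fun K => ∫ r in s..t, 2 * (h K r * conj (f r)).re) atTop
      (𝓝 (‖f t‖ ^ 2 - ‖f s‖ ^ 2)) := by
  rw [Metric.tendsto_nhds]
  intro ε hε
  set η := ε / (4 * (|Y| + 1)) with hη
  have hη0 : 0 < η := by positivity
  obtain ⟨m, hm, hm0⟩ :=
    ((eventually_part_oscillation hf hst hη0).and (eventually_ne_atTop 0)).exists
  set u := part s t m with hu
  have hu0 : u 0 = s := part_zero s t m
  have hum : u m = t := part_self s t hm0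
  have hmono : Monotone u := part_mono hst m
  have hsplit : ‖f t‖ ^ 2 - ‖f s‖ ^ 2 =
      ∑ j ∈ Finset.range m, ((f (u (j + 1)) - f (u j)) * conj (f (u j) + f (u (j + 1)))).re := by
    simp only [← normSq_sub_normSq]
    rw [Finset.sum_range_sub (fun j => ‖f (u j)‖ ^ 2), hu0, hum]
  have hlim2 : Tendsto (fun K => ∑ j ∈ Finset.range m,
      ((∫ r in u j..u (j + 1), h K r) * conj (f (u j) + f (u (j + 1)))).re) atTop
      (𝓝 (‖f t‖ ^ 2 - ‖f s‖ ^ 2)) := by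
    rw [hsplit]
    exact tendsto_finsetSum _ fun j _ =>
      (Complex.continuous_re.tendsto _).comp ((hlim _ _).mul_const _)
  filter_upwards [hY, Metric.tendsto_nhds.1 hlim2 (ε / 2) (by positivity)] with K hYK hK
  have hc : Continuous fun r => 2 * (h K r * conj (f r)).re :=
    continuous_const.mul (Complex.continuous_re.comp
      ((hh K).mul (Complex.continuous_conj.comp hf)))
  have hclose : |(∫ r in s..t, 2 * (h K r * conj (f r)).re) - ∑ j ∈ Finset.range m,
      ((∫ r in u j..u (j + 1), h K r) * conj (f (u j) + f (u (j + 1)))).re| ≤ 2 * η * Y := by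
    have e1 : ∫ r in s..t, 2 * (h K r * conj (f r)).re =
        ∑ j ∈ Finset.range m, ∫ r in u j..u (j + 1), 2 * (h K r * conj (f r)).re := by
      rw [intervalIntegral.sum_integral_adjacent_intervals
        fun k _ => hc.intervalIntegrable _ _, hu0, hum]
    have e2 : ∑ j ∈ Finset.range m, ∫ r in u j..u (j + 1), ‖h K r‖ = ∫ r in s..t, ‖h K r‖ := by
      rw [intervalIntegral.sum_integral_adjacent_intervals
        fun k _ => (hh K).norm.intervalIntegrable _ _, hu0, hum]
    rw [e1, ← Finset.sum_sub_distrib]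
    calc _ ≤ ∑ j ∈ Finset.range m, 2 * η * ∫ r in u j..u (j + 1), ‖h K r‖ := by
          refine (Finset.abs_sum_le_sum_abs _ _).trans (Finset.sum_le_sum fun j _ => ?_)
          have hle : u j ≤ u (j + 1) := hmono (Nat.le_succ j)
          have hcj : Continuous fun r => (h K r * conj (f (u j) + f (u (j + 1)))).re :=
            Complex.continuous_re.comp ((hh K).mul continuous_const)
          have e3 : ((∫ r in u j..u (j + 1), h K r) * conj (f (u j) + f (u (j + 1)))).re =
              ∫ r in u j..u (j + 1), (h K r * conj (f (u j) + f (u (j + 1)))).re := by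
            rw [← intervalIntegral.integral_mul_const]
            exact (Complex.reCLM.intervalIntegral_comp_comm
              (((hh K).mul continuous_const).intervalIntegrable _ _)).symm
          rw [e3, ← intervalIntegral.integral_sub (hc.intervalIntegrable _ _)
            (hcj.intervalIntegrable _ _), ← intervalIntegral.integral_const_mul,
            ← Real.norm_eq_abs]
          refine intervalIntegral.norm_integral_le_of_norm_le hle
            (Eventually.of_forall fun r hr => ?_)
            ((continuous_const.mul (hh K).norm).intervalIntegrable _ _)
          have hr' := hm j r ⟨hr.1.le, hr.2⟩
          have e4 : 2 * (h K r * conj (f r)).re - (h K r * conj (f (u j) + f (u (j + 1)))).re =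
              (h K r * conj ((f r - f (u j)) + (f r - f (u (j + 1))))).re := by
            simp; ring
          rw [e4, Real.norm_eq_abs]
          refine (Complex.abs_re_le_norm _).trans ?_
          rw [norm_mul, RCLike.norm_conj, mul_comm]
          gcongr
          exact (norm_add_le _ _).trans (by linarith [hr'.1, hr'.2])
      _ ≤ _ := by rw [← Finset.mul_sum, e2]; gcongr
  have hηY : 2 * η * Y < ε / 2 := by
    have h1 : 2 * η * Y ≤ 2 * η * |Y| := by gcongr; exact le_abs_self Y
    have h2 : 2 * η * |Y| < 2 * η * (|Y| + 1) := by gcongr; linarith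
    have h3 : 2 * η * (|Y| + 1) = ε / 2 := by rw [hη]; field_simp; norm_num
    linarith
  rw [Real.dist_eq] at hK ⊢
  rw [abs_lt] at hK ⊢
  have := abs_le.1 hclose
  constructor <;> linarith [hK.1, hK.2, this.1, this.2]

/-! ### Restriction of the frequencies -/

theorem continuous_indicator_apply {x : ℝ → ℤ → ℂ} (hx : ∀ n, Continuous fun r => x r n)
    (F : Set ℤ) (n : ℤ) : Continuous fun r => F.indicator (x r) n := by
  by_cases hn : n ∈ F
  · simpa [hn] using hx n
  · simpa [hn] using continuous_const

theorem mass_indicator_le (F : Set ℤ) (K : ℕ) (x : ℤ → ℂ) : mass K (F.indicator x) ≤ mass K x := by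
  refine Finset.sum_le_sum fun n _ => ?_
  gcongr
  exact norm_indicator_le_norm_self _ _

theorem HasVar.indicator {x : ℝ → ℤ → ℂ} {s t Y : ℝ} (h : HasVar x s t Y) (F : Set ℤ) :
    HasVar (fun r => F.indicator (x r)) s t Y := by
  intro m u hu hmem ν
  refine (Finset.sum_le_sum fun j _ => ?_).trans (h m u hu hmem ν)
  by_cases hn : ν j ∈ F <;> simp [hn]

theorem Controlled.indicator {x : ℝ → ℤ → ℂ} {s t A Y : ℝ} (h : Controlled x s t A Y)
    (F : Set ℤ) : Controlled (fun r => F.indicator (x r)) s t A Y where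
  cont := continuous_indicator_apply h.cont F
  nonneg := h.nonneg
  mass_le K r hr := (mass_indicator_le F K _).trans (h.mass_le K r hr)
  var := h.var.indicator F

theorem abs_integral_two_re_le {g : ℝ → ℂ} (hg : Continuous g) (s t : ℝ) :
    |∫ r in s..t, 2 * (-Complex.I * g r).re| ≤ 2 * ‖∫ r in s..t, g r‖ := by
  have h1 : ∫ r in s..t, 2 * (-Complex.I * g r).re =
      2 * (-Complex.I * ∫ r in s..t, g r).re := by
    rw [intervalIntegral.integral_const_mul, ← intervalIntegral.integral_const_mul (-Complex.I)]
    congr 1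
    exact Complex.reCLM.intervalIntegral_comp_comm
      ((continuous_const.mul hg).intervalIntegrable _ _)
  rw [h1, abs_mul, abs_two]
  gcongr
  refine (Complex.abs_re_le_norm _).trans_eq ?_
  simp

theorem not_mem_freqs {N : ℕ} {n : ℤ} (h : n ∉ freqs N) : ((N : ℝ)) ^ 2 ≤ (n : ℝ) ^ 2 := by
  have : (N : ℤ) ≤ |n| := by
    by_contra! hlt
    exact h (by simp only [freqs, Finset.mem_Icc]; exact abs_le.1 hlt.le)
  rw [← sq_abs (n : ℝ)]
  have : (N : ℝ) ≤ |(n : ℝ)| := by exact_mod_cast this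
  gcongr

theorem freqs_mono {N K : ℕ} (h : N ≤ K) : freqs N ⊆ freqs K := by
  intro n hn
  simp only [freqs, Finset.mem_Icc] at hn ⊢
  omega

theorem IsSol.integral_norm_le {S : Set ℤ} {x : ℝ → ℤ → ℂ} (hx : IsSol S x) {s t R B : ℝ}
    (hst : s ≤ t) (hR : 0 ≤ R) (hmass : ∀ K, ∀ r ∈ Set.Icc s t, mass K (x r) ≤ R ^ 2)
    (hB : ∀ K, ∫ r in s..t, quartNorm K r (x r) ≤ B) {K : ℕ} {n : ℤ} (hn : n ∈ freqs K) :
    ∫ r in s..t, ‖seqNonlin K r (x r) n‖ ≤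
      (3 / 2 * R ^ 2 + 6 * R ^ 3) * (t - s) + 3 / 4 * B := by
  have hq := continuous_quartNorm hx.cont K
  calc _ ≤ ∫ r in s..t, ((3 / 2 * R ^ 2 + 6 * R ^ 3) + 3 / 4 * quartNorm K r (x r)) := by
        refine intervalIntegral.integral_mono_on hst
          ((continuous_seqNonlin hx.cont K n).norm.intervalIntegrable _ _)
          (Continuous.intervalIntegrable (by fun_prop) _ _) fun r hr => ?_
        have := norm_seqNonlin_le r hR one_pos (hmass K r hr) hn
        linarith
    _ = (3 / 2 * R ^ 2 + 6 * R ^ 3) * (t - s) + 3 / 4 * ∫ r in s..t, quartNorm K r (x r) := by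
        rw [integral_const_add_const_mul hq, mul_comm]
    _ ≤ _ := by gcongr; exact hB K

/-- The mass of the high frequencies varies little. -/
theorem IsSol.abs_tail_sub_le {S : Set ℤ} {x : ℝ → ℤ → ℂ} (hx : IsSol S x) {s t R B : ℝ}
    (hst : s ≤ t) (hc : Controlled x s t R B)
    (hB : ∀ K, ∫ r in s..t, quartNorm K r (x r) ≤ B) {N : ℕ} (hN : 1 ≤ N) (J : ℕ) :
    |∑ n ∈ freqs J \ freqs N, ‖x t n‖ ^ 2 - ∑ n ∈ freqs J \ freqs N, ‖x s n‖ ^ 2| ≤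
      2 * ((N : ℝ)⁻¹ * (oscConst * (2 * R ^ 4 + 4 * B * R ^ 3))) := by
  set F := freqs J \ freqs N with hF
  set d : ℝ → ℤ → ℂ := fun r => (F : Set ℤ).indicator (x r) with hd
  have hdc : Controlled d s t R B := hc.indicator _
  have hlim : Tendsto (fun K => ∑ n ∈ F, ∫ r in s..t,
      2 * (S.indicator (seqNonlin K r (x r)) n * conj (x r n)).re) atTop
      (𝓝 (∑ n ∈ F, (‖x t n‖ ^ 2 - ‖x s n‖ ^ 2))) := by
    refine tendsto_finsetSum _ fun n _ => tendsto_energy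
      (h := fun K r => S.indicator (seqNonlin K r (x r)) n)
      (Y := (3 / 2 * R ^ 2 + 6 * R ^ 3) * (t - s) + 3 / 4 * B) hst (hx.cont n)
      (fun K => continuous_indicator_apply (continuous_seqNonlin hx.cont K) S n)
      (hx.tendsto_indicator n) ?_
    filter_upwards [eventually_mem_freqs n] with K hK
    refine le_trans ?_ (hx.integral_norm_le hst hc.nonneg hc.mass_le hB hK)
    refine intervalIntegral.integral_mono_on hst
      ((continuous_indicator_apply (continuous_seqNonlin hx.cont K) S n).norm.intervalIntegrable
        _ _) ((continuous_seqNonlin hx.cont K n).norm.intervalIntegrable _ _) fun r _ =>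
        norm_indicator_le_norm_self _ _
  rw [← Finset.sum_sub_distrib]
  refine le_of_tendsto hlim.abs ?_
  filter_upwards [eventually_ge_atTop J] with K hK
  have hFK : F ⊆ freqs K := Finset.sdiff_subset.trans (freqs_mono hK)
  -- The diagonal term `i|x_n|²x_n` has no real part against `conj x_n`, and the sum extends from
  -- `F` to all `|n| ≤ K` because `d` vanishes off `F`.
  have hpt : ∀ r, ∑ n ∈ F, 2 * (S.indicator (seqNonlin K r (x r)) n * conj (x r n)).re =
      2 * (-Complex.I * quartSum K r (x r) (x r) (x r) (d r)).re := by
    intro r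
    rw [← sum_triSum_mul_conj, Finset.mul_sum, Complex.re_sum, Finset.mul_sum]
    refine Finset.sum_subset_zero_on_sdiff hFK (fun n hn => ?_) fun n hn => ?_
    · have : n ∉ F := (Finset.mem_sdiff.1 hn).2
      simp [hd, this]
    · have hdn : d r n = x r n := by simp [hd, hn]
      rw [hdn]
      by_cases hnS : n ∈ S
      · rw [Set.indicator_of_mem hnS, seqNonlin, add_mul, Complex.add_re]
        have : (Complex.I * ((‖x r n‖ ^ 2 : ℝ) : ℂ) * x r n * conj (x r n)).re = 0 := by
          rw [mul_assoc, Complex.mul_conj]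
          simp [-Complex.ofReal_pow]
        rw [this, add_zero, mul_assoc]
      · simp [hx.supp r n hnS]
  have hcont : ∀ n, Continuous fun r =>
      2 * (S.indicator (seqNonlin K r (x r)) n * conj (x r n)).re := fun n =>
    continuous_const.mul (Complex.continuous_re.comp
      ((continuous_indicator_apply (continuous_seqNonlin hx.cont K) S n).mul
        (Complex.continuous_conj.comp (hx.cont n))))
  rw [← intervalIntegral.integral_finsetSum fun n _ => (hcont n).intervalIntegrable _ _]
  simp only [hpt]
  refine (abs_integral_two_re_le (continuous_quartSum hx.cont hx.cont hx.cont hdc.cont K) s t).trans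
    ?_
  have hN' : (1 : ℝ) ≤ N := by exact_mod_cast hN
  -- The output frequency lies in `F`, hence outside `freqs N`, so every contributing quadruple has
  -- size at least `N²`.
  have := norm_integral_quartSum_le_of_high K hN' hst hc hc hc hdc fun r q hq => by
    have hqF : q.1 ∉ F := fun hmem => absurd (sq_out_le_quadSize q) (not_le.2
      (lt_of_lt_of_le hq (not_mem_freqs (Finset.mem_sdiff.1 hmem).2)))
    simp [quadProd, hd, hqF]
  refine mul_le_mul_of_nonneg_left (this.trans_eq ?_) zero_le_two
  ring

/-! ### Comparison of two solutions -/

/-- Telescoping in the first three slots, with `b - a` split into `w` and `h`. With `d = w` the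
first group has `w` twice and the second has one `w` and one `h`. -/
theorem quartSum_cubic_sub (K : ℕ) (t : ℝ) (a b w h d : ℤ → ℂ) (hb : b = a + w + h) :
    quartSum K t b b b d - quartSum K t a a a d =
      (quartSum K t w b b d + quartSum K t a w b d + quartSum K t a a w d) +
      (quartSum K t h b b d + quartSum K t a h b d + quartSum K t a a h d) := by
  simp only [quartSum, ← Finset.sum_sub_distrib, ← Finset.sum_add_distrib]
  refine Finset.sum_congr rfl fun q _ => ?_
  rw [hb]
  simp only [quadProd, Pi.add_apply, map_add]
  ring

theorem norm_integral_add₆_le {f₁ f₂ f₃ f₄ f₅ f₆ : ℝ → ℂ} (h₁ : Continuous f₁)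
    (h₂ : Continuous f₂) (h₃ : Continuous f₃) (h₄ : Continuous f₄) (h₅ : Continuous f₅)
    (h₆ : Continuous f₆) {s t P Q : ℝ} (b₁ : ‖∫ r in s..t, f₁ r‖ ≤ P)
    (b₂ : ‖∫ r in s..t, f₂ r‖ ≤ P) (b₃ : ‖∫ r in s..t, f₃ r‖ ≤ P) (b₄ : ‖∫ r in s..t, f₄ r‖ ≤ Q)
    (b₅ : ‖∫ r in s..t, f₅ r‖ ≤ Q) (b₆ : ‖∫ r in s..t, f₆ r‖ ≤ Q) :
    ‖∫ r in s..t, ((f₁ r + f₂ r + f₃ r) + (f₄ r + f₅ r + f₆ r))‖ ≤ 3 * P + 3 * Q := by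
  have i : ∀ {f : ℝ → ℂ}, Continuous f → IntervalIntegrable f volume s t :=
    fun h => h.intervalIntegrable _ _
  have h₁₂ : Continuous fun r => f₁ r + f₂ r := h₁.add h₂
  have h₁₃ : Continuous fun r => f₁ r + f₂ r + f₃ r := h₁₂.add h₃
  have h₄₅ : Continuous fun r => f₄ r + f₅ r := h₄.add h₅
  have h₄₆ : Continuous fun r => f₄ r + f₅ r + f₆ r := h₄₅.add h₆
  rw [intervalIntegral.integral_add (i h₁₃) (i h₄₆), intervalIntegral.integral_add (i h₁₂) (i h₃),
    intervalIntegral.integral_add (i h₁) (i h₂), intervalIntegral.integral_add (i h₄₅) (i h₆),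
    intervalIntegral.integral_add (i h₄) (i h₅)]
  refine (norm_add_le _ _).trans (add_le_add (norm_add₃_le.trans ?_) (norm_add₃_le.trans ?_)) <;>
    linarith

/-- Taking `μ = D` in `norm_seqNonlin_sub_le` makes the variation proportional to `D`. The
restriction to `freqs N` is needed because `a` satisfies the equation only there. -/
theorem hasVar_low_sub {S : Set ℤ} {N : ℕ} {a b : ℝ → ℤ → ℂ} (ha : IsSol (freqs N) a)
    (hb : IsSol S b) (hS : (freqs N : Set ℤ) ⊆ S) {s t R B D : ℝ} (hR : 0 ≤ R)
    (hD : 0 < D) (hma : ∀ K, ∀ r ∈ Set.Icc s t, mass K (a r) ≤ R ^ 2)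
    (hmb : ∀ K, ∀ r ∈ Set.Icc s t, mass K (b r) ≤ R ^ 2)
    (hBa : ∀ K, ∫ r in s..t, quartNorm K r (a r) ≤ B)
    (hBb : ∀ K, ∫ r in s..t, quartNorm K r (b r) ≤ B)
    (hd : ∀ K, ∀ r ∈ Set.Icc s t, mass K (b r - a r) ≤ D ^ 2) :
    HasVar (fun r => (freqs N : Set ℤ).indicator (b r - a r)) s t
      (((t - s) * (3 / 2 + 6 * R ^ 2) + 3 / 2 * B) * D) := by
  have hqa := continuous_quartNorm ha.cont
  have hqb := continuous_quartNorm hb.cont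
  refine hasVar_of_tendsto (h := fun K r => (freqs N : Set ℤ).indicator
      (seqNonlin K r (b r) - seqNonlin K r (a r)))
    (y := fun K r => 3 / 2 * (D ^ 2 / D + D / 2 * (quartNorm K r (a r) + quartNorm K r (b r))) +
      6 * R ^ 2 * D)
    (fun K => by have := hqa K; have := hqb K; fun_prop)
    (fun K r => by
      have := quartNorm_nonneg K r (a r)
      have := quartNorm_nonneg K r (b r)
      positivity) ?_ ?_ ?_
  · intro n s' t'
    by_cases hn : n ∈ (freqs N : Set ℤ)
    · simp only [Set.indicator_of_mem hn, Pi.sub_apply]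
      have h1 := (hb.equation n (hS hn) s' t').sub (ha.equation n hn s' t')
      rw [show b t' n - a t' n - (b s' n - a s' n) = b t' n - b s' n - (a t' n - a s' n) by ring]
      refine h1.congr fun K => ?_
      rw [intervalIntegral.integral_sub
        ((continuous_seqNonlin hb.cont K n).intervalIntegrable _ _)
        ((continuous_seqNonlin ha.cont K n).intervalIntegrable _ _)]
    · simp [Set.indicator_of_notMem hn]
  · intro n
    filter_upwards [eventually_mem_freqs n] with K hK r hr
    exact (norm_indicator_le_norm_self _ _).trans
      (norm_seqNonlin_sub_le r hR hD.le hD (hma K r hr) (hmb K r hr) (hd K r hr) hK)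
  · refine Eventually.of_forall fun K => ?_
    have e : ∀ r, 3 / 2 * (D ^ 2 / D + D / 2 * (quartNorm K r (a r) + quartNorm K r (b r))) +
        6 * R ^ 2 * D = (3 / 2 * D + 6 * R ^ 2 * D) +
        3 / 4 * D * (quartNorm K r (a r) + quartNorm K r (b r)) := fun r => by
      field_simp; ring
    simp only [e]
    have hqq : Continuous fun r => quartNorm K r (a r) + quartNorm K r (b r) :=
      (hqa K).add (hqb K)
    rw [integral_const_add_const_mul hqq, intervalIntegral.integral_add
      ((hqa K).intervalIntegrable _ _) ((hqb K).intervalIntegrable _ _)]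
    have h1 := mul_le_mul_of_nonneg_left (add_le_add (hBa K) (hBb K)) hD.le
    nlinarith

/-- The basic estimate for the difference of a solution `b` and a solution `a` of the truncated
equation, on a short interval. -/
theorem exists_local_comparison {R T : ℝ} (hR : 0 ≤ R) (hT : 0 < T) :
    ∃ C, 0 ≤ C ∧ ∀ (S : Set ℤ) (N : ℕ) (a b : ℝ → ℤ → ℂ), IsSol (freqs N) a → IsSol S b →
      (freqs N : Set ℤ) ⊆ S → 1 ≤ N →
      (∀ K, ∀ r ∈ Set.Icc (-T) T, mass K (a r) ≤ R ^ 2) →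
      (∀ K, ∀ r ∈ Set.Icc (-T) T, mass K (b r) ≤ R ^ 2) →
      ∀ s t D L : ℝ, -T ≤ s → s ≤ t → t ≤ T → 0 < D → 1 ≤ L →
      (∀ K, ∀ r ∈ Set.Icc s t, mass K (b r - a r) ≤ D ^ 2) →
      |mass N (b t - a t) - mass N (b s - a s)| ≤
        C * (D ^ 2 * (L ^ 2 * (t - s) + L⁻¹) + D / N) := by
  have hosc := oscConst_nonneg
  obtain ⟨B, hB0, hB⟩ := exists_apriori hR hT
  set V := 2 * T * (3 / 2 + 6 * R ^ 2) + 3 / 2 * B with hV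
  have hV0 : 0 ≤ V := by positivity
  set c₁ := oscConst * (2 * R ^ 2 + 2 * V * R ^ 2 + 2 * B * R) with hc₁
  set c₂ := 2 * oscConst * R ^ 2 with hc₂
  set c₃ := oscConst * (2 * R ^ 3 + 3 * B * R ^ 2 + V * R ^ 3) with hc₃
  have hc1 : 0 ≤ c₁ := by positivity
  have hc2 : 0 ≤ c₂ := by positivity
  have hc3 : 0 ≤ c₃ := by positivity
  refine ⟨6 * (c₁ + c₂ + c₃ + R ^ 2), by positivity,
    fun S N a b ha hb hS hN hma hmb s t D L hs hst ht hD hL hd => ?_⟩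
  obtain ⟨hQa, hCa⟩ := hB _ a ha hma
  obtain ⟨hQb, hCb⟩ := hB _ b hb hmb
  have hsub : Set.Icc s t ⊆ Set.Icc (-T) T := Set.Icc_subset_Icc hs ht
  have hsubint : ∀ x : ℝ → ℤ → ℂ, (∀ n, Continuous fun r => x r n) →
      (∀ K, ∫ r in (-T)..T, quartNorm K r (x r) ≤ B) →
      ∀ K, ∫ r in s..t, quartNorm K r (x r) ≤ B := fun x hx h K =>
    (intervalIntegral.integral_mono_interval hs hst ht
      (Eventually.of_forall fun r => quartNorm_nonneg K r (x r))
      ((continuous_quartNorm hx K).intervalIntegrable _ _)).trans (h K)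
  replace hQa := hsubint a ha.cont hQa
  replace hQb := hsubint b hb.cont hQb
  replace hCa := hCa.mono hs ht le_rfl le_rfl
  replace hCb := hCb.mono hs ht le_rfl le_rfl
  set w : ℝ → ℤ → ℂ := fun r => (freqs N : Set ℤ).indicator (b r - a r) with hw
  set h : ℝ → ℤ → ℂ := fun r => ((freqs N : Set ℤ)ᶜ).indicator (b r) with hh
  have hcd : ∀ n, Continuous fun r => (b r - a r) n := fun n => (hb.cont n).sub (ha.cont n)
  have hcw : Controlled w s t D (V * D) :=
    { cont := continuous_indicator_apply hcd _
      nonneg := hD.le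
      mass_le := fun K r hr => (mass_indicator_le _ K _).trans (hd K r hr)
      var := (hasVar_low_sub ha hb hS hR hD hCa.mass_le hCb.mass_le hQa hQb hd).mono le_rfl
        le_rfl (by
          rw [hV]
          have : t - s ≤ 2 * T := by linarith
          gcongr) }
  have hch : Controlled h s t R B := hCb.indicator _
  have hdec : ∀ r, b r = a r + w r + h r := by
    intro r; ext n
    by_cases hn : n ∈ freqs N
    · simp [hw, hh, hn]
    · simp [hw, hh, hn, ha.supp r n hn]
  have hN' : (1 : ℝ) ≤ N := by exact_mod_cast hN
  have hhigh : ∀ r (k : ℤ) (q : Σ _ : ℤ, ℤ × ℤ × ℤ), (k : ℝ) ^ 2 ≤ quadSize q →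
      quadSize q < (N : ℝ) ^ 2 → h r k = 0 := by
    intro r k q hk hq
    have : k ∈ freqs N := by
      by_contra hnot
      exact absurd (not_mem_freqs hnot) (not_le.2 (lt_of_le_of_lt hk hq))
    simp [hh, this]
  -- `P` bounds the terms with two factors `w`, each of norm and variation `O(D)`. `Q` bounds those
  -- with one `w` and one `h`: `h` need not be small, but it forces a frequency outside `freqs N`
  -- and so gains `1/N`.
  set P := L⁻¹ * c₁ * D ^ 2 + L ^ 2 * (t - s) * c₂ * D ^ 2 with hP
  set Q := (N : ℝ)⁻¹ * c₃ * D with hQ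
  have hQuart : ∀ K, ‖∫ r in s..t, (quartSum K r (b r) (b r) (b r) (w r) -
      quartSum K r (a r) (a r) (a r) (w r))‖ ≤ 3 * P + 3 * Q := by
    intro K
    simp only [quartSum_cubic_sub K _ (a _) (b _) (w _) (h _) (w _) (hdec _)]
    refine norm_integral_add₆_le (continuous_quartSum hcw.cont hb.cont hb.cont hcw.cont K)
      (continuous_quartSum ha.cont hcw.cont hb.cont hcw.cont K)
      (continuous_quartSum ha.cont ha.cont hcw.cont hcw.cont K)
      (continuous_quartSum hch.cont hb.cont hb.cont hcw.cont K)
      (continuous_quartSum ha.cont hch.cont hb.cont hcw.cont K)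
      (continuous_quartSum ha.cont ha.cont hch.cont hcw.cont K) ?_ ?_ ?_ ?_ ?_ ?_
    · exact (norm_integral_quartSum_le K hL hst hcw hCb hCb hcw).trans_eq
        (by rw [hP, hc₁, hc₂]; ring)
    · exact (norm_integral_quartSum_le K hL hst hCa hcw hCb hcw).trans_eq
        (by rw [hP, hc₁, hc₂]; ring)
    · exact (norm_integral_quartSum_le K hL hst hCa hCa hcw hcw).trans_eq
        (by rw [hP, hc₁, hc₂]; ring)
    · exact (norm_integral_quartSum_le_of_high K hN' hst hch hCb hCb hcw fun r q hq => by
        simp [quadProd, hhigh r q.2.1 q (sq_fst_le_quadSize q) hq]).trans_eq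
        (by rw [hQ, hc₃]; ring)
    · exact (norm_integral_quartSum_le_of_high K hN' hst hCa hch hCb hcw fun r q hq => by
        simp [quadProd, hhigh r q.2.2.1 q (sq_snd_le_quadSize q) hq]).trans_eq
        (by rw [hQ, hc₃]; ring)
    · exact (norm_integral_quartSum_le_of_high K hN' hst hCa hCa hch hcw fun r q hq => by
        simp [quadProd, hhigh r q.2.2.2 q (sq_trd_le_quadSize q) hq]).trans_eq
        (by rw [hQ, hc₃]; ring)
  have hlim : Tendsto (fun K => ∑ n ∈ freqs N, ∫ r in s..t,
      2 * ((seqNonlin K r (b r) n - seqNonlin K r (a r) n) * conj ((b r - a r) n)).re) atTop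
      (𝓝 (∑ n ∈ freqs N, (‖(b t - a t) n‖ ^ 2 - ‖(b s - a s) n‖ ^ 2))) := by
    refine tendsto_finsetSum _ fun n hn => tendsto_energy
      (f := fun r => (b r - a r) n)
      (h := fun K r => seqNonlin K r (b r) n - seqNonlin K r (a r) n)
      (Y := 2 * ((3 / 2 * R ^ 2 + 6 * R ^ 3) * (t - s) + 3 / 4 * B)) hst (hcd n)
      (fun K => (continuous_seqNonlin hb.cont K n).sub (continuous_seqNonlin ha.cont K n)) ?_ ?_
    · intro s' t'
      have h1 := (hb.equation n (hS hn) s' t').sub (ha.equation n hn s' t')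
      simp only [Pi.sub_apply]
      rw [show b t' n - a t' n - (b s' n - a s' n) = b t' n - b s' n - (a t' n - a s' n) by ring]
      refine h1.congr fun K => ?_
      rw [intervalIntegral.integral_sub
        ((continuous_seqNonlin hb.cont K n).intervalIntegrable _ _)
        ((continuous_seqNonlin ha.cont K n).intervalIntegrable _ _)]
    · filter_upwards [eventually_mem_freqs n] with K hK
      have ca := (continuous_seqNonlin ha.cont K n).norm
      have cb := (continuous_seqNonlin hb.cont K n).norm
      have ia := ha.integral_norm_le hst hR hCa.mass_le hQa hK
      have ib := hb.integral_norm_le hst hR hCb.mass_le hQb hK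
      calc _ ≤ ∫ r in s..t, (‖seqNonlin K r (b r) n‖ + ‖seqNonlin K r (a r) n‖) :=
            intervalIntegral.integral_mono_on hst
              (((continuous_seqNonlin hb.cont K n).sub
                (continuous_seqNonlin ha.cont K n)).norm.intervalIntegrable _ _)
              ((cb.add ca).intervalIntegrable _ _) fun r _ => norm_sub_le _ _
        _ = _ := intervalIntegral.integral_add (cb.intervalIntegrable _ _)
              (ca.intervalIntegrable _ _)
        _ ≤ _ := by linarith
  rw [mass, mass, ← Finset.sum_sub_distrib]
  refine le_of_tendsto hlim.abs ?_
  filter_upwards [eventually_ge_atTop N] with K hK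
  set g : ℝ → ℂ := fun r => quartSum K r (b r) (b r) (b r) (w r) -
    quartSum K r (a r) (a r) (a r) (w r) with hg
  -- The diagonal terms of the two equations do not oscillate; their difference is Lipschitz in `b -
  -- a` and contributes `O(R² D² (t - s))`.
  set e : ℝ → ℝ := fun r => ∑ n ∈ freqs N, 2 * (Complex.I * (b r n * conj (b r n) * b r n -
    a r n * conj (a r n) * a r n) * conj ((b r - a r) n)).re with he
  have hgc : Continuous g := (continuous_quartSum hb.cont hb.cont hb.cont hcw.cont K).sub
    (continuous_quartSum ha.cont ha.cont ha.cont hcw.cont K)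
  have hec : Continuous e := by
    refine continuous_finsetSum _ fun n _ => ?_
    have h1 := ha.cont n
    have h2 := hb.cont n
    have h3 := hcd n
    fun_prop
  have hpt : ∀ r, ∑ n ∈ freqs N,
      2 * ((seqNonlin K r (b r) n - seqNonlin K r (a r) n) * conj ((b r - a r) n)).re =
      2 * (-Complex.I * g r).re + e r := by
    intro r
    have h1 : g r = ∑ n ∈ freqs N, (triSum K r (b r) (b r) (b r) n -
        triSum K r (a r) (a r) (a r) n) * conj ((b r - a r) n) := by
      rw [hg]
      simp only
      rw [← sum_triSum_mul_conj, ← sum_triSum_mul_conj, ← Finset.sum_sub_distrib]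
      refine (Finset.sum_subset_zero_on_sdiff (freqs_mono hK) (fun n hn => ?_)
        fun n hn => ?_).symm
      · have : n ∉ freqs N := (Finset.mem_sdiff.1 hn).2
        simp [hw, this]
      · simp only [hw, Set.indicator_of_mem (Finset.mem_coe.2 hn)]
        ring
    rw [h1, he, Finset.mul_sum, Complex.re_sum, Finset.mul_sum, ← Finset.sum_add_distrib]
    refine Finset.sum_congr rfl fun n _ => ?_
    rw [← mul_add, ← Complex.add_re]
    congr 2
    simp only [seqNonlin, Complex.mul_conj']
    push_cast
    ring
  have hterm : ∀ n, Continuous fun r =>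
      2 * ((seqNonlin K r (b r) n - seqNonlin K r (a r) n) * conj ((b r - a r) n)).re := fun n =>
    continuous_const.mul (Complex.continuous_re.comp
      (((continuous_seqNonlin hb.cont K n).sub (continuous_seqNonlin ha.cont K n)).mul
        (Complex.continuous_conj.comp (hcd n))))
  have hgr : Continuous fun r => 2 * (-Complex.I * g r).re :=
    continuous_const.mul (Complex.continuous_re.comp (continuous_const.mul hgc))
  rw [← intervalIntegral.integral_finsetSum fun n _ => (hterm n).intervalIntegrable _ _]
  simp only [hpt]
  rw [intervalIntegral.integral_add (hgr.intervalIntegrable _ _) (hec.intervalIntegrable _ _)]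
  have hE : |∫ r in s..t, e r| ≤ 6 * R ^ 2 * D ^ 2 * (t - s) := by
    rw [← Real.norm_eq_abs]
    refine (intervalIntegral.norm_integral_le_of_norm_le_const
      (C := 6 * R ^ 2 * D ^ 2) fun r hr => ?_).trans_eq
      (by rw [abs_of_nonneg (sub_nonneg.2 hst)])
    rw [Set.uIoc_of_le hst] at hr
    have hr' : r ∈ Set.Icc s t := ⟨hr.1.le, hr.2⟩
    calc ‖e r‖ ≤ ∑ n ∈ freqs N, 6 * R ^ 2 * ‖(b r - a r) n‖ ^ 2 := by
          refine norm_sum_le_of_le _ fun n hn => ?_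
          rw [norm_mul, Real.norm_eq_abs, Real.norm_eq_abs, abs_two]
          have h1 := norm_cubic_sub_le (a r n) (b r n)
          have h2 := norm_apply_le_of_mass_le hR (hCa.mass_le N r hr') hn
          have h3 := norm_apply_le_of_mass_le hR (hCb.mass_le N r hr') hn
          have h4 : ‖a r n‖ ^ 2 + ‖b r n‖ ^ 2 ≤ 2 * R ^ 2 := by
            nlinarith [norm_nonneg (a r n), norm_nonneg (b r n)]
          have h5 : ‖b r n * conj (b r n) * b r n - a r n * conj (a r n) * a r n‖ ≤
              3 * R ^ 2 * ‖(b r - a r) n‖ := by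
            refine h1.trans ?_
            have := mul_le_mul_of_nonneg_left h4 (norm_nonneg (b r n - a r n))
            simp only [Pi.sub_apply]
            nlinarith
          have h6 := Complex.abs_re_le_norm (Complex.I * (b r n * conj (b r n) * b r n -
            a r n * conj (a r n) * a r n) * conj ((b r - a r) n))
          rw [norm_mul, norm_mul, Complex.norm_I, one_mul, RCLike.norm_conj] at h6
          nlinarith [mul_le_mul_of_nonneg_right h5 (norm_nonneg ((b r - a r) n))]
      _ = 6 * R ^ 2 * mass N (b r - a r) := by rw [← Finset.mul_sum, mass]
      _ ≤ _ := by gcongr; exact hd N r hr'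
  have hG := (abs_integral_two_re_le hgc s t).trans (mul_le_mul_of_nonneg_left (hQuart K)
    zero_le_two)
  refine (abs_add_le _ _).trans ((add_le_add hG hE).trans ?_)
  have hτ : 0 ≤ t - s := sub_nonneg.2 hst
  have hL2 : 1 ≤ L ^ 2 := one_le_pow₀ hL
  have hLi : 0 ≤ L⁻¹ := inv_nonneg.2 (by linarith)
  have hNi : 0 ≤ (N : ℝ)⁻¹ := by positivity
  have e1 : 6 * R ^ 2 * D ^ 2 * (t - s) ≤ 6 * R ^ 2 * (D ^ 2 * (L ^ 2 * (t - s))) := by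
    have : t - s ≤ L ^ 2 * (t - s) := le_mul_of_one_le_left hτ hL2
    have := mul_le_mul_of_nonneg_left this (by positivity : 0 ≤ 6 * R ^ 2 * D ^ 2)
    linarith
  set α := D ^ 2 * (L ^ 2 * (t - s)) with hα
  set β := D ^ 2 * L⁻¹ with hβ
  set γ := (N : ℝ)⁻¹ * D with hγ
  have hα0 : 0 ≤ α := by positivity
  have hβ0 : 0 ≤ β := by positivity
  have hγ0 : 0 ≤ γ := by positivity
  have eP : P = c₁ * β + c₂ * α := by rw [hP, hα, hβ]; ring
  have eQ : Q = c₃ * γ := by rw [hQ, hγ]; ring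
  have eR : D ^ 2 * (L ^ 2 * (t - s) + L⁻¹) + D / N = α + β + γ := by
    rw [hα, hβ, hγ]; ring
  rw [eP, eQ, eR]
  have p1 := mul_nonneg hc1 hα0
  have p2 := mul_nonneg hc1 hγ0
  have p3 := mul_nonneg hc2 hβ0
  have p4 := mul_nonneg hc2 hγ0
  have p5 := mul_nonneg hc3 hα0
  have p6 := mul_nonneg hc3 hβ0
  have p7 := mul_nonneg (sq_nonneg R) hβ0
  have p8 := mul_nonneg (sq_nonneg R) hγ0
  linarith

/-- A discrete Grönwall inequality: the last of the `m + 1` equal steps starts at the point at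
fraction `m / (m + 1)` of the way from `r'` to `r`. -/
theorem le_of_short_steps {f : ℝ → ℝ} {T τ e : ℝ} (he : 0 ≤ e)
    (h : ∀ r ∈ Set.Icc (-T) T, ∀ r' ∈ Set.Icc (-T) T, |r - r'| ≤ τ → f r ≤ 2 * f r' + e)
    (m : ℕ) : ∀ r ∈ Set.Icc (-T) T, ∀ r' ∈ Set.Icc (-T) T, |r - r'| ≤ m * τ →
      f r ≤ 2 ^ m * (f r' + m * e) := by
  induction m with
  | zero =>
    intro r _ r' _ hrr
    have : r = r' := by
      have : |r - r'| ≤ 0 := by simpa using hrr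
      exact sub_eq_zero.1 (abs_nonpos_iff.1 this)
    simp [this]
  | succ m ih =>
    intro r hr r' hr' hrr
    set κ : ℝ := m / (m + 1) with hκ
    have hm : (0 : ℝ) < m + 1 := by positivity
    have hκ0 : 0 ≤ κ := by positivity
    have hκ1 : κ ≤ 1 := (div_le_one hm).2 (by linarith)
    set ρ := r' + κ * (r - r') with hρ
    push_cast at hrr
    have hρmem : ρ ∈ Set.Icc (-T) T := by
      constructor <;> rw [hρ] <;> nlinarith [hr.1, hr.2, hr'.1, hr'.2]
    have h1 : |ρ - r'| ≤ m * τ := by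
      have : ρ - r' = κ * (r - r') := by rw [hρ]; ring
      rw [this, abs_mul, abs_of_nonneg hκ0, hκ, div_mul_eq_mul_div, div_le_iff₀ hm]
      have := mul_le_mul_of_nonneg_left hrr (by positivity : (0 : ℝ) ≤ m)
      linarith
    have h2 : |r - ρ| ≤ τ := by
      have : r - ρ = (1 / (m + 1)) * (r - r') := by rw [hρ, hκ]; field_simp; ring
      rw [this, abs_mul, abs_of_nonneg (by positivity), div_mul_eq_mul_div, div_le_iff₀ hm]
      linarith
    have h3 := h r hr ρ hρmem h2
    have h4 := ih ρ hρmem r' hr' h1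
    have h5 : (1 : ℝ) ≤ 2 ^ (m + 1) := one_le_pow₀ one_le_two
    have h6 : e ≤ 2 ^ (m + 1) * e := le_mul_of_one_le_left he h5
    push_cast
    calc f r ≤ 2 * (2 ^ m * (f r' + m * e)) + 2 ^ (m + 1) * e := by linarith
      _ = _ := by ring

theorem mass_le_mass_add {K N : ℕ} (x : ℤ → ℂ) :
    mass K x ≤ mass N x + ∑ n ∈ freqs K \ freqs N, ‖x n‖ ^ 2 := by
  rw [mass, mass, ← Finset.sum_inter_add_sum_sdiff (freqs K) (freqs N)]
  gcongr
  exact Finset.inter_subset_right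

/-- Comparison of a solution `b` with a solution `a` of the truncated equation: the difference at
one time is controlled by the difference at another time, up to an error given by the high
frequencies of `b`. -/
theorem exists_comparison {R T : ℝ} (hR : 0 ≤ R) (hT : 0 < T) :
    ∃ C, 0 ≤ C ∧ ∀ (S : Set ℤ) (N : ℕ) (a b : ℝ → ℤ → ℂ), IsSol (freqs N) a → IsSol S b →
      (freqs N : Set ℤ) ⊆ S → 1 ≤ N →
      (∀ K, ∀ r ∈ Set.Icc (-T) T, mass K (a r) ≤ R ^ 2) →
      (∀ K, ∀ r ∈ Set.Icc (-T) T, mass K (b r) ≤ R ^ 2) →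
      ∀ θ : ℝ, 0 ≤ θ →
      (∀ K, ∀ r ∈ Set.Icc (-T) T, ∑ n ∈ freqs K \ freqs N, ‖b r n‖ ^ 2 ≤ θ) →
      ∀ r ∈ Set.Icc (-T) T, ∀ r' ∈ Set.Icc (-T) T,
        mass N (b r - a r) ≤ C * (mass N (b r' - a r') + θ + (N : ℝ)⁻¹) := by
  obtain ⟨C₁, hC₁, hloc⟩ := exists_local_comparison hR hT
  -- `L` is chosen first to make `C₁ / L ≤ 1/8`, then the step `τ` to make `C₁ L² τ ≤ 1/8`, so that
  -- the quadratic term of the local comparison can be absorbed.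
  set L := 8 * C₁ + 1 with hL
  set τ := (8 * (C₁ + 1) * L ^ 2)⁻¹ with hτ
  have hL1 : 1 ≤ L := by linarith
  have hτ0 : 0 < τ := by positivity
  have hCL : C₁ * L⁻¹ ≤ 1 / 8 := by
    rw [← div_eq_mul_inv, div_le_iff₀ (by linarith)]; linarith
  have hCτ : C₁ * (L ^ 2 * τ) ≤ 1 / 8 := by
    have : L ^ 2 * τ = (8 * (C₁ + 1))⁻¹ := by rw [hτ]; field_simp
    rw [this, ← div_eq_mul_inv, div_le_iff₀ (by positivity)]; linarith
  set c := 1 + 4 * (C₁ + 1) ^ 2 with hc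
  have hc0 : 0 ≤ c := by positivity
  obtain ⟨m, hm⟩ := exists_nat_ge (2 * T / τ)
  rw [div_le_iff₀ hτ0] at hm
  refine ⟨2 ^ m * (1 + m * c), by positivity,
    fun S N a b ha hb hS hN hma hmb θ hθ htail r hr r' hr' => ?_⟩
  have hN' : (1 : ℝ) ≤ N := by exact_mod_cast hN
  have hNi : 0 < (N : ℝ)⁻¹ := by positivity
  have hNi1 : (N : ℝ)⁻¹ ≤ 1 := inv_le_one_of_one_le₀ hN'
  have hfc : Continuous fun ρ => mass N (b ρ - a ρ) :=
    continuous_mass (x := fun ρ => b ρ - a ρ) (fun n => (hb.cont n).sub (ha.cont n)) N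
  have hstep : ∀ r ∈ Set.Icc (-T) T, ∀ r' ∈ Set.Icc (-T) T, |r - r'| ≤ τ →
      mass N (b r - a r) ≤ 2 * mass N (b r' - a r') + (θ + c * (N : ℝ)⁻¹) := by
    intro r hr r' hr' hrr
    -- Evaluating at the maximum over the whole interval supplies the bound on the difference at
    -- intermediate times that the local comparison demands.
    obtain ⟨ρ, hρ, hmax⟩ := (isCompact_uIcc (a := r) (b := r')).exists_isMaxOn
      ⟨r, Set.left_mem_uIcc⟩ hfc.continuousOn
    set W := mass N (b ρ - a ρ) with hW
    have hW0 : 0 ≤ W := mass_nonneg _ _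
    -- `D²` includes `θ` for the part of `b` above `N`, where `a` vanishes, and `1/N` to make `D`
    -- positive.
    set D := √(W + θ + (N : ℝ)⁻¹) with hD
    have hDpos : 0 < D := Real.sqrt_pos.2 (by positivity)
    have hD2 : D ^ 2 = W + θ + (N : ℝ)⁻¹ := Real.sq_sqrt (by positivity)
    have hsub : Set.uIcc r r' ⊆ Set.Icc (-T) T := Set.uIcc_subset_Icc hr hr'
    have hmassD : ∀ K, ∀ x ∈ Set.uIcc r r', mass K (b x - a x) ≤ D ^ 2 := by
      intro K x hx
      have h1 : mass N (b x - a x) ≤ W := hmax hx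
      have h2 : ∑ n ∈ freqs K \ freqs N, ‖(b x - a x) n‖ ^ 2 ≤ θ := by
        refine le_trans (le_of_eq (Finset.sum_congr rfl fun n hn => ?_)) (htail K x (hsub hx))
        have : a x n = 0 := ha.supp x n (by simpa using (Finset.mem_sdiff.1 hn).2)
        simp [this]
      linarith [mass_le_mass_add (K := K) (N := N) (b x - a x)]
    have hmain : |W - mass N (b r' - a r')| ≤
        C₁ * (D ^ 2 * (L ^ 2 * τ + L⁻¹) + D / N) := by
      have hdist : |ρ - r'| ≤ τ := by
        rw [abs_sub_comm]
        exact (Set.abs_sub_right_of_mem_uIcc hρ).trans (by rwa [abs_sub_comm])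
      rcases le_total ρ r' with hle | hle
      · have := hloc S N a b ha hb hS hN hma hmb ρ r' D L (hsub hρ).1 hle hr'.2 hDpos hL1
          fun K x hx => hmassD K x
            (Set.uIcc_subset_uIcc hρ Set.right_mem_uIcc (Set.Icc_subset_uIcc hx))
        rw [abs_sub_comm]
        refine this.trans ?_
        have : r' - ρ ≤ τ := by rw [abs_sub_comm] at hdist; exact (le_abs_self _).trans hdist
        gcongr
      · have := hloc S N a b ha hb hS hN hma hmb r' ρ D L hr'.1 hle (hsub hρ).2 hDpos hL1
          fun K x hx => hmassD K x
            (Set.uIcc_subset_uIcc hρ Set.right_mem_uIcc (Set.Icc_subset_uIcc' hx))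
        refine this.trans ?_
        have : ρ - r' ≤ τ := (le_abs_self _).trans hdist
        gcongr
    -- Young's inequality leaves `D²/8`, so altogether at most `3/8` of `D²` returns to the left,
    -- and `N⁻² ≤ N⁻¹`.
    have hDN : C₁ * (D / N) ≤ D ^ 2 / 8 + 2 * (C₁ + 1) ^ 2 * (N : ℝ)⁻¹ := by
      have h1 : C₁ * (D / N) ≤ (C₁ + 1) * (D * (N : ℝ)⁻¹) := by
        rw [div_eq_mul_inv]; gcongr; linarith
      have h2 : (N : ℝ)⁻¹ ^ 2 ≤ (N : ℝ)⁻¹ := by nlinarith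
      have h3 : 2 * (C₁ + 1) ^ 2 * (N : ℝ)⁻¹ ^ 2 ≤ 2 * (C₁ + 1) ^ 2 * (N : ℝ)⁻¹ := by gcongr
      nlinarith [sq_nonneg (D - 4 * (C₁ + 1) * (N : ℝ)⁻¹)]
    have h1 := (le_abs_self _).trans hmain
    have h2 := mul_le_mul_of_nonneg_right hCL (sq_nonneg D)
    have h3 := mul_le_mul_of_nonneg_right hCτ (sq_nonneg D)
    have h4 : mass N (b r - a r) ≤ W := hmax Set.left_mem_uIcc
    have h5 : 0 ≤ mass N (b r' - a r') := mass_nonneg _ _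
    rw [hc]
    nlinarith
  have hrr : |r - r'| ≤ m * τ := by
    rw [abs_le]; constructor <;> linarith [hr.1, hr.2, hr'.1, hr'.2]
  have key := le_of_short_steps (f := fun ρ => mass N (b ρ - a ρ)) (by positivity) hstep m
    r hr r' hr' hrr
  refine key.trans ?_
  have h5 : 0 ≤ mass N (b r' - a r') := mass_nonneg _ _
  rw [mul_assoc]
  gcongr
  have hc1 : 1 ≤ c := by rw [hc]; nlinarith
  have hmc : (0 : ℝ) ≤ m * c := by positivity
  have hmm : (m : ℝ) * θ ≤ m * c * θ := by
    have : (m : ℝ) ≤ m * c := le_mul_of_one_le_right (by positivity) hc1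
    gcongr
  nlinarith [mul_nonneg hmc h5]

theorem exists_tail_bound {R T : ℝ} (hR : 0 ≤ R) (hT : 0 < T) :
    ∃ C, 0 ≤ C ∧ ∀ (S : Set ℤ) (x : ℝ → ℤ → ℂ), IsSol S x →
      (∀ K, ∀ r ∈ Set.Icc (-T) T, mass K (x r) ≤ R ^ 2) → ∀ N : ℕ, 1 ≤ N → ∀ J : ℕ,
      ∀ r ∈ Set.Icc (-T) T, ∀ r' ∈ Set.Icc (-T) T,
        ∑ n ∈ freqs J \ freqs N, ‖x r n‖ ^ 2 ≤
          (∑ n ∈ freqs J \ freqs N, ‖x r' n‖ ^ 2) + C * (N : ℝ)⁻¹ := by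
  have hosc := oscConst_nonneg
  obtain ⟨B, hB0, hB⟩ := exists_apriori hR hT
  refine ⟨2 * (oscConst * (2 * R ^ 4 + 4 * B * R ^ 3)), by positivity,
    fun S x hx hm N hN J r hr r' hr' => ?_⟩
  obtain ⟨hQ, hC⟩ := hB S x hx hm
  have key : ∀ s ∈ Set.Icc (-T) T, ∀ t ∈ Set.Icc (-T) T, s ≤ t →
      |∑ n ∈ freqs J \ freqs N, ‖x t n‖ ^ 2 - ∑ n ∈ freqs J \ freqs N, ‖x s n‖ ^ 2| ≤
        2 * (oscConst * (2 * R ^ 4 + 4 * B * R ^ 3)) * (N : ℝ)⁻¹ := by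
    intro s hs t ht hst
    refine (hx.abs_tail_sub_le hst (hC.mono hs.1 ht.2 le_rfl le_rfl) (fun K => ?_) hN J).trans_eq
      (by ring)
    exact (intervalIntegral.integral_mono_interval hs.1 hst ht.2
      (Eventually.of_forall fun r => quartNorm_nonneg K r (x r))
      ((continuous_quartNorm hx.cont K).intervalIntegrable _ _)).trans (hQ K)
  rcases le_total r r' with h | h
  · have := (abs_le.1 (key r hr r' hr' h)).1; linarith
  · have := (abs_le.1 (key r' hr' r hr h)).2; linarith

/-! ### Global solutions of ordinary differential equations -/

section ODE

variable {E : Type*} [NormedAddCommGroup E] [NormedSpace ℝ E]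

theorem exists_lipschitzOnWith_ball [FiniteDimensional ℝ E] {G : ℝ → E → E}
    (hG : ContDiff ℝ 1 fun p : ℝ × E => G p.1 p.2) (a b : ℝ) (x₀ : E) (M : ℝ) :
    ∃ K, ∀ t ∈ Set.Icc a b, LipschitzOnWith K (G t) (Metric.closedBall x₀ M) := by
  have hcomp : IsCompact (Set.Icc a b ×ˢ Metric.closedBall x₀ M) :=
    isCompact_Icc.prod (isCompact_closedBall x₀ M)
  obtain ⟨K, hK⟩ :=
    hG.locallyLipschitz.locallyLipschitzOn.exists_lipschitzOnWith_of_compact hcomp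
  refine ⟨K, fun t ht x hx y hy => ?_⟩
  have := hK (Set.mk_mem_prod ht hx) (Set.mk_mem_prod ht hy)
  simpa [Prod.edist_eq] using this

theorem eqOn_of_hasDerivAt [FiniteDimensional ℝ E] {G : ℝ → E → E}
    (hG : ContDiff ℝ 1 fun p : ℝ × E => G p.1 p.2) {a b t₀ : ℝ} (ht₀ : t₀ ∈ Set.Ioo a b)
    {f g : ℝ → E} (hf : ContinuousOn f (Set.Icc a b))
    (hf' : ∀ t ∈ Set.Ioo a b, HasDerivAt f (G t (f t)) t) (hg : ContinuousOn g (Set.Icc a b))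
    (hg' : ∀ t ∈ Set.Ioo a b, HasDerivAt g (G t (g t)) t) (h : f t₀ = g t₀) :
    Set.EqOn f g (Set.Icc a b) := by
  obtain ⟨M₁, h₁⟩ := isCompact_Icc.exists_bound_of_continuousOn hf
  obtain ⟨M₂, h₂⟩ := isCompact_Icc.exists_bound_of_continuousOn hg
  obtain ⟨K, hK⟩ := exists_lipschitzOnWith_ball hG a b 0 (max M₁ M₂)
  refine ODE_solution_unique_of_mem_Icc (K := K) (v := G)
    (s := fun _ => Metric.closedBall 0 (max M₁ M₂))
    (fun t ht => hK t (Set.Ioo_subset_Icc_self ht)) ht₀ hf hf' (fun t ht => ?_) hg hg'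
    (fun t ht => ?_) h
  · simpa using Or.inl (h₁ t (Set.Ioo_subset_Icc_self ht))
  · simpa using Or.inr (h₂ t (Set.Ioo_subset_Icc_self ht))

/-- Since the field vanishes outside a ball it is bounded by some `|C|` on the whole time slab, so a
solution cannot move further than `2T|C|`, and Picard–Lindelöf applies on all of `[-T, T]` at once.
-/
theorem exists_hasDerivAt_Ioo [FiniteDimensional ℝ E] {G : ℝ → E → E}
    (hG : ContDiff ℝ 1 fun p : ℝ × E => G p.1 p.2) {ρ : ℝ} (hρ : ∀ t x, ρ ≤ ‖x‖ → G t x = 0)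
    {T t₀ : ℝ} (ht₀ : t₀ ∈ Set.Icc (-T) T) (x₀ : E) :
    ∃ α : ℝ → E, α t₀ = x₀ ∧ ContinuousOn α (Set.Icc (-T) T) ∧
      ∀ t ∈ Set.Ioo (-T) T, HasDerivAt α (G t (α t)) t := by
  have : CompleteSpace E := FiniteDimensional.complete ℝ E
  have hcomp : IsCompact (Set.Icc (-T) T ×ˢ Metric.closedBall (0 : E) ρ) :=
    isCompact_Icc.prod (isCompact_closedBall 0 ρ)
  obtain ⟨C, hC⟩ := hcomp.exists_bound_of_continuousOn hG.continuous.continuousOn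
  have hbound : ∀ t ∈ Set.Icc (-T) T, ∀ x, ‖G t x‖ ≤ |C| := by
    intro t ht x
    by_cases hx : ρ ≤ ‖x‖
    · rw [hρ t x hx, norm_zero]; exact abs_nonneg C
    · exact (hC (t, x) (Set.mk_mem_prod ht (by simpa using (not_le.1 hx).le))).trans
        (le_abs_self C)
  have hT : 0 ≤ T := by linarith [ht₀.1, ht₀.2]
  obtain ⟨K, hK⟩ := exists_lipschitzOnWith_ball hG (-T) T x₀ (|C| * (2 * T))
  have hPL : IsPicardLindelof G (⟨t₀, ht₀⟩ : Set.Icc (-T) T) x₀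
      (⟨|C| * (2 * T), by positivity⟩ : NNReal) 0 (⟨|C|, abs_nonneg C⟩ : NNReal) K :=
    { lipschitzOnWith := hK
      continuousOn := fun x _ =>
        (hG.continuous.comp (continuous_id.prodMk continuous_const)).continuousOn
      norm_le := fun t ht x _ => hbound t ht x
      mul_max_le := by
        change |C| * max (T - t₀) (t₀ - -T) ≤ |C| * (2 * T) - 0
        rw [sub_zero]
        exact mul_le_mul_of_nonneg_left (max_le (by linarith [ht₀.1]) (by linarith [ht₀.2]))
          (abs_nonneg C) }
  obtain ⟨α, hα0, hα⟩ := hPL.exists_eq_forall_mem_Icc_hasDerivWithinAt₀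
  exact ⟨α, hα0, fun t ht => (hα t ht).continuousWithinAt, fun t ht =>
    (hα t (Set.Ioo_subset_Icc_self ht)).hasDerivAt (Icc_mem_nhds ht.1 ht.2)⟩

/-- Solutions on growing intervals agree by uniqueness; the value at time `t` is read off from the
one with index `⌈|t|⌉₊`. -/
theorem exists_hasDerivAt [FiniteDimensional ℝ E] {G : ℝ → E → E}
    (hG : ContDiff ℝ 1 fun p : ℝ × E => G p.1 p.2) {ρ : ℝ} (hρ : ∀ t x, ρ ≤ ‖x‖ → G t x = 0)
    (t₀ : ℝ) (x₀ : E) : ∃ α : ℝ → E, α t₀ = x₀ ∧ ∀ t, HasDerivAt α (G t (α t)) t := by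
  have hpos : ∀ k : ℕ, 0 < |t₀| + k + 1 := fun k => by positivity
  have hmem : ∀ k : ℕ, t₀ ∈ Set.Ioo (-(|t₀| + k + 1)) (|t₀| + k + 1) := fun k => by
    have := abs_le.1 (le_refl |t₀|)
    have hk : (0 : ℝ) ≤ k := by positivity
    constructor <;> linarith [this.1, this.2]
  choose α hα0 hαc hα using fun k : ℕ =>
    exists_hasDerivAt_Ioo hG hρ (Set.Ioo_subset_Icc_self (hmem k)) x₀
  have hagree : ∀ j k : ℕ, j ≤ k →
      Set.EqOn (α j) (α k) (Set.Icc (-(|t₀| + j + 1)) (|t₀| + j + 1)) := by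
    intro j k hjk
    have hjk' : (j : ℝ) ≤ k := by exact_mod_cast hjk
    exact eqOn_of_hasDerivAt hG (hmem j) (hαc j) (hα j)
      ((hαc k).mono (Set.Icc_subset_Icc (by linarith) (by linarith)))
      (fun t ht => hα k t ⟨by linarith [ht.1], by linarith [ht.2]⟩) (by rw [hα0, hα0])
  have hval : ∀ (k : ℕ) (t : ℝ), |t| ≤ k → α ⌈|t|⌉₊ t = α k t := by
    intro k t ht
    have h1 : ⌈|t|⌉₊ ≤ k := Nat.ceil_le.2 ht
    have h2 := Nat.le_ceil |t|
    refine hagree _ k h1 (abs_le.1 ?_)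
    linarith [abs_nonneg t₀]
  refine ⟨fun t => α ⌈|t|⌉₊ t, hα0 _, fun t => ?_⟩
  obtain ⟨k, hk⟩ := exists_nat_ge (|t| + 1)
  have hev : (fun t => α ⌈|t|⌉₊ t) =ᶠ[𝓝 t] α k := by
    have : ∀ᶠ r in 𝓝 t, |r| < |t| + 1 := continuous_abs.continuousAt.eventually_lt
      continuousAt_const (by simp)
    filter_upwards [this] with r hr using hval k r (hr.le.trans hk)
  have hkt : t ∈ Set.Ioo (-(|t₀| + k + 1)) (|t₀| + k + 1) := by
    have := abs_le.1 (le_refl |t|)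
    have := abs_nonneg t₀
    constructor <;> linarith
  have := (hα k t hkt).congr_of_eventuallyEq hev
  simp only
  rwa [hval k t (by linarith)]

end ODE

/-! ### Fourier coefficients on `L²(𝕋)` -/

theorem fourierCoeff_sub (v w : L2) (n : ℤ) :
    fourierCoeff (v - w : L2) n = fourierCoeff v n - fourierCoeff w n := by
  simp only [← fourierBasis_repr, map_sub]; rfl

theorem fourierCoeff_add (v w : L2) (n : ℤ) :
    fourierCoeff (v + w : L2) n = fourierCoeff v n + fourierCoeff w n := by
  simp only [← fourierBasis_repr, map_add]; rfl

theorem fourierCoeff_sum_smul {ι : Type*} (s : Finset ι) (c : ι → ℂ) (k : ι → ℤ) (n : ℤ) :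
    fourierCoeff (∑ i ∈ s, c i • (fourierLp 2 (k i) : L2) : L2) n =
      ∑ i ∈ s, if k i = n then c i else 0 := by
  classical
  rw [← fourierBasis_repr, map_sum, lp.coeFn_sum, Finset.sum_apply]
  refine Finset.sum_congr rfl fun i _ => ?_
  rw [map_smul, lp.coeFn_smul, Pi.smul_apply, ← coe_fourierBasis, HilbertBasis.repr_self,
    lp.single_apply, Pi.single_apply]
  simp [eq_comm]

theorem continuous_fourierCoeff (n : ℤ) : Continuous fun v : L2 => fourierCoeff v n := by
  have h : ∀ v : L2, fourierCoeff v n = inner ℂ (fourierBasis n : L2) v := fun v => by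
    rw [← fourierBasis_repr, HilbertBasis.repr_apply_apply]
  simp only [h]
  exact continuous_const.inner continuous_id

theorem hasSum_normSq_fourierCoeff (v : L2) :
    HasSum (fun n => ‖fourierCoeff v n‖ ^ 2) (‖v‖ ^ 2) := by
  have h : HasSum (fun i => ‖fourierBasis.repr v i‖ ^ 2) (‖fourierBasis.repr v‖ ^ 2) := by
    apply_mod_cast lp.hasSum_norm ?_ (fourierBasis.repr v)
    simp
  simpa only [fourierBasis_repr, LinearIsometryEquiv.norm_map] using h

theorem fourierCoeff_injective {v w : L2} (h : ∀ n, fourierCoeff v n = fourierCoeff w n) :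
    v = w := by
  have h0 : HasSum (fun n => ‖fourierCoeff (v - w : L2) n‖ ^ 2) 0 := by
    have e : (fun n => ‖fourierCoeff (v - w : L2) n‖ ^ 2) = fun _ => 0 := funext fun n => by
      rw [fourierCoeff_sub, h, sub_self, norm_zero, zero_pow two_ne_zero]
    rw [e]
    exact hasSum_zero
  have := (hasSum_normSq_fourierCoeff (v - w)).unique h0
  exact sub_eq_zero.1 (norm_eq_zero.1 (pow_eq_zero_iff two_ne_zero |>.1 this))

theorem mass_le_normSq (K : ℕ) (v : L2) : mass K (fourierCoeff v) ≤ ‖v‖ ^ 2 :=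
  sum_le_hasSum _ (fun _ _ => by positivity) (hasSum_normSq_fourierCoeff v)

theorem tendsto_freqs : Tendsto freqs atTop atTop := by
  refine tendsto_atTop_finset_of_monotone (fun N K h => freqs_mono h) fun n => ?_
  exact (eventually_mem_freqs n).exists

theorem tendsto_mass (v : L2) :
    Tendsto (fun K => mass K (fourierCoeff v)) atTop (𝓝 (‖v‖ ^ 2)) :=
  (show Tendsto (fun s : Finset ℤ => ∑ n ∈ s, ‖fourierCoeff v n‖ ^ 2) atTop (𝓝 (‖v‖ ^ 2)) by
    simpa [HasSum] using hasSum_normSq_fourierCoeff v).comp tendsto_freqs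

theorem mass_mono (x : ℤ → ℂ) {N K : ℕ} (h : N ≤ K) : mass N x ≤ mass K x :=
  Finset.sum_le_sum_of_subset_of_nonneg (freqs_mono h) fun _ _ _ => by positivity

/-! ### The truncated equation -/

theorem mem_planeTrunc {N : ℕ} {n : ℤ} {p : ℤ × ℤ × ℤ} (hp : p ∈ planeTrunc N n) :
    p.1 ∈ freqs N ∧ p.2.1 ∈ freqs N ∧ p.2.2 ∈ freqs N := by
  simp only [planeTrunc, Finset.mem_filter, Finset.mem_product] at hp
  exact hp.1

theorem seqNonlin_congr {N : ℕ} (t : ℝ) {x y : ℤ → ℂ} (h : ∀ n ∈ freqs N, x n = y n) {n : ℤ}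
    (hn : n ∈ freqs N) : seqNonlin N t x n = seqNonlin N t y n := by
  unfold seqNonlin triSum
  rw [h n hn]
  congr 2
  refine Finset.sum_congr rfl fun p hp => ?_
  obtain ⟨h1, h2, h3⟩ := mem_planeTrunc hp
  rw [h _ h1, h _ h2, h _ h3]

theorem planeTrunc_mono {N K : ℕ} (h : N ≤ K) (n : ℤ) : planeTrunc N n ⊆ planeTrunc K n := by
  intro p hp
  simp only [planeTrunc, Finset.mem_filter, Finset.mem_product] at hp ⊢
  exact ⟨⟨freqs_mono h hp.1.1, freqs_mono h hp.1.2.1, freqs_mono h hp.1.2.2⟩, hp.2⟩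

theorem seqNonlin_eq_of_le {N K : ℕ} (h : N ≤ K) (t : ℝ) {x : ℤ → ℂ}
    (hx : ∀ n ∉ freqs N, x n = 0) (n : ℤ) : seqNonlin K t x n = seqNonlin N t x n := by
  have : triSum N t x x x n = triSum K t x x x n := by
    unfold triSum
    refine Finset.sum_subset (planeTrunc_mono h n) fun p hp hpN => ?_
    by_cases h1 : p.1 ∈ freqs N
    · by_cases h2 : p.2.1 ∈ freqs N
      · by_cases h3 : p.2.2 ∈ freqs N
        · refine absurd ?_ hpN
          simp only [planeTrunc, Finset.mem_filter, Finset.mem_product] at hp ⊢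
          exact ⟨⟨h1, h2, h3⟩, hp.2⟩
        · simp [hx _ h3]
      · simp [hx _ h2]
    · simp [hx _ h1]
  rw [seqNonlin, seqNonlin, this]

/-- Infinitesimal mass conservation: the diagonal term is imaginary against `conj x_n`, and the
non-resonant form is real by `quartSum_self_im`, hence imaginary after multiplication by `-i`. -/
theorem re_sum_seqNonlin (N : ℕ) (t : ℝ) (x : ℤ → ℂ) :
    ∑ n ∈ freqs N, (seqNonlin N t x n * conj (x n)).re = 0 := by
  have h : ∀ n, (seqNonlin N t x n * conj (x n)).re =
      (-Complex.I * (triSum N t x x x n * conj (x n))).re := by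
    intro n
    rw [seqNonlin, add_mul, Complex.add_re, mul_assoc, mul_assoc (_ * _), Complex.mul_conj]
    simp [-Complex.ofReal_pow]
  simp only [h]
  rw [← Complex.re_sum, ← Finset.mul_sum, sum_triSum_mul_conj]
  simp [quartSum_self_im]

/-! ### Global solutions and mass conservation for the truncated equation -/

/-- Extension by zero of finitely many coefficients. -/
def extendZero {N : ℕ} (e : freqs N → ℂ) (n : ℤ) : ℂ := if h : n ∈ freqs N then e ⟨n, h⟩ else 0

theorem extendZero_coe {N : ℕ} (e : freqs N → ℂ) (k : freqs N) : extendZero e k = e k := by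
  simp [extendZero]

/-- The vector field of the truncated equation. -/
def truncField (N : ℕ) (t : ℝ) (e : freqs N → ℂ) (k : freqs N) : ℂ :=
  seqNonlin N t (extendZero e) k

theorem contDiff_truncField (N : ℕ) :
    ContDiff ℝ 1 fun p : ℝ × (freqs N → ℂ) => truncField N p.1 p.2 := by
  have hx : ∀ n, ContDiff ℝ 1 fun p : ℝ × (freqs N → ℂ) => extendZero p.2 n := by
    intro n
    by_cases hn : n ∈ freqs N
    · simp only [extendZero, hn, dif_pos]
      exact (contDiff_apply ℝ ℂ (⟨n, hn⟩ : freqs N)).comp contDiff_snd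
    · simp only [extendZero, hn, dif_neg, not_false_iff]
      exact contDiff_const
  have hconj : ∀ n, ContDiff ℝ 1 fun p : ℝ × (freqs N → ℂ) => conj (extendZero p.2 n) :=
    fun n => Complex.conjCLE.contDiff.comp (hx n)
  have ht : ContDiff ℝ 1 fun p : ℝ × (freqs N → ℂ) => (p.1 : ℂ) :=
    Complex.ofRealCLM.contDiff.comp contDiff_fst
  refine contDiff_pi.2 fun k => ?_
  unfold truncField seqNonlin triSum
  refine ContDiff.add (contDiff_const.mul (ContDiff.sum fun p _ => ?_)) ?_
  · exact (contDiff_const.mul ht).cexp.mul (((hx _).mul (hconj _)).mul (hx _))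
  · exact (contDiff_const.mul (Complex.ofRealCLM.contDiff.comp ((hx _).norm_sq ℝ))).mul (hx _)

/-- The real factor `c` allows for the cutoff: a rescaled field is still tangent to the spheres of
constant mass. -/
theorem hasDerivAt_sum_normSq {N : ℕ} {α : ℝ → freqs N → ℂ} {t : ℝ} {c : ℝ}
    (h : HasDerivAt α (c • truncField N t (α t)) t) :
    HasDerivAt (fun r => ∑ k, ‖α r k‖ ^ 2) 0 t := by
  have h1 : HasDerivAt (fun r => ∑ k, ‖α r k‖ ^ 2)
      (∑ k, 2 * inner ℝ (α t k) ((c • truncField N t (α t)) k)) t := by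
    have := HasDerivAt.fun_sum (u := Finset.univ) fun k _ => (hasDerivAt_pi.1 h k).norm_sq
    exact this
  convert h1 using 1
  have h2 := re_sum_seqNonlin N t (extendZero (α t))
  rw [← Finset.sum_coe_sort (freqs N)] at h2
  have h3 : ∀ k : freqs N, 2 * inner ℝ (α t k) ((c • truncField N t (α t)) k) =
      2 * c * (seqNonlin N t (extendZero (α t)) k * conj (extendZero (α t) k)).re := by
    intro k
    rw [Complex.inner, extendZero_coe, Pi.smul_apply, truncField, Complex.real_smul,
      mul_assoc, Complex.re_ofReal_mul]
    ring
  rw [Finset.sum_congr rfl fun k _ => h3 k, ← Finset.mul_sum, h2, mul_zero]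

theorem normSq_le_sum {N : ℕ} (e : freqs N → ℂ) : ‖e‖ ^ 2 ≤ ∑ k, ‖e k‖ ^ 2 := by
  have h0 : 0 ≤ ∑ k, ‖e k‖ ^ 2 := Finset.sum_nonneg fun _ _ => by positivity
  have : ‖e‖ ≤ √(∑ k, ‖e k‖ ^ 2) := by
    refine (pi_norm_le_iff_of_nonneg (Real.sqrt_nonneg _)).2 fun k => ?_
    exact Real.le_sqrt_of_sq_le
      (Finset.single_le_sum (f := fun k => ‖e k‖ ^ 2) (fun _ _ => by positivity)
        (Finset.mem_univ k))
  calc ‖e‖ ^ 2 ≤ √(∑ k, ‖e k‖ ^ 2) ^ 2 := by gcongr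
    _ = _ := Real.sq_sqrt h0

/-- The field is multiplied by a cutoff `χ` of the mass, equal to `1` up to mass `c` and to `0` from
`c + 1` on. The cut-off flow is global and conserves mass, so it stays at mass `c`, where the cutoff
is invisible. -/
theorem exists_hasDerivAt_truncField (N : ℕ) (t₀ : ℝ) (e₀ : freqs N → ℂ) :
    ∃ α : ℝ → freqs N → ℂ, α t₀ = e₀ ∧ ∀ t, HasDerivAt α (truncField N t (α t)) t := by
  set c : ℝ := ∑ k, ‖e₀ k‖ ^ 2 with hc
  have hc0 : 0 ≤ c := Finset.sum_nonneg fun _ _ => by positivity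
  set χ : (freqs N → ℂ) → ℝ := fun e => Real.smoothTransition (c + 1 - ∑ k, ‖e k‖ ^ 2) with hχ
  have hχd : ContDiff ℝ 1 χ := by
    refine Real.smoothTransition.contDiff.comp (contDiff_const.sub (ContDiff.sum fun k _ => ?_))
    exact (contDiff_apply ℝ ℂ k).norm_sq ℝ
  have hG : ContDiff ℝ 1 fun p : ℝ × (freqs N → ℂ) => χ p.2 • truncField N p.1 p.2 :=
    (hχd.comp contDiff_snd).smul (contDiff_truncField N)
  obtain ⟨α, hα0, hα⟩ := exists_hasDerivAt (G := fun t e => χ e • truncField N t e) hG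
    (ρ := c + 1) (fun t e he => by
      have h1 := normSq_le_sum e
      have h2 : (c + 1) ^ 2 ≤ ‖e‖ ^ 2 := by gcongr
      have : χ e = 0 := Real.smoothTransition.zero_of_nonpos (by nlinarith)
      rw [this, zero_smul]) t₀ e₀
  have hconst : ∀ t, ∑ k, ‖α t k‖ ^ 2 = c := by
    intro t
    rw [hc, ← hα0]
    exact is_const_of_deriv_eq_zero (f := fun r => ∑ k, ‖α r k‖ ^ 2)
      (fun r => (hasDerivAt_sum_normSq (hα r)).differentiableAt)
      (fun r => (hasDerivAt_sum_normSq (hα r)).deriv) t t₀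
  refine ⟨α, hα0, fun t => ?_⟩
  have h1 : χ (α t) = 1 := Real.smoothTransition.one_of_one_le (by rw [hconst]; linarith)
  have := hα t
  rwa [h1, one_smul] at this

/-- The coefficients of frequency at most `N`. -/
def lowCoeff (N : ℕ) (v : L2) (k : freqs N) : ℂ := fourierCoeff v k

theorem extendZero_lowCoeff {N : ℕ} (v : L2) {n : ℤ} (hn : n ∈ freqs N) :
    extendZero (lowCoeff N v) n = fourierCoeff v n := by
  simp [extendZero, hn, lowCoeff]

theorem IsTruncatedSolution.hasDerivAt_lowCoeff {N : ℕ} {v : ℝ → L2}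
    (hv : IsTruncatedSolution N v) (t : ℝ) :
    HasDerivAt (fun r => lowCoeff N (v r)) (truncField N t (lowCoeff N (v t))) t := by
  refine hasDerivAt_pi.2 fun k => ?_
  have := hv.equation k t
  rw [if_pos k.2, nonlinearity_eq] at this
  rw [truncField, seqNonlin_congr t (fun n hn => extendZero_lowCoeff (v t) hn) k.2]
  exact this

theorem IsTruncatedSolution.fourierCoeff_of_notMem {N : ℕ} {v : ℝ → L2}
    (hv : IsTruncatedSolution N v) {n : ℤ} (hn : n ∉ freqs N) (s t : ℝ) :
    fourierCoeff (v t) n = fourierCoeff (v s) n := by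
  have h : ∀ r, HasDerivAt (fun r => fourierCoeff (v r) n) 0 r := fun r => by
    have := hv.equation n r
    rwa [if_neg hn] at this
  exact is_const_of_deriv_eq_zero (f := fun r => fourierCoeff (v r) n)
    (fun r => (h r).differentiableAt) (fun r => (h r).deriv) t s

theorem IsTruncatedSolution.eq_of_eq {N : ℕ} {v w : ℝ → L2} (hv : IsTruncatedSolution N v)
    (hw : IsTruncatedSolution N w) {t₀ : ℝ} (h : v t₀ = w t₀) : v = w := by
  funext t
  refine fourierCoeff_injective fun n => ?_
  by_cases hn : n ∈ freqs N
  · have ht₀ : t₀ ∈ Set.Ioo (-(|t₀| + |t| + 1)) (|t₀| + |t| + 1) := by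
      have := abs_le.1 (le_refl |t₀|)
      have := abs_nonneg t
      constructor <;> linarith
    have ht : t ∈ Set.Icc (-(|t₀| + |t| + 1)) (|t₀| + |t| + 1) := by
      have := abs_le.1 (le_refl |t|)
      have := abs_nonneg t₀
      constructor <;> linarith
    have := eqOn_of_hasDerivAt (contDiff_truncField N) ht₀
      (f := fun r => lowCoeff N (v r)) (g := fun r => lowCoeff N (w r))
      (fun r _ => (hv.hasDerivAt_lowCoeff r).continuousAt.continuousWithinAt)
      (fun r _ => hv.hasDerivAt_lowCoeff r)
      (fun r _ => (hw.hasDerivAt_lowCoeff r).continuousAt.continuousWithinAt)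
      (fun r _ => hw.hasDerivAt_lowCoeff r) (by simp only [h]) ht
    exact congrFun this ⟨n, hn⟩
  · rw [hv.fourierCoeff_of_notMem hn t₀ t, hw.fourierCoeff_of_notMem hn t₀ t, h]

/-- The time `t₀` is arbitrary because the main argument prescribes the value at time `t` rather
than at `0`. The frequencies above `N` are kept frozen at those of `u₀`. -/
theorem exists_isTruncatedSolution (N : ℕ) (t₀ : ℝ) (u₀ : L2) :
    ∃ v, IsTruncatedSolution N v ∧ v t₀ = u₀ := by
  obtain ⟨α, hα0, hα⟩ := exists_hasDerivAt_truncField N t₀ (lowCoeff N u₀)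
  have hαc : ∀ k, Continuous fun r => α r k := fun k =>
    continuous_iff_continuousAt.2 fun r => (hasDerivAt_pi.1 (hα r) k).continuousAt
  set v : ℝ → L2 := fun r => u₀ + ∑ k ∈ (Finset.univ : Finset (freqs N)),
    (α r k - fourierCoeff u₀ k) • (fourierLp 2 (k : ℤ) : L2) with hv
  have hlow : ∀ r (k : freqs N), fourierCoeff (v r) k = α r k := by
    intro r k
    rw [hv, fourierCoeff_add, fourierCoeff_sum_smul, Finset.sum_eq_single k]
    · simp
    · intro i _ hi
      rw [if_neg fun h => hi (Subtype.ext h)]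
    · simp
  have hhigh : ∀ r, ∀ n ∉ freqs N, fourierCoeff (v r) n = fourierCoeff u₀ n := by
    intro r n hn
    rw [hv, fourierCoeff_add, fourierCoeff_sum_smul, Finset.sum_eq_zero, add_zero]
    intro k _
    rw [if_neg fun h : (k : ℤ) = n => hn (h ▸ k.2)]
  refine ⟨v, ⟨?_, fun n t => ?_⟩, ?_⟩
  · exact continuous_const.add (continuous_finsetSum _ fun k _ =>
      ((hαc k).sub continuous_const).smul continuous_const)
  · by_cases hn : n ∈ freqs N
    · rw [if_pos hn, nonlinearity_eq]
      have h1 := hasDerivAt_pi.1 (hα t) ⟨n, hn⟩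
      have h2 : (fun r => fourierCoeff (v r) n) = fun r => α r ⟨n, hn⟩ :=
        funext fun r => hlow r ⟨n, hn⟩
      rw [h2]
      rw [truncField, seqNonlin_congr t (y := fourierCoeff (v t)) (fun m hm => by
        rw [hlow t ⟨m, hm⟩]; simp [extendZero, hm]) hn] at h1
      exact h1
    · rw [if_neg hn]
      simp only [hhigh _ n hn]
      exact hasDerivAt_const t _
  · refine fourierCoeff_injective fun n => ?_
    by_cases hn : n ∈ freqs N
    · rw [hlow t₀ ⟨n, hn⟩, hα0]; rfl
    · exact hhigh t₀ n hn

theorem IsTruncatedSolution.mass_eq {N : ℕ} {v : ℝ → L2} (hv : IsTruncatedSolution N v)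
    (s t : ℝ) : mass N (fourierCoeff (v t)) = mass N (fourierCoeff (v s)) := by
  have h : ∀ r, HasDerivAt (fun r => mass N (fourierCoeff (v r))) 0 r := by
    intro r
    have h1 : (fun r => mass N (fourierCoeff (v r))) =
        fun r => ∑ k, ‖lowCoeff N (v r) k‖ ^ 2 := by
      funext r
      rw [mass, ← Finset.sum_coe_sort (freqs N)]; rfl
    rw [h1]
    exact hasDerivAt_sum_normSq (c := 1) (by simpa using hv.hasDerivAt_lowCoeff r)
  exact is_const_of_deriv_eq_zero (f := fun r => mass N (fourierCoeff (v r)))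
    (fun r => (h r).differentiableAt) (fun r => (h r).deriv) t s

theorem IsTruncatedSolution.norm_eq {N : ℕ} {v : ℝ → L2} (hv : IsTruncatedSolution N v)
    (s t : ℝ) : ‖v t‖ = ‖v s‖ := by
  have h : ∀ K ≥ N, mass K (fourierCoeff (v t)) = mass K (fourierCoeff (v s)) := by
    intro K hK
    have h1 : ∀ r, mass K (fourierCoeff (v r)) = mass N (fourierCoeff (v r)) +
        ∑ n ∈ freqs K \ freqs N, ‖fourierCoeff (v r) n‖ ^ 2 := fun r => by
      rw [mass, mass, add_comm, Finset.sum_sdiff (freqs_mono hK)]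
    rw [h1, h1, hv.mass_eq s t]
    congr 1
    refine Finset.sum_congr rfl fun n hn => ?_
    rw [hv.fourierCoeff_of_notMem (Finset.mem_sdiff.1 hn).2 s t]
  have h2 : ‖v t‖ ^ 2 = ‖v s‖ ^ 2 := tendsto_nhds_unique (tendsto_mass (v t))
    ((tendsto_mass (v s)).congr' (by
      filter_upwards [eventually_ge_atTop N] with K hK using (h K hK).symm))
  exact (sq_eq_sq₀ (norm_nonneg _) (norm_nonneg _)).1 h2

theorem trigPoly_eq_of_le {N K : ℕ} (h : N ≤ K) {u : ℤ → ℂ} (hu : ∀ n ∉ freqs N, u n = 0) :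
    trigPoly K u = trigPoly N u := by
  funext y
  exact (Finset.sum_subset (freqs_mono h) fun n _ hn => by simp [hu n hn]).symm

theorem quartNorm_eq_of_le {N K : ℕ} (h : N ≤ K) (t : ℝ) {x : ℤ → ℂ}
    (hx : ∀ n ∉ freqs N, x n = 0) : quartNorm K t x = quartNorm N t x := by
  rw [quartNorm, quartNorm, trigPoly_eq_of_le h fun n hn => by simp [rot, hx n hn]]

/-- The frozen high frequencies are discarded. On the remaining ones the level-`K` nonlinearity
equals the level-`N` one for `K ≥ N`, so the limit in `IsSol` is eventually constant. -/
theorem IsTruncatedSolution.isSol {N : ℕ} {v : ℝ → L2} (hv : IsTruncatedSolution N v) :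
    IsSol (freqs N) fun r => (freqs N : Set ℤ).indicator (fourierCoeff (v r)) := by
  have hcont : ∀ n, Continuous fun r => (freqs N : Set ℤ).indicator (fourierCoeff (v r)) n :=
    continuous_indicator_apply (x := fun r => fourierCoeff (v r))
      (fun n => (continuous_fourierCoeff n).comp hv.continuous) _
  have hsupp : ∀ r, ∀ n ∉ freqs N, (freqs N : Set ℤ).indicator (fourierCoeff (v r)) n = 0 :=
    fun r n hn => Set.indicator_of_notMem (by simpa using hn) _
  refine ⟨hcont, fun r n hn => hsupp r n (by simpa using hn), fun T hT => ?_, fun n hn s t => ?_⟩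
  -- The integrals at levels above `N` coincide with the one at `N`, so a sum of finitely many
  -- bounds them all.
  · refine ⟨∑ J ∈ Finset.range (N + 1), ∫ r in (-T)..T, quartNorm J r
      ((freqs N : Set ℤ).indicator (fourierCoeff (v r))), fun K => ?_⟩
    have h1 : ∫ r in (-T)..T, quartNorm K r
        ((freqs N : Set ℤ).indicator (fourierCoeff (v r))) =
        ∫ r in (-T)..T, quartNorm (min K N) r
          ((freqs N : Set ℤ).indicator (fourierCoeff (v r))) := by
      rcases le_total K N with h | h
      · rw [min_eq_left h]
      · rw [min_eq_right h]
        simp only [quartNorm_eq_of_le h _ (hsupp _)]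
    rw [h1]
    exact Finset.single_le_sum (f := fun J => ∫ r in (-T)..T, quartNorm J r
      ((freqs N : Set ℤ).indicator (fourierCoeff (v r))))
      (fun J _ => intervalIntegral.integral_nonneg (by linarith)
        fun r _ => quartNorm_nonneg _ _ _)
      (Finset.mem_range.2 (Nat.lt_succ_of_le (min_le_right K N)))
  · have hn' : n ∈ freqs N := hn
    have hd : ∀ r, HasDerivAt (fun r => fourierCoeff (v r) n)
        (seqNonlin N r ((freqs N : Set ℤ).indicator (fourierCoeff (v r))) n) r := by
      intro r
      have := hv.equation n r
      rw [if_pos hn', nonlinearity_eq] at this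
      rwa [seqNonlin_congr r (y := fourierCoeff (v r)) (fun m hm => by simp [hm]) hn']
    have hint := intervalIntegral.integral_eq_sub_of_hasDerivAt (a := s) (b := t)
      (fun r _ => hd r) ((continuous_seqNonlin hcont N n).intervalIntegrable _ _)
    rw [Set.indicator_of_mem hn, Set.indicator_of_mem hn, ← hint]
    refine tendsto_const_nhds.congr' ?_
    filter_upwards [eventually_ge_atTop N] with K hK
    simp only [seqNonlin_eq_of_le hK _ (hsupp _)]

/-! ### High frequency tails -/

/-- The squared norm of the part of `v` at frequencies above `N`. -/
def tail (N : ℕ) (v : L2) : ℝ := ‖v‖ ^ 2 - mass N (fourierCoeff v)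

theorem tail_nonneg (N : ℕ) (v : L2) : 0 ≤ tail N v := sub_nonneg.2 (mass_le_normSq N v)

theorem tendsto_tail (v : L2) : Tendsto (fun N => tail N v) atTop (𝓝 0) := by
  have h := (tendsto_mass v).const_sub (‖v‖ ^ 2)
  rwa [show ‖v‖ ^ 2 - ‖v‖ ^ 2 = 0 from sub_self _] at h

theorem tail_antitone (v : L2) : Antitone fun N => tail N v := fun _ _ h =>
  sub_le_sub_left (mass_mono _ h) _

theorem continuous_tail (N : ℕ) : Continuous (tail N) := by
  unfold tail mass
  exact (continuous_norm.pow 2).sub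
    (continuous_finsetSum _ fun n _ => (continuous_fourierCoeff n).norm.pow 2)

theorem sum_sdiff_eq {N K : ℕ} (h : N ≤ K) (x : ℤ → ℂ) :
    ∑ n ∈ freqs K \ freqs N, ‖x n‖ ^ 2 = mass K x - mass N x := by
  rw [mass, mass, ← Finset.sum_sdiff (freqs_mono h), add_sub_cancel_right]

theorem tendsto_sum_sdiff (N : ℕ) (v : L2) :
    Tendsto (fun K => ∑ n ∈ freqs K \ freqs N, ‖fourierCoeff v n‖ ^ 2) atTop (𝓝 (tail N v)) := by
  refine ((tendsto_mass v).sub_const (mass N (fourierCoeff v))).congr' ?_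
  filter_upwards [eventually_ge_atTop N] with K hK using (sum_sdiff_eq hK _).symm

theorem sum_sdiff_le_tail (N K : ℕ) (v : L2) :
    ∑ n ∈ freqs K \ freqs N, ‖fourierCoeff v n‖ ^ 2 ≤ tail N v := by
  refine ge_of_tendsto (tendsto_sum_sdiff N v) ?_
  filter_upwards [eventually_ge_atTop K] with J hJ
  exact Finset.sum_le_sum_of_subset_of_nonneg (Finset.sdiff_subset_sdiff (freqs_mono hJ) subset_rfl)
    fun _ _ _ => by positivity

theorem tail_sub_le (N : ℕ) (v w : L2) : tail N (v - w) ≤ 2 * tail N v + 2 * tail N w := by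
  refine le_of_tendsto_of_tendsto' (tendsto_sum_sdiff N (v - w))
    (((tendsto_sum_sdiff N v).const_mul 2).add ((tendsto_sum_sdiff N w).const_mul 2)) fun K => ?_
  rw [Finset.mul_sum, Finset.mul_sum, ← Finset.sum_add_distrib]
  refine Finset.sum_le_sum fun n _ => ?_
  rw [fourierCoeff_sub]
  have := norm_sub_le (fourierCoeff v n) (fourierCoeff w n)
  have := norm_nonneg (fourierCoeff v n - fourierCoeff w n)
  nlinarith [sq_nonneg (‖fourierCoeff v n‖ - ‖fourierCoeff w n‖)]

theorem normSq_sub_le (N : ℕ) (v w : L2) :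
    ‖v - w‖ ^ 2 ≤ mass N (fourierCoeff v - fourierCoeff w) + 2 * tail N v + 2 * tail N w := by
  have h : mass N (fourierCoeff (v - w : L2)) = mass N (fourierCoeff v - fourierCoeff w) :=
    Finset.sum_congr rfl fun n _ => by rw [fourierCoeff_sub]; rfl
  have h1 := tail_sub_le N v w
  have h2 : tail N (v - w) = ‖v - w‖ ^ 2 - mass N (fourierCoeff (v - w : L2)) := rfl
  linarith

/-- Dini's theorem: the tails are continuous in `v`, decrease in `N` and tend to `0` pointwise. -/
theorem exists_forall_tail_lt {A : Set L2} (hA : IsCompact A) {δ : ℝ} (hδ : 0 < δ) :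
    ∃ N₀ : ℕ, ∀ N ≥ N₀, ∀ v ∈ A, tail N v < δ := by
  have h : TendstoUniformlyOn tail 0 atTop A :=
    Antitone.tendstoUniformlyOn_of_forall_tendsto hA (fun N => (continuous_tail N).continuousOn)
      (fun v _ => tail_antitone v) continuousOn_const fun v _ => tendsto_tail v
  obtain ⟨N₀, hN₀⟩ := eventually_atTop.1 (Metric.tendstoUniformlyOn_iff.1 h δ hδ)
  refine ⟨N₀, fun N hN v hv => ?_⟩
  have := hN₀ N hN v hv
  rw [Pi.zero_apply, dist_zero_left, Real.norm_eq_abs] at this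
  exact (le_abs_self _).trans_lt this

/-! ### Flows in `L²` -/

/-- `v` solves the equation at the frequencies in `S`, and is constant at the others. -/
structure IsFlow (S : Set ℤ) (v : ℝ → L2) : Prop where
  sol : IsSol S fun r => S.indicator (fourierCoeff (v r))
  const : ∀ n ∉ S, ∀ s t, fourierCoeff (v t) n = fourierCoeff (v s) n

theorem IsTruncatedSolution.isFlow {N : ℕ} {v : ℝ → L2} (hv : IsTruncatedSolution N v) :
    IsFlow (freqs N) v :=
  ⟨hv.isSol, fun _ hn s t => hv.fourierCoeff_of_notMem (by simpa using hn) s t⟩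

theorem IsSolution.isFlow {v : ℝ → L2} (hv : IsSolution v) : IsFlow Set.univ v := by
  have hc : ∀ n, Continuous fun r => fourierCoeff (v r) n := fun n =>
    (continuous_fourierCoeff n).comp hv.continuous
  refine ⟨?_, fun n hn => absurd (Set.mem_univ n) hn⟩
  simp only [Set.indicator_univ]
  refine ⟨hc, fun r n hn => absurd (Set.mem_univ n) hn, fun T hT => hv.memL4 T hT,
    fun n _ s t => ?_⟩
  have h := (hv.equation n t).sub (hv.equation n s)
  rw [sub_sub_sub_cancel_right] at h
  refine h.congr fun K => ?_
  have hi : ∀ p q : ℝ, IntervalIntegrable (fun r => seqNonlin K r (fourierCoeff (v r)) n)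
      volume p q := fun p q =>
    (continuous_seqNonlin (x := fun r => fourierCoeff (v r)) hc K n).intervalIntegrable p q
  exact intervalIntegral.integral_interval_sub_left (hi 0 t) (hi 0 s)

theorem mass_indicator_fourierCoeff_le (S : Set ℤ) (K : ℕ) {v : L2} {R : ℝ} (h : ‖v‖ ≤ R) :
    mass K (S.indicator (fourierCoeff v)) ≤ R ^ 2 :=
  (mass_indicator_le _ _ _).trans ((mass_le_normSq _ _).trans (by gcongr))

theorem IsFlow.exists_tail_le {R T : ℝ} (hR : 0 ≤ R) (hT : 0 < T) :
    ∃ C, 0 ≤ C ∧ ∀ (S : Set ℤ) (v : ℝ → L2), IsFlow S v → (∀ r ∈ Set.Icc (-T) T, ‖v r‖ ≤ R) →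
      ∀ N : ℕ, 1 ≤ N → ∀ r ∈ Set.Icc (-T) T, ∀ r' ∈ Set.Icc (-T) T,
        tail N (v r) ≤ tail N (v r') + C * (N : ℝ)⁻¹ := by
  obtain ⟨C, hC, h⟩ := exists_tail_bound hR hT
  refine ⟨C, hC, fun S v hv hvR N hN r hr r' hr' => ?_⟩
  refine le_of_tendsto_of_tendsto' (tendsto_sum_sdiff N (v r))
    ((tendsto_sum_sdiff N (v r')).add_const _) fun J => ?_
  have h1 := h S _ hv.sol (fun K r hr => mass_indicator_fourierCoeff_le S K (hvR r hr)) N hN J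
    r hr r' hr'
  have h2 : ∑ n ∈ freqs J \ freqs N, (‖fourierCoeff (v r) n‖ ^ 2 - ‖fourierCoeff (v r') n‖ ^ 2) =
      ∑ n ∈ freqs J \ freqs N, (‖S.indicator (fourierCoeff (v r)) n‖ ^ 2 -
        ‖S.indicator (fourierCoeff (v r')) n‖ ^ 2) := by
    refine Finset.sum_congr rfl fun n _ => ?_
    by_cases hn : n ∈ S
    · simp [hn]
    · simp [hn, hv.const n hn r' r]
  rw [Finset.sum_sub_distrib, Finset.sum_sub_distrib] at h2
  linarith

/-- Two flows that agree at one time stay close. Below `N` this is `exists_comparison` with zero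
difference at `r'`; above `N` both tails are within `O(1/N)` of the common tail at `r'`. -/
theorem IsFlow.exists_normSq_sub_le {R T : ℝ} (hR : 0 ≤ R) (hT : 0 < T) :
    ∃ C, 0 ≤ C ∧ ∀ (S : Set ℤ) (N : ℕ) (a b : ℝ → L2), IsFlow (freqs N) a → IsFlow S b →
      (freqs N : Set ℤ) ⊆ S → 1 ≤ N → (∀ r ∈ Set.Icc (-T) T, ‖a r‖ ≤ R) →
      (∀ r ∈ Set.Icc (-T) T, ‖b r‖ ≤ R) → ∀ r ∈ Set.Icc (-T) T, ∀ r' ∈ Set.Icc (-T) T,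
        a r' = b r' → ‖b r - a r‖ ^ 2 ≤ C * (tail N (b r') + (N : ℝ)⁻¹) := by
  obtain ⟨C₁, hC₁, htail⟩ := IsFlow.exists_tail_le hR hT
  obtain ⟨C₂, hC₂, hcomp⟩ := exists_comparison hR hT
  refine ⟨C₂ * (C₁ + 1) + 4 * (C₁ + 1), by positivity,
    fun S N a b ha hb hS hN hRa hRb r hr r' hr' hab => ?_⟩
  have hNi : 0 ≤ (N : ℝ)⁻¹ := by positivity
  have hθ : ∀ r ∈ Set.Icc (-T) T, tail N (b r) ≤ tail N (b r') + C₁ * (N : ℝ)⁻¹ :=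
    fun r hr => htail S b hb hRb N hN r hr r' hr'
  have hθ' := htail _ a ha hRa N hN r hr r' hr'
  rw [hab] at hθ'
  have h0 := tail_nonneg N (b r')
  have hind : ∀ r, mass N (S.indicator (fourierCoeff (b r)) -
      (freqs N : Set ℤ).indicator (fourierCoeff (a r))) =
      mass N (fourierCoeff (b r) - fourierCoeff (a r)) := fun r =>
    Finset.sum_congr rfl fun n hn => by
      rw [Pi.sub_apply, Set.indicator_of_mem (hS hn), Set.indicator_of_mem (by simpa using hn),
        Pi.sub_apply]
  have key := hcomp S N _ _ ha.sol hb.sol hS hN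
    (fun K r hr => mass_indicator_fourierCoeff_le _ K (hRa r hr))
    (fun K r hr => mass_indicator_fourierCoeff_le _ K (hRb r hr))
    (tail N (b r') + C₁ * (N : ℝ)⁻¹) (by positivity) (fun K r hr => by
      refine le_trans (Finset.sum_le_sum fun n _ => ?_)
        ((sum_sdiff_le_tail N K (b r)).trans (hθ r hr))
      gcongr
      exact norm_indicator_le_norm_self _ _) r hr r' hr'
  rw [hind, hind, hab, sub_self] at key
  have hz : mass N (0 : ℤ → ℂ) = 0 := by simp [mass]
  rw [hz, zero_add] at key
  have h3 := normSq_sub_le N (b r) (a r)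
  have h4 := hθ r hr
  have h5 : C₂ * (tail N (b r') + C₁ * (N : ℝ)⁻¹ + (N : ℝ)⁻¹) ≤
      C₂ * (C₁ + 1) * (tail N (b r') + (N : ℝ)⁻¹) := by
    rw [mul_assoc]
    gcongr
    nlinarith
  nlinarith

theorem tendsto_const_mul_tail_add_inv (c : ℝ) (u₀ : L2) :
    Tendsto (fun N : ℕ => c * (tail N u₀ + (N : ℝ)⁻¹)) atTop (𝓝 0) := by
  simpa using ((tendsto_tail u₀).add tendsto_inv_atTop_nhds_zero_nat).const_mul c

/-- The solution of the truncated equation with given initial value. -/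
def truncSol (u₀ : L2) (N : ℕ) : ℝ → L2 := (exists_isTruncatedSolution N 0 u₀).choose

theorem isTruncatedSolution_truncSol (u₀ : L2) (N : ℕ) : IsTruncatedSolution N (truncSol u₀ N) :=
  (exists_isTruncatedSolution N 0 u₀).choose_spec.1

theorem truncSol_zero (u₀ : L2) (N : ℕ) : truncSol u₀ N 0 = u₀ :=
  (exists_isTruncatedSolution N 0 u₀).choose_spec.2

theorem norm_truncSol (u₀ : L2) (N : ℕ) (t : ℝ) : ‖truncSol u₀ N t‖ = ‖u₀‖ := by
  rw [(isTruncatedSolution_truncSol u₀ N).norm_eq 0 t, truncSol_zero]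

theorem mem_Icc_abs_add_one (t : ℝ) : t ∈ Set.Icc (-(|t| + 1)) (|t| + 1) := by
  have := abs_le.1 (le_refl |t|)
  constructor <;> linarith

theorem zero_mem_Icc {T : ℝ} (hT : 0 < T) : (0 : ℝ) ∈ Set.Icc (-T) T :=
  ⟨by linarith, hT.le⟩

/-- Any solution is a limit of the truncated solutions with its initial value; this yields both mass
conservation and uniqueness. Since mass conservation is not yet available for `v`, the radius `R`
comes from continuity on a compact interval. -/
theorem IsSolution.tendsto_truncSol {v : ℝ → L2} (hv : IsSolution v) (t : ℝ) :
    Tendsto (fun N => truncSol (v 0) N t) atTop (𝓝 (v t)) := by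
  have hT : 0 < |t| + 1 := by positivity
  obtain ⟨R, hR⟩ := (isCompact_Icc (a := -(|t| + 1)) (b := |t| + 1)).exists_bound_of_continuousOn
    hv.continuous.continuousOn
  have hR0 : 0 ≤ R := (norm_nonneg _).trans (hR 0 (zero_mem_Icc hT))
  obtain ⟨C, hC, h⟩ := IsFlow.exists_normSq_sub_le hR0 hT
  rw [tendsto_iff_norm_sub_tendsto_zero]
  have hsq : Tendsto (fun N => ‖truncSol (v 0) N t - v t‖ ^ 2) atTop (𝓝 0) := by
    refine squeeze_zero' (Eventually.of_forall fun _ => by positivity) ?_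
      (tendsto_const_mul_tail_add_inv C (v 0))
    filter_upwards [eventually_ge_atTop 1] with N hN
    rw [norm_sub_rev]
    exact h Set.univ N _ v (isTruncatedSolution_truncSol (v 0) N).isFlow hv.isFlow
      (Set.subset_univ _) hN (fun r hr => by rw [norm_truncSol]; exact hR 0 (zero_mem_Icc hT)) hR
      t (mem_Icc_abs_add_one t) 0 (zero_mem_Icc hT) (truncSol_zero _ _)
  simpa using hsq.sqrt

theorem IsSolution.norm_eq {v : ℝ → L2} (hv : IsSolution v) (t : ℝ) : ‖v t‖ = ‖v 0‖ := by
  have := (hv.tendsto_truncSol t).norm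
  simp only [norm_truncSol] at this
  exact tendsto_nhds_unique this tendsto_const_nhds

theorem IsSolution.eq_of_eq {v w : ℝ → L2} (hv : IsSolution v) (hw : IsSolution w)
    (h : v 0 = w 0) : v = w := by
  funext t
  have := hv.tendsto_truncSol t
  rw [h] at this
  exact tendsto_nhds_unique this (hw.tendsto_truncSol t)

/-! ### Existence -/

theorem exists_truncSol_sub_le (u₀ : L2) {T : ℝ} (hT : 0 < T) :
    ∃ C, 0 ≤ C ∧ ∀ N M : ℕ, 1 ≤ N → N ≤ M → ∀ r ∈ Set.Icc (-T) T,
      ‖truncSol u₀ M r - truncSol u₀ N r‖ ^ 2 ≤ C * (tail N u₀ + (N : ℝ)⁻¹) := by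
  obtain ⟨C, hC, h⟩ := IsFlow.exists_normSq_sub_le (norm_nonneg u₀) hT
  refine ⟨C, hC, fun N M hN hM r hr => ?_⟩
  have := h (freqs M) N _ _ (isTruncatedSolution_truncSol u₀ N).isFlow
    (isTruncatedSolution_truncSol u₀ M).isFlow (by exact_mod_cast freqs_mono hM) hN
    (fun r _ => (norm_truncSol u₀ N r).le) (fun r _ => (norm_truncSol u₀ M r).le)
    r hr 0 (zero_mem_Icc hT) (by rw [truncSol_zero, truncSol_zero])
  rwa [truncSol_zero] at this

theorem exists_forall_norm_truncSol_sub_lt (u₀ : L2) {T : ℝ} (hT : 0 < T) {ε : ℝ} (hε : 0 < ε) :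
    ∃ N₀ : ℕ, ∀ N ≥ N₀, ∀ M ≥ N, ∀ r ∈ Set.Icc (-T) T,
      ‖truncSol u₀ M r - truncSol u₀ N r‖ < ε := by
  obtain ⟨C, hC, h⟩ := exists_truncSol_sub_le u₀ hT
  obtain ⟨N₀, hN₀⟩ := eventually_atTop.1
    ((tendsto_const_mul_tail_add_inv C u₀).eventually_lt_const
      (show (0 : ℝ) < ε ^ 2 by positivity))
  refine ⟨max N₀ 1, fun N hN M hM r hr => ?_⟩
  exact lt_of_pow_lt_pow_left₀ 2 hε.le ((h N M ((le_max_right _ _).trans hN) hM r hr).trans_lt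
    (hN₀ N ((le_max_left _ _).trans hN)))

/-- The comparison with `S = freqs M` makes the sequence uniformly Cauchy on bounded time intervals,
so its limit is continuous in time. -/
theorem exists_tendsto_truncSol (u₀ : L2) : ∃ v : ℝ → L2, Continuous v ∧
    ∀ t, Tendsto (fun N => truncSol u₀ N t) atTop (𝓝 (v t)) := by
  have hlim : ∀ t, ∃ w, Tendsto (fun N => truncSol u₀ N t) atTop (𝓝 w) := by
    intro t
    refine cauchySeq_tendsto_of_complete (Metric.cauchySeq_iff'.2 fun ε hε => ?_)
    obtain ⟨N₀, hN₀⟩ := exists_forall_norm_truncSol_sub_lt u₀ (T := |t| + 1) (by positivity) hε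
    refine ⟨N₀, fun M hM => ?_⟩
    rw [dist_eq_norm]
    exact hN₀ N₀ le_rfl M hM t (mem_Icc_abs_add_one t)
  choose v hv using hlim
  refine ⟨v, ?_, hv⟩
  have hu : TendstoLocallyUniformly (truncSol u₀) v atTop := by
    refine Metric.tendstoLocallyUniformly_iff.2 fun ε hε t => ?_
    obtain ⟨N₀, hN₀⟩ := exists_forall_norm_truncSol_sub_lt u₀ (T := |t| + 1) (by positivity)
      (half_pos hε)
    refine ⟨Set.Icc (-(|t| + 1)) (|t| + 1), Icc_mem_nhds ?_ ?_, ?_⟩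
    · have := neg_abs_le t; linarith
    · have := le_abs_self t; linarith
    · filter_upwards [eventually_ge_atTop N₀] with N hN r hr
      rw [dist_eq_norm]
      refine lt_of_le_of_lt ?_ (half_lt_self hε)
      refine le_of_tendsto ((hv r).sub_const _).norm ?_
      filter_upwards [eventually_ge_atTop N] with M hM using (hN₀ N hN M hM r hr).le
  exact hu.continuous (Frequently.of_forall fun N => (isTruncatedSolution_truncSol u₀ N).continuous)

/-- In the product topology the coefficients bounded by `R` form a compact set, so `G` is bounded
there and dominated convergence applies. Quantities at a fixed level `K` involve finitely many
coefficients and are continuous in this topology. -/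
theorem tendsto_integral_of_continuous {E : Type*} [NormedAddCommGroup E] [NormedSpace ℝ E]
    {G : ℝ × (ℤ → ℂ) → E} (hG : Continuous G) {X : ℕ → ℝ → ℤ → ℂ} {x : ℝ → ℤ → ℂ} {R : ℝ}
    (hX : ∀ M n, Continuous fun r => X M r n) (hR : ∀ M r n, ‖X M r n‖ ≤ R)
    (hx : ∀ r n, Tendsto (fun M => X M r n) atTop (𝓝 (x r n))) (s t : ℝ) :
    Tendsto (fun M => ∫ r in s..t, G (r, X M r)) atTop (𝓝 (∫ r in s..t, G (r, x r))) := by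
  have hK : IsCompact (Set.uIcc s t ×ˢ Set.univ.pi fun _ : ℤ => Metric.closedBall (0 : ℂ) R) :=
    isCompact_uIcc.prod (isCompact_univ_pi fun _ => isCompact_closedBall _ _)
  obtain ⟨B, hB⟩ := hK.exists_bound_of_continuousOn hG.continuousOn
  refine intervalIntegral.tendsto_integral_filter_of_dominated_convergence (fun _ => B)
    (Eventually.of_forall fun M => ?_) (Eventually.of_forall fun M => ?_)
    intervalIntegrable_const ?_
  · exact (hG.comp (continuous_id.prodMk (continuous_pi (hX M)))).aestronglyMeasurable
  · refine Eventually.of_forall fun r hr => hB _ ⟨Set.uIoc_subset_uIcc hr, fun n _ => ?_⟩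
    simpa using hR M r n
  · refine Eventually.of_forall fun r _ => ?_
    exact (hG.tendsto (r, x r)).comp (tendsto_const_nhds.prodMk_nhds (tendsto_pi_nhds.2 (hx r)))

theorem continuous_quartNorm_prod (K : ℕ) :
    Continuous fun p : ℝ × (ℤ → ℂ) => quartNorm K p.1 p.2 := by
  simp only [quartNorm_eq]
  unfold quartSum quadExp quadProd mass
  fun_prop

theorem continuous_seqNonlin_prod (K : ℕ) (n : ℤ) :
    Continuous fun p : ℝ × (ℤ → ℂ) => seqNonlin K p.1 p.2 n := by
  unfold seqNonlin triSum
  fun_prop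

theorem norm_fourierCoeff_le (v : L2) (n : ℤ) : ‖fourierCoeff v n‖ ≤ ‖v‖ := by
  obtain ⟨K, hK⟩ := (eventually_mem_freqs n).exists
  exact norm_apply_le_of_mass_le (norm_nonneg v) (mass_le_normSq K v) hK

theorem quartNorm_congr {N : ℕ} (t : ℝ) {x y : ℤ → ℂ} (h : ∀ n ∈ freqs N, x n = y n) :
    quartNorm N t x = quartNorm N t y := by
  have : trigPoly N (rot t x) = trigPoly N (rot t y) := by
    funext z
    exact Finset.sum_congr rfl fun n hn => by rw [rot, rot, h n hn]
  rw [quartNorm, quartNorm, this]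

/-- At frequencies `|n| ≤ K`, the level-`K` nonlinearity of `x` is the level-`M` nonlinearity of its
restriction to `freqs K`, so the general difference estimate applies with the tail of `x` as the
difference and `μ = D`. -/
theorem norm_seqNonlin_sub_truncation_le {K M : ℕ} (h : K ≤ M) (t : ℝ) {x : ℤ → ℂ} {R D : ℝ}
    (hR : 0 ≤ R) (hD : 0 < D) (hx : mass M x ≤ R ^ 2)
    (hd : ∑ n ∈ freqs M \ freqs K, ‖x n‖ ^ 2 ≤ D ^ 2) {n : ℤ} (hn : n ∈ freqs K) :
    ‖seqNonlin M t x n - seqNonlin K t x n‖ ≤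
      D * (3 / 2 + 6 * R ^ 2) + D * (3 / 4) * (quartNorm K t x + quartNorm M t x) := by
  set y := (freqs K : Set ℤ).indicator x with hy
  have hy0 : ∀ m ∉ freqs K, y m = 0 := fun m hm => Set.indicator_of_notMem (by simpa using hm) _
  have hy1 : ∀ m ∈ freqs K, y m = x m := fun m hm => Set.indicator_of_mem (by simpa using hm) _
  have h1 : seqNonlin K t x n = seqNonlin M t y n := by
    rw [seqNonlin_eq_of_le h t hy0, seqNonlin_congr t hy1 hn]
  have h2 : quartNorm K t x = quartNorm M t y := by
    rw [quartNorm_eq_of_le h t hy0, quartNorm_congr t hy1]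
  have h3 : mass M (x - y) ≤ D ^ 2 := by
    refine le_trans (le_of_eq ?_) hd
    rw [mass, ← Finset.sum_sdiff (freqs_mono h), add_eq_left.2]
    · exact Finset.sum_congr rfl fun m hm => by
        rw [Pi.sub_apply, hy0 m (Finset.mem_sdiff.1 hm).2, sub_zero]
    · exact Finset.sum_eq_zero fun m hm => by simp [hy1 m hm]
  rw [h1, h2]
  refine (norm_seqNonlin_sub_le t hR hD.le hD ((mass_indicator_le _ _ _).trans hx) hx h3
    (freqs_mono h hn)).trans_eq ?_
  field_simp
  ring

theorem quartNorm_truncSol {M K : ℕ} (h : K ≤ M) (u₀ : L2) (r : ℝ) :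
    quartNorm K r ((freqs M : Set ℤ).indicator (fourierCoeff (truncSol u₀ M r))) =
      quartNorm K r (fourierCoeff (truncSol u₀ M r)) :=
  quartNorm_congr r fun n hn => Set.indicator_of_mem (by simpa using freqs_mono h hn) _

theorem continuous_truncSol_fourierCoeff (u₀ : L2) (M : ℕ) (n : ℤ) :
    Continuous fun r => fourierCoeff (truncSol u₀ M r) n :=
  (continuous_fourierCoeff n).comp (isTruncatedSolution_truncSol u₀ M).continuous

theorem exists_integral_quartNorm_truncSol_le (u₀ : L2) {T : ℝ} (hT : 0 < T) :
    ∃ B, 0 ≤ B ∧ ∀ K M : ℕ, K ≤ M →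
      ∫ r in (-T)..T, quartNorm K r (fourierCoeff (truncSol u₀ M r)) ≤ B := by
  obtain ⟨B, hB, h⟩ := exists_apriori (norm_nonneg u₀) hT
  refine ⟨B, hB, fun K M hKM => ?_⟩
  have := (h _ _ (isTruncatedSolution_truncSol u₀ M).isSol fun K r _ =>
    mass_indicator_fourierCoeff_le _ K (norm_truncSol u₀ M r).le).1 K
  simpa only [quartNorm_truncSol hKM] using this

theorem integral_seqNonlin_truncSol (u₀ : L2) {M : ℕ} {n : ℤ} (hn : n ∈ freqs M) (t : ℝ) :
    ∫ r in (0 : ℝ)..t, seqNonlin M r (fourierCoeff (truncSol u₀ M r)) n =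
      fourierCoeff (truncSol u₀ M t) n - fourierCoeff u₀ n := by
  have hd : ∀ r, HasDerivAt (fun r => fourierCoeff (truncSol u₀ M r) n)
      (seqNonlin M r (fourierCoeff (truncSol u₀ M r)) n) r := fun r => by
    have := (isTruncatedSolution_truncSol u₀ M).equation n r
    rwa [if_pos hn, nonlinearity_eq] at this
  rw [intervalIntegral.integral_eq_sub_of_hasDerivAt (fun r _ => hd r)
    ((continuous_seqNonlin (continuous_truncSol_fourierCoeff u₀ M) M n).intervalIntegrable _ _),
    truncSol_zero]

/-- The bound is uniform in `M ≥ K`, which permits the interchange of the limits `M → ∞` and `K →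
∞`. Here `D K` is the square root of the tail of `u₀` plus `1/K`, up to a constant, and tail
propagation transfers it to all times. -/
theorem exists_integral_seqNonlin_truncSol_sub_le (u₀ : L2) {T : ℝ} (hT : 0 < T) :
    ∃ (c : ℝ) (D : ℕ → ℝ), Tendsto D atTop (𝓝 0) ∧ ∀ K M : ℕ, 1 ≤ K → K ≤ M →
      ∀ n ∈ freqs K, ∀ t ∈ Set.Icc (-T) T,
      ‖(fourierCoeff (truncSol u₀ M t) n - fourierCoeff u₀ n) -
        ∫ r in (0 : ℝ)..t, seqNonlin K r (fourierCoeff (truncSol u₀ M r)) n‖ ≤ c * D K := by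
  obtain ⟨B, hB, hQ⟩ := exists_integral_quartNorm_truncSol_le u₀ hT
  obtain ⟨C, hC, htail⟩ := IsFlow.exists_tail_le (norm_nonneg u₀) hT
  refine ⟨2 * T * (3 / 2 + 6 * ‖u₀‖ ^ 2) + 3 / 4 * (B + B),
    fun K => √((C + 1) * (tail K u₀ + (K : ℝ)⁻¹)), ?_, fun K M hK hKM n hn t ht => ?_⟩
  · simpa using (tendsto_const_mul_tail_add_inv (C + 1) u₀).sqrt
  set D := √((C + 1) * (tail K u₀ + (K : ℝ)⁻¹)) with hDdef
  have hK' : (0 : ℝ) < (K : ℝ)⁻¹ := by positivity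
  have h0 := tail_nonneg K u₀
  have hD : 0 < D := Real.sqrt_pos.2 (by positivity)
  have hD2 : D ^ 2 = (C + 1) * (tail K u₀ + (K : ℝ)⁻¹) := Real.sq_sqrt (by positivity)
  have hx := continuous_truncSol_fourierCoeff u₀ M
  have hint : ∀ J, IntervalIntegrable
      (fun r => seqNonlin J r (fourierCoeff (truncSol u₀ M r)) n) volume 0 t :=
    fun J => (continuous_seqNonlin hx J n).intervalIntegrable _ _
  rw [← integral_seqNonlin_truncSol u₀ (freqs_mono hKM hn) t,
    ← intervalIntegral.integral_sub (hint M) (hint K)]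
  set g : ℝ → ℝ := fun r => quartNorm K r (fourierCoeff (truncSol u₀ M r)) +
    quartNorm M r (fourierCoeff (truncSol u₀ M r)) with hg
  have hgK := continuous_quartNorm hx K
  have hgM := continuous_quartNorm hx M
  have hgc : Continuous g := hgK.add hgM
  have hg0 : ∀ r, 0 ≤ g r := fun r => add_nonneg (quartNorm_nonneg _ _ _) (quartNorm_nonneg _ _ _)
  have hbound : ∀ r ∈ Set.Icc (-T) T, ‖seqNonlin M r (fourierCoeff (truncSol u₀ M r)) n -
      seqNonlin K r (fourierCoeff (truncSol u₀ M r)) n‖ ≤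
        D * (3 / 2 + 6 * ‖u₀‖ ^ 2) + D * (3 / 4) * g r := by
    intro r hr
    refine norm_seqNonlin_sub_truncation_le hKM r (norm_nonneg u₀) hD ?_ ?_ hn
    · rw [← norm_truncSol u₀ M r]; exact mass_le_normSq _ _
    · refine (sum_sdiff_le_tail K M _).trans ?_
      have := htail _ _ (isTruncatedSolution_truncSol u₀ M).isFlow
        (fun r _ => (norm_truncSol u₀ M r).le) K hK r hr 0 (zero_mem_Icc hT)
      rw [truncSol_zero] at this
      rw [hD2]
      nlinarith
  set F : ℝ → ℝ := fun r => D * (3 / 2 + 6 * ‖u₀‖ ^ 2) + D * (3 / 4) * g r with hF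
  have hFc : Continuous F := continuous_const.add (continuous_const.mul hgc)
  have hF0 : ∀ r, 0 ≤ F r := fun r => by
    have := hg0 r
    positivity
  have hle : ‖∫ r in (0 : ℝ)..t, (seqNonlin M r (fourierCoeff (truncSol u₀ M r)) n -
      seqNonlin K r (fourierCoeff (truncSol u₀ M r)) n)‖ ≤ ∫ r in (-T)..T, F r := by
    have hsub : Set.uIcc 0 t ⊆ Set.Icc (-T) T := Set.uIcc_subset_Icc (zero_mem_Icc hT) ht
    rw [intervalIntegral.norm_integral_eq_norm_integral_uIoc]
    rw [intervalIntegral.integral_of_le (by linarith)]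
    have hsub' : Set.uIoc 0 t ⊆ Set.Ioc (-T) T := by
      rw [Set.uIoc]
      exact Set.Ioc_subset_Ioc (le_min (by linarith) ht.1) (max_le hT.le ht.2)
    have hFi : IntegrableOn F (Set.Ioc (-T) T) :=
      (hFc.integrableOn_Icc).mono_set Set.Ioc_subset_Icc_self
    refine (norm_integral_le_of_norm_le (hFi.mono_set hsub') ?_).trans
      (setIntegral_mono_set hFi (Eventually.of_forall hF0) hsub'.eventuallyLE)
    refine (ae_restrict_iff' measurableSet_uIoc).2 (Eventually.of_forall fun r hr => ?_)
    exact hbound r (hsub (Set.uIoc_subset_uIcc hr))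
  refine hle.trans ?_
  rw [hF, integral_const_add_const_mul hgc, hg, intervalIntegral.integral_add
    (hgK.intervalIntegrable _ _) (hgM.intervalIntegrable _ _)]
  have h1 := hQ K M hKM
  have h2 := hQ M M le_rfl
  have : D * (3 / 4) * ((∫ r in (-T)..T, quartNorm K r (fourierCoeff (truncSol u₀ M r))) +
      ∫ r in (-T)..T, quartNorm M r (fourierCoeff (truncSol u₀ M r))) ≤
      D * (3 / 4) * (B + B) := by gcongr
  linarith

/-- For fixed `K` let `M → ∞` in the `L⁴` bound and in the integrated equation; then let `K → ∞` in
the latter, where the error is at most `c * D K`. -/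
theorem exists_isSolution (u₀ : L2) : ∃ v, IsSolution v ∧ v 0 = u₀ := by
  obtain ⟨v, hvc, hv⟩ := exists_tendsto_truncSol u₀
  have hv0 : v 0 = u₀ := by
    refine tendsto_nhds_unique (hv 0) ?_
    simp only [truncSol_zero]
    exact tendsto_const_nhds
  have hcoeff : ∀ r n, Tendsto (fun M => fourierCoeff (truncSol u₀ M r) n) atTop
      (𝓝 (fourierCoeff (v r) n)) := fun r n => ((continuous_fourierCoeff n).tendsto _).comp (hv r)
  have hbd : ∀ M r n, ‖fourierCoeff (truncSol u₀ M r) n‖ ≤ ‖u₀‖ := fun M r n =>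
    (norm_fourierCoeff_le _ n).trans (norm_truncSol u₀ M r).le
  have hcont := continuous_truncSol_fourierCoeff u₀
  refine ⟨v, ⟨hvc, fun T hT => ?_, fun n t => ?_⟩, hv0⟩
  · obtain ⟨B, -, hQ⟩ := exists_integral_quartNorm_truncSol_le u₀ hT
    refine ⟨B, fun K => ?_⟩
    refine le_of_tendsto (tendsto_integral_of_continuous (continuous_quartNorm_prod K)
      hcont hbd hcoeff (-T) T) ?_
    filter_upwards [eventually_ge_atTop K] with M hM using hQ K M hM
  · obtain ⟨c, D, hD, h⟩ := exists_integral_seqNonlin_truncSol_sub_le u₀ (T := |t| + 1)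
      (by positivity)
    rw [tendsto_iff_norm_sub_tendsto_zero]
    have hcD : Tendsto (fun K => c * D K) atTop (𝓝 0) := by simpa using hD.const_mul c
    refine squeeze_zero' (Eventually.of_forall fun _ => norm_nonneg _) ?_ hcD
    filter_upwards [eventually_ge_atTop 1, eventually_mem_freqs n] with K hK hn
    rw [norm_sub_rev, hv0]
    refine le_of_tendsto (((hcoeff t n).sub_const _).sub (tendsto_integral_of_continuous
      (continuous_seqNonlin_prod K n) hcont hbd hcoeff 0 t)).norm ?_
    filter_upwards [eventually_ge_atTop K] with M hM
    exact h K M hK hM n hn t (mem_Icc_abs_add_one t)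

/-! ### The flows -/

/-- Uniqueness makes the choice in `solutionMap` irrelevant. -/
theorem solutionMap_eq {Sol : (ℝ → L2) → Prop}
    (h : ∀ v w, Sol v → Sol w → v 0 = w 0 → v = w) {v : ℝ → L2} (hv : Sol v) (t : ℝ) :
    solutionMap Sol t (v 0) = v t := by
  have hex : ∃ w, Sol w ∧ w 0 = v 0 := ⟨v, hv, rfl⟩
  rw [solutionMap, dif_pos hex, h _ v hex.choose_spec.1 hv hex.choose_spec.2]

theorem IsSolution.Psi_eq {v : ℝ → L2} (hv : IsSolution v) (t : ℝ) : Psi t (v 0) = v t :=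
  solutionMap_eq (fun _ _ hv hw h => hv.eq_of_eq hw h) hv t

theorem IsTruncatedSolution.PsiTrunc_eq {N : ℕ} {v : ℝ → L2} (hv : IsTruncatedSolution N v)
    (t : ℝ) : PsiTrunc N t (v 0) = v t :=
  solutionMap_eq (fun _ _ hv hw h => hv.eq_of_eq hw h) hv t

theorem exists_Psi_image_subset {R : ℝ} (hR : 0 < R) {A : Set L2} (hA : IsCompact A)
    (hAR : A ⊆ Metric.ball 0 R) (t : ℝ) {ε : ℝ} (hε : 0 < ε) :
    ∃ N₀ : ℕ, ∀ N : ℕ, N₀ ≤ N → Psi t '' A ⊆ PsiTrunc N t '' (A + Metric.ball 0 ε) := by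
  have hT : 0 < |t| + 1 := by positivity
  obtain ⟨C, hC, h⟩ := IsFlow.exists_normSq_sub_le hR.le hT
  obtain ⟨C', hC', htail⟩ := IsFlow.exists_tail_le hR.le hT
  -- With tails of `A` and `1/N` both below `δ`, the tail of `v t` is at most `δ + C' δ`, and a
  -- further `δ` covers the `1/N` of the comparison.
  obtain ⟨δ, hδ, hδε⟩ : ∃ δ : ℝ, 0 < δ ∧ C * (δ + (C' + 1) * δ) < ε ^ 2 := by
    refine ⟨ε ^ 2 / (C * (C' + 2) + 1), by positivity, ?_⟩
    have : C * (ε ^ 2 / (C * (C' + 2) + 1) + (C' + 1) * (ε ^ 2 / (C * (C' + 2) + 1))) =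
        C * (C' + 2) / (C * (C' + 2) + 1) * ε ^ 2 := by field_simp; ring
    rw [this]
    refine mul_lt_of_lt_one_left (by positivity) ?_
    rw [div_lt_one (by positivity)]
    linarith
  obtain ⟨N₁, hN₁⟩ := exists_forall_tail_lt hA hδ
  obtain ⟨N₂, hN₂⟩ := eventually_atTop.1
    ((tendsto_inv_atTop_nhds_zero_nat (𝕜 := ℝ)).eventually_lt_const hδ)
  refine ⟨max (max N₁ N₂) 1, fun N hN => ?_⟩
  have hN1 : N₁ ≤ N := (le_max_left _ _).trans ((le_max_left _ _).trans hN)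
  have hN2 : N₂ ≤ N := (le_max_right _ _).trans ((le_max_left _ _).trans hN)
  have hN3 : 1 ≤ N := (le_max_right _ _).trans hN
  rintro _ ⟨u₀, hu₀, rfl⟩
  obtain ⟨v, hv, rfl⟩ := exists_isSolution u₀
  -- The truncated solution is matched with `v` at time `t`; its value at time `0` is the required
  -- preimage.
  obtain ⟨a, ha, hat⟩ := exists_isTruncatedSolution N t (v t)
  rw [hv.Psi_eq]
  refine ⟨a 0, ⟨v 0, hu₀, a 0 - v 0, ?_, add_sub_cancel _ _⟩, by rw [ha.PsiTrunc_eq, hat]⟩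
  have hvR : ∀ r ∈ Set.Icc (-(|t| + 1)) (|t| + 1), ‖v r‖ ≤ R := fun r _ => by
    rw [hv.norm_eq]
    exact (mem_ball_zero_iff.1 (hAR hu₀)).le
  have haR : ∀ r ∈ Set.Icc (-(|t| + 1)) (|t| + 1), ‖a r‖ ≤ R := fun r _ => by
    rw [ha.norm_eq t r, hat]
    exact hvR t (mem_Icc_abs_add_one t)
  have h1 := h Set.univ N a v ha.isFlow hv.isFlow (Set.subset_univ _) hN3 haR hvR
    0 (zero_mem_Icc hT) t (mem_Icc_abs_add_one t) hat
  have h2 := htail _ v hv.isFlow hvR N hN3 t (mem_Icc_abs_add_one t) 0 (zero_mem_Icc hT)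
  have h3 := hN₁ N hN1 _ hu₀
  have h4 := hN₂ N hN2
  rw [mem_ball_zero_iff, ← norm_neg, neg_sub]
  refine lt_of_pow_lt_pow_left₀ 2 hε.le (h1.trans_lt (lt_of_le_of_lt ?_ hδε))
  have h5 : C' * (N : ℝ)⁻¹ ≤ C' * δ := by gcongr
  exact mul_le_mul_of_nonneg_left (by linarith) hC

end FourthOrderNLS

end

theorem propositionB3 :
    -- the solution maps are well defined: global existence and uniqueness in `L²(𝕋)`
    (∀ u₀ : FourthOrderNLS.L2, ∃! v : ℝ → FourthOrderNLS.L2,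
        FourthOrderNLS.IsSolution v ∧ v 0 = u₀) ∧
    (∀ (N : ℕ) (u₀ : FourthOrderNLS.L2), ∃! v : ℝ → FourthOrderNLS.L2,
        FourthOrderNLS.IsTruncatedSolution N v ∧ v 0 = u₀) ∧
    -- the approximation property
    (∀ (R : ℝ), 0 < R → ∀ A : Set FourthOrderNLS.L2, IsCompact A → A ⊆ Metric.ball 0 R →
      ∀ (t ε : ℝ), 0 < ε → ∃ N₀ : ℕ, ∀ N : ℕ, N₀ ≤ N →
        FourthOrderNLS.Psi t '' A ⊆
          FourthOrderNLS.PsiTrunc N t '' (A + Metric.ball 0 ε)) := by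
  refine ⟨fun u₀ => ?_, fun N u₀ => ?_, fun R hR A hA hAR t ε hε =>
    FourthOrderNLS.exists_Psi_image_subset hR hA hAR t hε⟩
  · obtain ⟨v, hv, hv0⟩ := FourthOrderNLS.exists_isSolution u₀
    exact ⟨v, ⟨hv, hv0⟩, fun w hw => hw.1.eq_of_eq hv (hw.2.trans hv0.symm)⟩
  · obtain ⟨v, hv, hv0⟩ := FourthOrderNLS.exists_isTruncatedSolution N 0 u₀
    exact ⟨v, ⟨hv, hv0⟩, fun w hw => hw.1.eq_of_eq hv (hw.2.trans hv0.symm)⟩
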